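/- Consider finite $n$-player extensive-form games with perfect recall, with set of histories $H$, terminal histories $Z$, chance probabilities, information sets $I\in\mathcal I_i$ with action sets $A_I$, utilities $u_i:Z\to\mathbb Q$, and pure strategies $X_i=\prod_{I\in\mathcal I_i}A_I$; assume $n\le|H|$ for the running time. All numbers are rational, and $b$ denotes a bound on the bit lengths of their numerators and denominators. Write $x_i(z)$, $x_i(I)$, $x_i(Ja)\in\{0,1\}$ for the indicators that the pure strategy $x_i$ plays all actions of player $i$ on the path from the root to the node $z$, to the information set $I$, or to the sequence $Ja$ (that is, to $J$ and then plays $a$ at $J$); $x_i(z|I)$ for the indicator that it does so on the path from $I$ to $z$; and $p(z)$ for the probability that chance plays to $z$. For a pure profile $x$ put $u_i(x)=\sum_{z\in Z}u_i(z)\,p(z)\prod_j x_j(z)$ and $u_i(x;I)=\sum_{z\in Z,\,z\succ I}u_i(z)\,p(z)\,x_i(z|I)\prod_{j\ne i}x_j(z)$. Let $\pi$ be a distribution over pure profiles. It is an $\varepsilon$-EFCE if $\mathbb E_{x\sim\pi}[u_i(\phi(x_i),x_{-i})-u_i(x)]\le\varepsilon$ for every player $i$ and every causal deviation $\phi:X_i\to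 X_i$, i.e. one for which $\phi(x_i)$ at $I$ depends only on $I$ and the values $x_i(Ja)$, $J\preceq I$. It is an $\varepsilon$-BCE if $\mathbb E_{x\sim\pi}[u_i(\phi(x_i),x_{-i};I)-u_i(x;I)]\le\varepsilon$ for every player $i$, every $I\in\mathcal I_i$ and every behavioral deviation $\phi$, i.e. one for which $\phi(x_i)$ at $I$ depends only on $I$ and the actions of $x_i$ at the information sets $J\preceq I$. A mixture of small-support products is a distribution $\pi=\sum_{t=1}^T\alpha^{(t)}\bigotimes_{i=1}^n\pi_i^{(t)}$ with $\pi_i^{(t)}=\sum_{k=1}^K\beta_i^{(t,k)}x_i^{(t,k)}$, where the $x_i^{(t,k)}$ are pure strategies and the weights are nonnegative with $\sum_t\alpha^{(t)}=1$ and $\sum_k\beta_i^{(t,k)}=1$; it is given by the list of all $\alpha^{(t)},\beta_i^{(t,k)},x_i^{(t,k)}$. Theorem. There is an algorithm that takes as input such a game and an $\varepsilon$-EFCE $\pi$ of it as a mixture of $T$ products of $K$-support mixed strategies ($\varepsilon$ is not part of the input), runs in time $\mathrm{poly}(|H|,T,K,b)$ (hence in time $\mathrm{poly}(|H|,T,K)$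 if all numbers have $\mathrm{poly}(|H|)$ bits), and returns an $\varepsilon$-BCE $\pi'$ in the same format, with the same $T$ and $K$. The distribution $\pi'$ induces the same distribution over terminal histories as $\pi$, and it is obtained from $\pi$ as follows. There are strategies $x_i^{Ja}$, for all $i$, $J\in\mathcal I_i$ and $a\in A_J$, that are conditional counterfactual best responses: $x_i^{Ja}$ maximizes $\mathbb E_{x\sim\pi}[u_i(x_i',x_{-i};I)\mid x_i(Ja)=1]$ over $x_i'\in X_i$ at $I=J$ and at every information set $I\succeq J$ of player $i$ (no condition if the conditioning event has probability $0$). All weights are kept, and each $x_i^{(t,k)}$ is kept at the information sets $I$ with $x_i^{(t,k)}(I)=1$; at every other information set $I$ of player $i$, its action is replaced by that of $x_i^{Ja}$ at $I$, where $Ja$ is the sequence at which $x_i^{(t,k)}$ leaves the path to $I$, that is, $x_i^{(t,k)}(Ja)=1$, $J\preceq I$ and $Ja\not\preceq I$. -/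

import Mathlib

open scoped BigOperators

/-! ## The machine model: programs on binary trees with integer leaves, with bit cost -/

/-- Data values: binary trees whose leaves are integers. -/
inductive Data : Type
  | num (z : ℤ) : Data
  | pair (a b : Data) : Data

/-- Length of a value written as a string: bits of all the integers (plus one symbol for the
sign), plus one symbol for each internal node. -/
def Data.size : Data → ℕ
  | .num z => Nat.size z.natAbs + 1
  | .pair a b => a.size + b.size + 1

/-- The elementary operations. -/
inductive Prim : Type
  | ident
  | const (z : ℤ)
  | fst
  | snd
  | isPair
  | add
  | sub
  | mul
  | div
  | lt

/-- Meaning of the elementary operations; an operation applied to an argument of the wrong shape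
returns `0`. Integer division is the Euclidean one, and division by `0` returns `0`. -/
def Prim.apply : Prim → Data → Data
  | .ident, x => x
  | .const z, _ => .num z
  | .fst, .pair a _ => a
  | .snd, .pair _ b => b
  | .isPair, .pair _ _ => .num 1
  | .add, .pair (.num a) (.num b) => .num (a + b)
  | .sub, .pair (.num a) (.num b) => .num (a - b)
  | .mul, .pair (.num a) (.num b) => .num (a * b)
  | .div, .pair (.num a) (.num b) => .num (a / b)
  | .lt, .pair (.num a) (.num b) => .num (if a < b then 1 else 0)
  | _, _ => .num 0

/-- Programs. A program transforms one data value into another. `seq p q` runs `p` and then `q`;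
`both p q` runs `p` and `q` on the same input and pairs the results; `cond c p q` branches on
whether `c` returns something other than `0`; `loop c p` is `while c do p`. -/
inductive Prog : Type
  | prim (o : Prim)
  | seq (p q : Prog)
  | both (p q : Prog)
  | cond (c p q : Prog)
  | loop (c p : Prog)

/-- `p.Runs x y k`: on input `x` the program `p` halts with output `y` after `k` time units.
Each elementary operation is charged the square of the total length of its argument and its
result (enough for schoolbook arithmetic), and each duplication of a value its length. -/
inductive Prog.Runs : Prog → Data → Data → ℕ → Prop
  | prim (o : Prim) (x : Data) :
      Prog.Runs (.prim o) x (o.apply x) ((x.size + (o.apply x).size) ^ 2)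
  | seq {p q : Prog} {x y z : Data} {k l : ℕ} :
      Prog.Runs p x y k → Prog.Runs q y z l → Prog.Runs (.seq p q) x z (k + l + 1)
  | both {p q : Prog} {x y z : Data} {k l : ℕ} :
      Prog.Runs p x y k → Prog.Runs q x z l →
        Prog.Runs (.both p q) x (.pair y z) (k + l + x.size + 1)
  | cond_true {c p q : Prog} {x v y : Data} {k l : ℕ} :
      Prog.Runs c x v k → v ≠ .num 0 → Prog.Runs p x y l →
        Prog.Runs (.cond c p q) x y (k + l + x.size + 1)
  | cond_false {c p q : Prog} {x y : Data} {k l : ℕ} :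
      Prog.Runs c x (.num 0) k → Prog.Runs q x y l →
        Prog.Runs (.cond c p q) x y (k + l + x.size + 1)
  | loop_step {c p : Prog} {x v y z : Data} {k l r : ℕ} :
      Prog.Runs c x v k → v ≠ .num 0 → Prog.Runs p x y l → Prog.Runs (.loop c p) y z r →
        Prog.Runs (.loop c p) x z (k + l + r + x.size + 1)
  | loop_stop {c p : Prog} {x : Data} {k : ℕ} :
      Prog.Runs c x (.num 0) k → Prog.Runs (.loop c p) x x (k + x.size + 1)

/-- Execution is deterministic: output and running time are determined by the input. -/
theorem Prog.Runs.deterministic {p : Prog} {x y y' : Data} {k k' : ℕ}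
    (h : p.Runs x y k) (h' : p.Runs x y' k') : y = y' ∧ k = k' := by
  induction h generalizing y' k' with
  | prim o x => cases h'; exact ⟨rfl, rfl⟩
  | seq _ _ ih₁ ih₂ =>
    cases h' with
    | seq a b =>
      obtain ⟨rfl, rfl⟩ := ih₁ a
      obtain ⟨rfl, rfl⟩ := ih₂ b
      exact ⟨rfl, rfl⟩
  | both _ _ ih₁ ih₂ =>
    cases h' with
    | both a b =>
      obtain ⟨rfl, rfl⟩ := ih₁ a
      obtain ⟨rfl, rfl⟩ := ih₂ b
      exact ⟨rfl, rfl⟩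
  | cond_true _ hv _ ih₁ ih₂ =>
    cases h' with
    | cond_true a _ b =>
      obtain ⟨rfl, rfl⟩ := ih₁ a
      obtain ⟨rfl, rfl⟩ := ih₂ b
      exact ⟨rfl, rfl⟩
    | cond_false a b => exact absurd (ih₁ a).1 hv
  | cond_false _ _ ih₁ ih₂ =>
    cases h' with
    | cond_true a hv b => exact absurd (ih₁ a).1.symm hv
    | cond_false a b =>
      obtain ⟨_, rfl⟩ := ih₁ a
      obtain ⟨rfl, rfl⟩ := ih₂ b
      exact ⟨rfl, rfl⟩
  | loop_step _ hv _ _ ih₁ ih₂ ih₃ =>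
    cases h' with
    | loop_step a _ b c =>
      obtain ⟨rfl, rfl⟩ := ih₁ a
      obtain ⟨rfl, rfl⟩ := ih₂ b
      obtain ⟨rfl, rfl⟩ := ih₃ c
      exact ⟨rfl, rfl⟩
    | loop_stop a => exact absurd (ih₁ a).1 hv
  | loop_stop _ ih₁ =>
    cases h' with
    | loop_step a hv b c => exact absurd (ih₁ a).1.symm hv
    | loop_stop a =>
      obtain ⟨_, rfl⟩ := ih₁ a
      exact ⟨rfl, rfl⟩

/-! ## Extensive-form games -/

/-- A finite extensive-form game with rational data. The histories are
`0, …, numEdges`, listed so that each one comes after its parent; `0` is the root, and the edge `e`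
enters the history `e + 1`. The actions available at a history `h` are `0, …, d - 1`, where `d` is
the number of children of `h`. A history without children is terminal. A history with children is a
chance node if `infoset` is `none` there, and otherwise it belongs to the given information set. -/
structure Game where
  numPlayers : ℕ
  numEdges : ℕ
  numInfosets : ℕ
  /-- the history that the edge leaves -/
  parent : Fin numEdges → Fin (numEdges + 1)
  parent_le : ∀ e, parent e ≤ e.castSucc
  /-- the action that labels the edge -/
  action : Fin numEdges → ℕ
  action_lt : ∀ e, action e < (Finset.univ.filter fun e' => parent e' = parent e).card
  action_inj : ∀ e e', parent e = parent e' → action e = action e' → e = e'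
  infoset : Fin (numEdges + 1) → Option (Fin numInfosets)
  infoset_nonempty : ∀ I, ∃ h, infoset h = some I
  /-- the player who acts at the information set -/
  owner : Fin numInfosets → Fin numPlayers
  /-- the number of actions at the information set -/
  numActions : Fin numInfosets → ℕ
  numActions_pos : ∀ I, 0 < numActions I
  card_children : ∀ h I, infoset h = some I →
    (Finset.univ.filter fun e => parent e = h).card = numActions I
  /-- the probability of the edge at a chance node; edges of players carry the value `1` -/
  prob : Fin numEdges → ℚ
  prob_nonneg : ∀ e, 0 ≤ prob e
  prob_sum : ∀ h, infoset h = none → (∃ e, parent e = h) →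
    ∑ e ∈ Finset.univ.filter (fun e => parent e = h), prob e = 1
  prob_eq_one : ∀ e, infoset (parent e) ≠ none → prob e = 1
  /-- the utilities at terminal histories; other histories carry the value `0` -/
  utility : Fin numPlayers → Fin (numEdges + 1) → ℚ
  utility_eq_zero : ∀ i e, utility i (parent e) = 0

namespace Game

variable (G : Game)

/-- The set of histories. -/
abbrev Hist : Type := Fin (G.numEdges + 1)

/-- The number of histories. -/
def numHist : ℕ := G.numEdges + 1

/-- The information sets of player `i`. -/
abbrev Infoset (i : Fin G.numPlayers) : Type := {I : Fin G.numInfosets // G.owner I = i}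

/-- Terminal histories. -/
def Terminal (h : G.Hist) : Prop := ∀ e, G.parent e ≠ h

instance : DecidablePred G.Terminal := fun h => by unfold Terminal; infer_instance

/-- The edges on the path from the root to `h`, in order. -/
def path (h : G.Hist) : List (Fin G.numEdges) :=
  if hz : h = 0 then [] else path (G.parent (h.pred hz)) ++ [h.pred hz]
termination_by h.val
decreasing_by
  have h1 : (G.parent (h.pred hz)).val ≤ (h.pred hz).val := G.parent_le _
  have h2 : h.val ≠ 0 := fun h0 => hz (Fin.ext h0)
  simp only [Fin.val_pred] at h1
  omega

/-- The order of the tree: `g` is `h` or an ancestor of `h`. -/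
def Le (g h : G.Hist) : Prop := G.path g <+: G.path h

instance : DecidableRel G.Le := fun g h => by unfold Le; infer_instance

variable {G}

/-- The information set and action of player `i` on an edge, if the edge is a move of `i`. -/
def moveOf (i : Fin G.numPlayers) (e : Fin G.numEdges) : Option (G.Infoset i × ℕ) :=
  match G.infoset (G.parent e) with
  | some I => if h : G.owner I = i then some (⟨I, h⟩, G.action e) else none
  | none => none

/-- The sequence of information sets of player `i` and actions there on the path to `h`, without
the information set at `h` itself. -/
def sequence (i : Fin G.numPlayers) (h : G.Hist) : List (G.Infoset i × ℕ) :=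
  (G.path h).filterMap (moveOf i)

/-- Perfect recall: histories in the same information set have the same sequence of its player. -/
def PerfectRecall (G : Game) : Prop :=
  ∀ (i : Fin G.numPlayers) (I : G.Infoset i) (h h' : G.Hist),
    G.infoset h = some I.1 → G.infoset h' = some I.1 → sequence i h = sequence i h'

/-- `J ⪯ I` for information sets. -/
def InfoLe {i : Fin G.numPlayers} (J I : G.Infoset i) : Prop :=
  ∃ g h, G.infoset g = some J.1 ∧ G.infoset h = some I.1 ∧ G.Le g h

/-- `Ja ⪯ I` for a sequence `Ja` and an information set `I`. -/
def SeqLe {i : Fin G.numPlayers} (J : G.Infoset i) (a : Fin (G.numActions J.1))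
    (I : G.Infoset i) : Prop :=
  ∃ h, G.infoset h = some I.1 ∧ (J, (a : ℕ)) ∈ sequence i h

/-- `I ⪯ h` for an information set `I` and a history `h`. -/
def InfoLeHist {i : Fin G.numPlayers} (I : G.Infoset i) (h : G.Hist) : Prop :=
  ∃ g, G.infoset g = some I.1 ∧ G.Le g h

instance {i : Fin G.numPlayers} (I : G.Infoset i) (h : G.Hist) : Decidable (InfoLeHist I h) := by
  unfold InfoLeHist; infer_instance

/-! ### Strategies and utilities -/

/-- Pure strategies of player `i`. -/
abbrev Strat (G : Game) (i : Fin G.numPlayers) : Type :=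
  (I : G.Infoset i) → Fin (G.numActions I.1)

/-- Pure strategy profiles. -/
abbrev Profile (G : Game) : Type := (i : Fin G.numPlayers) → G.Strat i

/-- `x_i(h) = 1`: the strategy plays all actions of player `i` on the path to `h`. -/
def PlaysTo {i : Fin G.numPlayers} (x : G.Strat i) (h : G.Hist) : Prop :=
  ∀ m ∈ sequence i h, (x m.1 : ℕ) = m.2

instance {i : Fin G.numPlayers} (x : G.Strat i) (h : G.Hist) : Decidable (PlaysTo x h) := by
  unfold PlaysTo; infer_instance

/-- `x_i(I) = 1`: the strategy plays to the information set `I`. -/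
def PlaysToInfo {i : Fin G.numPlayers} (x : G.Strat i) (I : G.Infoset i) : Prop :=
  ∃ h, G.infoset h = some I.1 ∧ PlaysTo x h

instance {i : Fin G.numPlayers} (x : G.Strat i) (I : G.Infoset i) :
    Decidable (PlaysToInfo x I) := by
  unfold PlaysToInfo; infer_instance

/-- `x_i(Ja) = 1`: the strategy plays to `J` and plays `a` there. -/
def PlaysToSeq {i : Fin G.numPlayers} (x : G.Strat i) (J : G.Infoset i)
    (a : Fin (G.numActions J.1)) : Prop :=
  PlaysToInfo x J ∧ x J = a

instance {i : Fin G.numPlayers} (x : G.Strat i) (J : G.Infoset i) (a : Fin (G.numActions J.1)) :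
    Decidable (PlaysToSeq x J a) := by
  unfold PlaysToSeq; infer_instance

/-- `x_i(z|I) = 1`: the strategy plays all actions of player `i` on the path from `I` to `z`. -/
def PlaysFrom {i : Fin G.numPlayers} (x : G.Strat i) (I : G.Infoset i) (z : G.Hist) : Prop :=
  ∀ e ∈ G.path z, InfoLeHist I (G.parent e) → ∀ m ∈ moveOf i e, (x m.1 : ℕ) = m.2

instance {i : Fin G.numPlayers} (x : G.Strat i) (I : G.Infoset i) (z : G.Hist) :
    Decidable (PlaysFrom x I z) := by
  unfold PlaysFrom; infer_instance

/-- The probability that chance plays all its actions on the path to `z`. -/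
def chanceProb (z : G.Hist) : ℚ := ((G.path z).map G.prob).prod

/-- The indicator of `PlaysTo`. -/
def reach {i : Fin G.numPlayers} (x : G.Strat i) (z : G.Hist) : ℚ := if PlaysTo x z then 1 else 0

/-- `u_i(x)`. -/
def util (i : Fin G.numPlayers) (x : G.Profile) : ℚ :=
  ∑ z ∈ Finset.univ.filter G.Terminal, G.utility i z * chanceProb z * ∏ j, reach (x j) z

/-- The counterfactual utility `u_i(x; I)`: the terminal histories below `I`, weighted by the
probability that chance and the other players play to them and by whether `i` plays from `I` to
them. -/
def cfUtil (i : Fin G.numPlayers) (x : G.Profile) (I : G.Infoset i) : ℚ :=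
  ∑ z ∈ Finset.univ.filter (fun z => G.Terminal z ∧ InfoLeHist I z),
    G.utility i z * chanceProb z * (if PlaysFrom (x i) I z then 1 else 0) *
      ∏ j ∈ Finset.univ.erase i, reach (x j) z

/-- A correlated strategy profile: a (rational) probability distribution on pure profiles. -/
structure Correlated (G : Game) where
  weight : G.Profile → ℚ
  nonneg : ∀ x, 0 ≤ weight x
  sum_eq_one : ∑ x, weight x = 1

/-- Expectation under a correlated profile. -/
def Correlated.expect (μ : G.Correlated) (f : G.Profile → ℚ) : ℚ := ∑ x, μ.weight x * f x

/-- The outcome distribution: the probability that the terminal history `z` is reached. -/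
def Correlated.outcome (μ : G.Correlated) (z : G.Hist) : ℚ :=
  μ.expect fun x => chanceProb z * ∏ j, reach (x j) z

/-- Outcome equivalence. -/
def Correlated.OutcomeEquiv (μ ν : G.Correlated) : Prop :=
  ∀ z, G.Terminal z → μ.outcome z = ν.outcome z

/-! ### Deviations and equilibria -/

/-- The regret `R_i(μ, φ)`. -/
def Correlated.regret (μ : G.Correlated) (i : Fin G.numPlayers) (φ : G.Strat i → G.Strat i) : ℚ :=
  μ.expect fun x => util i (Function.update x i (φ (x i))) - util i x

/-- The counterfactual regret `R_i(μ, φ; I)`. -/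
def Correlated.cfRegret (μ : G.Correlated) (i : Fin G.numPlayers) (φ : G.Strat i → G.Strat i)
    (I : G.Infoset i) : ℚ :=
  μ.expect fun x => cfUtil i (Function.update x i (φ (x i))) I - cfUtil i x I

/-- Causal deviations: the action at `I` depends only on `I` and the values `x_i(Ja)`, `J ⪯ I`. -/
def Causal {i : Fin G.numPlayers} (φ : G.Strat i → G.Strat i) : Prop :=
  ∀ (I : G.Infoset i) (x y : G.Strat i),
    (∀ J, InfoLe J I → ∀ a, PlaysToSeq x J a ↔ PlaysToSeq y J a) → φ x I = φ y I

/-- Behavioral deviations: the action at `I` depends only on `I` and the recommendations at the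
information sets `J ⪯ I`. -/
def Behavioral {i : Fin G.numPlayers} (φ : G.Strat i → G.Strat i) : Prop :=
  ∀ (I : G.Infoset i) (x y : G.Strat i), (∀ J, InfoLe J I → x J = y J) → φ x I = φ y I

/-- `ε`-extensive-form correlated equilibrium. -/
def Correlated.IsEFCE (μ : G.Correlated) (ε : ℝ) : Prop :=
  ∀ (i : Fin G.numPlayers) (φ : G.Strat i → G.Strat i), Causal φ → (μ.regret i φ : ℝ) ≤ ε

/-- `ε`-behavioral correlated equilibrium. -/
def Correlated.IsBCE (μ : G.Correlated) (ε : ℝ) : Prop :=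
  ∀ (i : Fin G.numPlayers) (φ : G.Strat i → G.Strat i), Behavioral φ →
    ∀ I : G.Infoset i, (μ.cfRegret i φ I : ℝ) ≤ ε

/-! ### Mixtures of small-support products -/

/-- A mixture of `T` products of mixed strategies, each of them given by `K` weighted pure
strategies. -/
structure Mixture (G : Game) (T K : ℕ) where
  α : Fin T → ℚ
  β : Fin T → Fin G.numPlayers → Fin K → ℚ
  strat : Fin T → (i : Fin G.numPlayers) → Fin K → G.Strat i
  α_nonneg : ∀ t, 0 ≤ α t
  α_sum : ∑ t, α t = 1
  β_nonneg : ∀ t i k, 0 ≤ β t i k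
  β_sum : ∀ t i, ∑ k, β t i k = 1

/-- The correlated profile that a mixture represents. -/
def Mixture.toCorrelated {T K : ℕ} (π : G.Mixture T K) : G.Correlated where
  weight x := ∑ t, π.α t * ∏ i, ∑ k, if π.strat t i k = x i then π.β t i k else 0
  nonneg x := Finset.sum_nonneg fun t _ => mul_nonneg (π.α_nonneg t) <|
    Finset.prod_nonneg fun i _ => Finset.sum_nonneg fun k _ => by
      split_ifs
      · exact π.β_nonneg t i k
      · exact le_rfl
  sum_eq_one := by
    rw [Finset.sum_comm, ← π.α_sum]
    refine Finset.sum_congr rfl fun t _ => ?_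
    rw [← Finset.mul_sum]
    have h := Finset.prod_univ_sum (fun i : Fin G.numPlayers => (Finset.univ : Finset (G.Strat i)))
      (fun i y => ∑ k, if π.strat t i k = y then π.β t i k else 0)
    rw [Fintype.piFinset_univ] at h
    rw [← h]
    have h1 : ∀ i, (∑ y : G.Strat i, ∑ k, if π.strat t i k = y then π.β t i k else 0) = 1 := by
      intro i
      rw [Finset.sum_comm, ← π.β_sum t i]
      exact Finset.sum_congr rfl fun k _ => by simp
    simp [h1]

/-! ### The conversion -/

/-- `E_{x ∼ μ}[u_i(y, x_{-i}; I) | x_i(Ja) = 1]` (and `0` if the condition has probability `0`). -/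
def Correlated.condCfUtil (μ : G.Correlated) {i : Fin G.numPlayers} (J : G.Infoset i)
    (a : Fin (G.numActions J.1)) (I : G.Infoset i) (y : G.Strat i) : ℚ :=
  (μ.expect fun x => if PlaysToSeq (x i) J a then cfUtil i (Function.update x i y) I else 0) /
    (μ.expect fun x => if PlaysToSeq (x i) J a then 1 else 0)

/-- `y` is a counterfactual best response conditioned on `x_i(Ja) = 1`, as found by backward
traversal: it maximizes the conditional counterfactual utility at `J` and at every information set
of the player below `J`. -/
def Correlated.IsCondBestResponse (μ : G.Correlated) {i : Fin G.numPlayers} (J : G.Infoset i)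
    (a : Fin (G.numActions J.1)) (y : G.Strat i) : Prop :=
  ∀ I : G.Infoset i, InfoLe J I →
    ∀ y' : G.Strat i, μ.condCfUtil J a I y' ≤ μ.condCfUtil J a I y

/-- `π'` arises from `π` by keeping all weights and all recommendations at information sets that
the respective pure strategy plays to, and by replacing every other recommendation at `I` by that
of a conditional counterfactual best response for the sequence `Ja` at which the pure strategy
leaves the path to `I`. -/
def Mixture.IsConversion {T K : ℕ} (π π' : G.Mixture T K) : Prop :=
  π'.α = π.α ∧ π'.β = π.β ∧
  ∃ br : (i : Fin G.numPlayers) → (J : G.Infoset i) → Fin (G.numActions J.1) → G.Strat i,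
    (∀ i J a, π.toCorrelated.IsCondBestResponse J a (br i J a)) ∧
    ∀ t i k (I : G.Infoset i),
      (PlaysToInfo (π.strat t i k) I → π'.strat t i k I = π.strat t i k I) ∧
      (¬ PlaysToInfo (π.strat t i k) I → ∀ J a, InfoLe J I → PlaysToSeq (π.strat t i k) J a →
        ¬ SeqLe J a I → π'.strat t i k I = br i J a I)

end Game

/-! ## Input and output format -/

/-- Lists as right-nested pairs that end in `0`. -/
def Data.ofList : List Data → Data
  | [] => .num 0
  | d :: l => .pair d (Data.ofList l)

/-- A rational number as numerator and denominator. -/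
def Data.ofRat (q : ℚ) : Data := .pair (.num q.num) (.num q.den)

/-- Numerator and denominator have at most `b` bits. -/
def RatBits (b : ℕ) (q : ℚ) : Prop := Nat.size q.num.natAbs ≤ b ∧ Nat.size q.den ≤ b

namespace Game

/-- The game as data: the number of players; for each edge its parent, action and probability; for
each history its information set (`-1` if none) and the utilities; for each information set its
player and its number of actions. -/
def encode (G : Game) : Data :=
  .pair (.num G.numPlayers) <|
  .pair (Data.ofList <| List.ofFn fun e : Fin G.numEdges =>
    .pair (.num (G.parent e).val) (.pair (.num (G.action e)) (Data.ofRat (G.prob e)))) <|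
  .pair (Data.ofList <| List.ofFn fun h : G.Hist =>
    .pair (.num (match G.infoset h with
      | some I => (I.val : ℤ)
      | none => -1))
      (Data.ofList <| List.ofFn fun i => Data.ofRat (G.utility i h)))
  (Data.ofList <| List.ofFn fun I : Fin G.numInfosets =>
    .pair (.num (G.owner I).val) (.num (G.numActions I)))

/-- A pure strategy as the list of the pairs (information set, action). -/
def encodeStrat {G : Game} {i : Fin G.numPlayers} (x : G.Strat i) : Data :=
  Data.ofList <| (List.finRange G.numInfosets).filterMap fun I =>
    if h : G.owner I = i then some (.pair (.num I.val) (.num (x ⟨I, h⟩).val)) else none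

/-- A mixture as data: for each `t` the weight, and for each player the list of the `K` weighted
pure strategies. -/
def Mixture.encode {G : Game} {T K : ℕ} (π : G.Mixture T K) : Data :=
  Data.ofList <| List.ofFn fun t : Fin T =>
    .pair (Data.ofRat (π.α t)) <| Data.ofList <| List.ofFn fun i : Fin G.numPlayers =>
      Data.ofList <| List.ofFn fun k : Fin K =>
        .pair (Data.ofRat (π.β t i k)) (encodeStrat (π.strat t i k))

/-- All the rational numbers of the game have at most `b` bits. -/
def BitsLe (G : Game) (b : ℕ) : Prop :=
  (∀ e, RatBits b (G.prob e)) ∧ ∀ i h, RatBits b (G.utility i h)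

/-- All the weights of the mixture have at most `b` bits. -/
def Mixture.BitsLe {G : Game} {T K : ℕ} (π : G.Mixture T K) (b : ℕ) : Prop :=
  (∀ t, RatBits b (π.α t)) ∧ ∀ t i k, RatBits b (π.β t i k)

end Game

/-! Perfect recall attaches to each information set `I` of player `i` one sequence of own moves
leading to it. Hence a pure strategy `x` either plays to `I` or leaves the path to `I` at exactly
one sequence `Ja`. The converted strategy `C(x)` (`convStrat`) keeps `x` in the first case and
follows the best response for `Ja` in the second. Whether `x` reaches a history is decided at
information sets that `x` itself plays to (`playsTo_congr`), so `C` preserves all reach indicators,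
and with them the outcomes and the opponents' factors in every counterfactual utility.

For the equilibrium property, fix a behavioral `φ` and `I`, and split the gain of `φ(C(x))` over
`C(x)` at `I` along these cases (`gain_eq`). On the event that `x` plays to `I`, it is the ordinary
utility gain of the deviation that switches to `φ(C(x))` from `I` on (`regret_deviateFrom`). This
deviation is causal, because `C(x)` at `K` is determined by the values `x_i(Ja)` with `J ⪯ K`; so
this part is at most `ε`. On the event that `x` leaves at `Ja`, all such `x` have the same
conversion at every information set that `φ` may consult from `I` on. There `φ` prescribes one fixed
strategy, which competes with the best response for `Ja`, and the contribution is at most `0`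
(`expect_gain_leaves_le`).

Best responses come from backward traversal. Up to a normalization independent of the candidate, the
conditional utility is a sum of history weights over a subtree, and a strategy that is optimal at
each information set given its own later actions is optimal on each subtree: replace an arbitrary
strategy by it, one information set at a time (`subtreeValue_le`). The weights are computable
because the expectation of a product of one-player functions factors over each product in the
mixture (`expect_prod`).

The running time follows from closure of polynomial time under composition, pairing, branching and
folds whose state stays polynomially long. Fractions are never reduced: the length of a product of
integers is at most the sum of the lengths, so common denominators stay short. -/

/-! ## Functions computable in polynomial time -/

/-- Types whose elements are written as data. -/
class Enc (α : Type) where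
  enc : α → Data

open Enc (enc)

instance : Enc ℤ := ⟨Data.num⟩
instance : Enc Bool := ⟨fun b => .num (if b then 1 else 0)⟩
instance {α β : Type} [Enc α] [Enc β] : Enc (α × β) := ⟨fun p => .pair (enc p.1) (enc p.2)⟩
instance {α : Type} [Enc α] : Enc (List α) := ⟨fun l => Data.ofList (l.map enc)⟩

/-- The length of the encoding. -/
def encSize {α : Type} [Enc α] (a : α) : ℕ := (enc a).size

/-- Functions that a program computes in time polynomial in the length of the input. -/
@[fun_prop]
def PolyTime {α β : Type} [Enc α] [Enc β] (f : α → β) : Prop :=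
  ∃ (p : Prog) (q : Polynomial ℕ), ∀ a, ∃ k,
    p.Runs (enc a) (enc (f a)) k ∧ k ≤ q.eval (encSize a)

/-- Coefficients in `ℕ` make all bounds monotone, which is what lets them be composed. -/
theorem Polynomial.eval_nat_mono (q : Polynomial ℕ) {m n : ℕ} (h : m ≤ n) :
    q.eval m ≤ q.eval n := by
  rw [Polynomial.eval_eq_sum, Polynomial.eval_eq_sum]
  exact Finset.sum_le_sum fun i _ => Nat.mul_le_mul_left _ (Nat.pow_le_pow_left h i)

theorem Data.size_pos (d : Data) : 0 < d.size := by
  cases d <;> simp [Data.size]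

/-- Every construct is charged at least for what it outputs, so a time bound is also a bound on the
output length. -/
theorem Prog.Runs.size_le {p : Prog} {x y : Data} {k : ℕ} (h : p.Runs x y k) : y.size ≤ k := by
  induction h with
  | prim o x => nlinarith [Data.size_pos x, Data.size_pos (o.apply x)]
  | seq => omega
  | both => simp only [Data.size]; omega
  | cond_true => omega
  | cond_false => omega
  | loop_step => omega
  | loop_stop => omega

/-! ### Lengths of encodings; composition, constants, pairing and branching -/

section
variable {α β γ δ σ : Type} [Enc α] [Enc β] [Enc γ] [Enc δ] [Enc σ]

theorem encSize_pair (a : α) (b : β) : encSize (a, b) = encSize a + encSize b + 1 := rfl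

theorem encSize_int (z : ℤ) : encSize z = Nat.size z.natAbs + 1 := rfl

theorem encSize_nil : encSize ([] : List α) = 1 := rfl

theorem encSize_cons (a : α) (l : List α) : encSize (a :: l) = encSize a + encSize l + 1 := rfl

theorem encSize_pos (a : α) : 0 < encSize a := Data.size_pos _

theorem encSize_bool (b : Bool) : encSize b ≤ 2 := by cases b <;> decide

theorem length_le_encSize (l : List α) : l.length ≤ encSize l := by
  induction l with
  | nil => simp
  | cons a l ih => rw [encSize_cons, List.length_cons]; omega

theorem encSize_le_of_mem {l : List α} {a : α} (h : a ∈ l) : encSize a ≤ encSize l := by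
  induction l with
  | nil => simp at h
  | cons b l ih =>
    rw [encSize_cons]
    rcases List.mem_cons.1 h with rfl | h
    · omega
    · have := ih h; omega

theorem PolyTime.encSize_le {f : α → β} (hf : PolyTime f) :
    ∃ q : Polynomial ℕ, ∀ a, encSize (f a) ≤ q.eval (encSize a) := by
  obtain ⟨p, q, h⟩ := hf
  exact ⟨q, fun a => by obtain ⟨k, hr, hk⟩ := h a; exact hr.size_le.trans hk⟩

theorem PolyTime.of_prim {f : α → β} (o : Prim) (h : ∀ a, o.apply (enc a) = enc (f a))
    (q : Polynomial ℕ) (hq : ∀ a, encSize (f a) ≤ q.eval (encSize a)) : PolyTime f := by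
  refine ⟨.prim o, (Polynomial.X + q) ^ 2, fun a => ⟨_, h a ▸ Prog.Runs.prim o (enc a), ?_⟩⟩
  rw [Polynomial.eval_pow, Polynomial.eval_add, Polynomial.eval_X]
  exact Nat.pow_le_pow_left (Nat.add_le_add_left (hq a) _) 2

@[fun_prop]
theorem PolyTime.id' : PolyTime fun a : α => a :=
  .of_prim .ident (fun _ => rfl) Polynomial.X fun a => by simp

@[fun_prop]
theorem PolyTime.comp' {f : β → γ} {g : α → β} (hf : PolyTime f) (hg : PolyTime g) :
    PolyTime fun a => f (g a) := by
  obtain ⟨pf, qf, hf⟩ := hf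
  obtain ⟨pg, qg, hg⟩ := hg
  refine ⟨.seq pg pf, qg + qf.comp qg + 1, fun a => ?_⟩
  obtain ⟨k, hr, hk⟩ := hg a
  obtain ⟨l, hs, hl⟩ := hf (g a)
  refine ⟨_, .seq hr hs, ?_⟩
  have h1 : encSize (g a) ≤ qg.eval (encSize a) := hr.size_le.trans hk
  have h2 := qf.eval_nat_mono h1
  simp only [Polynomial.eval_add, Polynomial.eval_comp, Polynomial.eval_one]
  omega

/-- Only integers are elementary constants; trees are assembled by nested `both`, whose duplication
of the input is why the cost depends on `x`. -/
theorem exists_const_prog (d : Data) :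
    ∃ (p : Prog) (q : Polynomial ℕ), ∀ x : Data, ∃ k, p.Runs x d k ∧ k ≤ q.eval x.size := by
  induction d with
  | num z =>
    refine ⟨.prim (.const z), (Polynomial.X + Polynomial.C (Data.num z).size) ^ 2,
      fun x => ⟨_, .prim (.const z) x, ?_⟩⟩
    simp [Prim.apply]
  | pair a b iha ihb =>
    obtain ⟨p, q, h⟩ := iha
    obtain ⟨p', q', h'⟩ := ihb
    refine ⟨.both p p', q + q' + Polynomial.X + 1, fun x => ?_⟩
    obtain ⟨k, hr, hk⟩ := h x
    obtain ⟨l, hs, hl⟩ := h' x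
    refine ⟨_, .both hr hs, ?_⟩
    simp only [Polynomial.eval_add, Polynomial.eval_X, Polynomial.eval_one]
    omega

@[fun_prop]
theorem PolyTime.const' (b : β) : PolyTime fun _ : α => b := by
  obtain ⟨p, q, h⟩ := exists_const_prog (enc b)
  exact ⟨p, q, fun a => h (enc a)⟩

@[fun_prop]
theorem PolyTime.fst' : PolyTime fun p : α × β => p.1 :=
  .of_prim .fst (fun _ => rfl) Polynomial.X fun p => by
    simp only [Polynomial.eval_X, encSize_pair p.1 p.2]; omega

@[fun_prop]
theorem PolyTime.snd' : PolyTime fun p : α × β => p.2 :=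
  .of_prim .snd (fun _ => rfl) Polynomial.X fun p => by
    simp only [Polynomial.eval_X, encSize_pair p.1 p.2]; omega

@[fun_prop]
theorem PolyTime.fst {f : α → β × γ} (hf : PolyTime f) : PolyTime fun a => (f a).1 :=
  PolyTime.fst'.comp' hf

@[fun_prop]
theorem PolyTime.snd {f : α → β × γ} (hf : PolyTime f) : PolyTime fun a => (f a).2 :=
  PolyTime.snd'.comp' hf

@[fun_prop]
theorem PolyTime.pair {f : α → β} {g : α → γ} (hf : PolyTime f) (hg : PolyTime g) :
    PolyTime fun a => (f a, g a) := by
  obtain ⟨p, q, h⟩ := hf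
  obtain ⟨p', q', h'⟩ := hg
  refine ⟨.both p p', q + q' + Polynomial.X + 1, fun x => ?_⟩
  obtain ⟨k, hr, hk⟩ := h x
  obtain ⟨l, hs, hl⟩ := h' x
  refine ⟨_, .both hr hs, ?_⟩
  simp only [Polynomial.eval_add, Polynomial.eval_X, Polynomial.eval_one]
  change k + l + encSize x + 1 ≤ _
  omega

@[fun_prop]
theorem PolyTime.cond {c : α → Bool} {f g : α → β} (hc : PolyTime c) (hf : PolyTime f)
    (hg : PolyTime g) : PolyTime fun a => cond (c a) (f a) (g a) := by
  obtain ⟨pc, qc, hc⟩ := hc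
  obtain ⟨p, q, h⟩ := hf
  obtain ⟨p', q', h'⟩ := hg
  refine ⟨.cond pc p p', qc + q + q' + Polynomial.X + 1, fun x => ?_⟩
  obtain ⟨j, hj, hjk⟩ := hc x
  obtain ⟨k, hr, hk⟩ := h x
  obtain ⟨l, hs, hl⟩ := h' x
  simp only [Polynomial.eval_add, Polynomial.eval_X, Polynomial.eval_one]
  cases hx : c x with
  | true =>
    rw [hx] at hj
    refine ⟨_, .cond_true hj (by simp [enc]) hr, ?_⟩
    change j + k + encSize x + 1 ≤ _
    omega
  | false =>
    rw [hx] at hj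
    refine ⟨_, .cond_false hj hs, ?_⟩
    change j + l + encSize x + 1 ≤ _
    omega

/-! ### Arithmetic -/

theorem Nat.size_add_le (m n : ℕ) : Nat.size (m + n) ≤ Nat.size m + Nat.size n + 1 := by
  rw [Nat.size_le]
  have hm := Nat.lt_size_self m
  have hn := Nat.lt_size_self n
  have h1 : 2 ^ Nat.size m ≤ 2 ^ (Nat.size m + Nat.size n) :=
    Nat.pow_le_pow_right (by norm_num) (by omega)
  have h2 : 2 ^ Nat.size n ≤ 2 ^ (Nat.size m + Nat.size n) :=
    Nat.pow_le_pow_right (by norm_num) (by omega)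
  rw [pow_succ]
  omega

theorem Nat.size_mul_le (m n : ℕ) : Nat.size (m * n) ≤ Nat.size m + Nat.size n := by
  rw [Nat.size_le, pow_add]
  exact Nat.mul_lt_mul'' (Nat.lt_size_self m) (Nat.lt_size_self n)

theorem Int.size_add_le (a b : ℤ) :
    Nat.size (a + b).natAbs ≤ Nat.size a.natAbs + Nat.size b.natAbs + 1 :=
  (Nat.size_le_size (Int.natAbs_add_le a b)).trans (Nat.size_add_le _ _)

@[fun_prop]
theorem PolyTime.int_add {f g : α → ℤ} (hf : PolyTime f) (hg : PolyTime g) :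
    PolyTime fun a => f a + g a := by
  have h : PolyTime fun p : ℤ × ℤ => p.1 + p.2 :=
    .of_prim .add (fun _ => rfl) (Polynomial.X + 1) fun p => by
      simp only [Polynomial.eval_X, Polynomial.eval_add, Polynomial.eval_one,
        encSize_pair p.1 p.2, encSize_int]
      have := Int.size_add_le p.1 p.2
      omega
  exact h.comp' (hf.pair hg)

@[fun_prop]
theorem PolyTime.int_mul {f g : α → ℤ} (hf : PolyTime f) (hg : PolyTime g) :
    PolyTime fun a => f a * g a := by
  have h : PolyTime fun p : ℤ × ℤ => p.1 * p.2 :=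
    .of_prim .mul (fun _ => rfl) Polynomial.X fun p => by
      simp only [Polynomial.eval_X, encSize_pair p.1 p.2, encSize_int, Int.natAbs_mul]
      have := Nat.size_mul_le p.1.natAbs p.2.natAbs
      omega
  exact h.comp' (hf.pair hg)

@[fun_prop]
theorem PolyTime.int_div {f g : α → ℤ} (hf : PolyTime f) (hg : PolyTime g) :
    PolyTime fun a => f a / g a := by
  have h : PolyTime fun p : ℤ × ℤ => p.1 / p.2 :=
    .of_prim .div (fun _ => rfl) Polynomial.X fun p => by
      simp only [Polynomial.eval_X, encSize_pair p.1 p.2, encSize_int]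
      have := Nat.size_le_size (Int.natAbs_ediv_le_natAbs p.1 p.2)
      omega
  exact h.comp' (hf.pair hg)

/-- Comparison of integers, as a Boolean. -/
def ltb (a b : ℤ) : Bool := decide (a < b)

@[fun_prop]
theorem PolyTime.ltb {f g : α → ℤ} (hf : PolyTime f) (hg : PolyTime g) :
    PolyTime fun a => ltb (f a) (g a) := by
  have h : PolyTime fun p : ℤ × ℤ => _root_.ltb p.1 p.2 :=
    .of_prim .lt (fun p => by simp [Prim.apply, enc, _root_.ltb]) 2 fun p => by
      simpa using encSize_bool _
  exact h.comp' (hf.pair hg)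

@[fun_prop]
theorem PolyTime.not {f : α → Bool} (hf : PolyTime f) : PolyTime fun a => !(f a) := by
  have : (fun a => !(f a)) = fun a => _root_.cond (f a) false true := by
    funext a; cases f a <;> rfl
  rw [this]; fun_prop

@[fun_prop]
theorem PolyTime.and {f g : α → Bool} (hf : PolyTime f) (hg : PolyTime g) :
    PolyTime fun a => f a && g a := by
  have : (fun a => f a && g a) = fun a => _root_.cond (f a) (g a) false := by
    funext a; cases f a <;> rfl
  rw [this]; fun_prop

@[fun_prop]
theorem PolyTime.or {f g : α → Bool} (hf : PolyTime f) (hg : PolyTime g) :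
    PolyTime fun a => f a || g a := by
  have : (fun a => f a || g a) = fun a => _root_.cond (f a) true (g a) := by
    funext a; cases f a <;> rfl
  rw [this]; fun_prop

/-- Equality of integers, as a Boolean. -/
def eqb (a b : ℤ) : Bool := decide (a = b)

@[fun_prop]
theorem PolyTime.eqb {f g : α → ℤ} (hf : PolyTime f) (hg : PolyTime g) :
    PolyTime fun a => eqb (f a) (g a) := by
  have : (fun a => _root_.eqb (f a) (g a)) =
      fun a => !(_root_.ltb (f a) (g a)) && !(_root_.ltb (g a) (f a)) := by
    funext a
    rw [Bool.eq_iff_iff]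
    simp only [_root_.eqb, _root_.ltb, Bool.and_eq_true, Bool.not_eq_true', decide_eq_false_iff_not,
      decide_eq_true_eq]
    omega
  rw [this]; fun_prop

/-! ### Lists -/

@[fun_prop]
theorem PolyTime.cons {f : α → β} {g : α → List β} (hf : PolyTime f) (hg : PolyTime g) :
    PolyTime fun a => f a :: g a := hf.pair hg

/-- A nonempty list is encoded as a pair and the empty one as the number `0`, so `isPair` is the
test. -/
theorem PolyTime.not_isEmpty : PolyTime fun l : List α => !l.isEmpty :=
  .of_prim .isPair (fun l => by cases l <;> rfl) 2 fun l => by simpa using encSize_bool _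

@[fun_prop]
theorem PolyTime.headD {f : α → List β} {g : α → β} (hf : PolyTime f) (hg : PolyTime g) :
    PolyTime fun a => (f a).headD (g a) := by
  obtain ⟨pc, qc, hc⟩ := PolyTime.not_isEmpty.comp' hf
  obtain ⟨p, q, h⟩ := hf
  obtain ⟨p', q', h'⟩ := hg
  -- The elementary `fst` yields the head only on a nonempty list, so the program guards it by a
  -- test. Both the list and its head have length at most `q`, whence the charge `(q + q) ^ 2`.
  refine ⟨.cond pc (.seq p (.prim .fst)) p', qc + q + (q + q) ^ 2 + 1 + q' + Polynomial.X + 1,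
    fun x => ?_⟩
  obtain ⟨j, hj, hjk⟩ := hc x
  obtain ⟨k, hr, hk⟩ := h x
  obtain ⟨l, hs, hl⟩ := h' x
  simp only [Polynomial.eval_add, Polynomial.eval_X, Polynomial.eval_one, Polynomial.eval_pow]
  beta_reduce at hj
  cases hx : f x with
  | nil =>
    rw [hx] at hj
    refine ⟨_, .cond_false hj hs, ?_⟩
    change j + l + encSize x + 1 ≤ _
    omega
  | cons b t =>
    rw [hx] at hj hr
    refine ⟨_, .cond_true hj (by simp [enc]) (.seq hr (.prim .fst _)), ?_⟩
    have h1 : encSize (b :: t) ≤ q.eval (encSize x) := hr.size_le.trans hk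
    have h2 : encSize b ≤ q.eval (encSize x) := by rw [encSize_cons] at h1; omega
    have h3 := Nat.pow_le_pow_left (Nat.add_le_add h1 h2) 2
    change j + (k + (encSize (b :: t) + encSize b) ^ 2 + 1) + encSize x + 1 ≤ _
    omega

/-- The loop state consists of the context, the accumulator and the remaining list. `S` bounds the
accumulator after every prefix, hence `M` bounds the whole state, and each of the `l.length + 1`
tests, with its pass through the body, has a cost bounded in `M`. -/
theorem loop_runs_foldl {step : α → σ → γ → σ} {c b : Prog} {qc qb : Polynomial ℕ}
    (hc : ∀ p : α × σ × List γ, ∃ k, c.Runs (enc p) (enc (!p.2.2.isEmpty)) k ∧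
      k ≤ qc.eval (encSize p))
    (hb : ∀ p : α × σ × γ × List γ, ∃ k,
      b.Runs (enc p) (enc (p.1, step p.1 p.2.1 p.2.2.1, p.2.2.2)) k ∧ k ≤ qb.eval (encSize p))
    (a : α) (S M : ℕ) (l : List γ) (s : σ)
    (hS : ∀ l₁ l₂, l = l₁ ++ l₂ → encSize (l₁.foldl (step a) s) ≤ S)
    (hM : encSize a + S + encSize l + 2 ≤ M) :
    ∃ k, (Prog.loop c b).Runs (enc (a, s, l)) (enc (a, l.foldl (step a) s, ([] : List γ))) k ∧
      k ≤ (l.length + 1) * (qc.eval M + qb.eval M + M + 1) := by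
  have hs : encSize s ≤ S := hS [] l rfl
  induction l generalizing s with
  | nil =>
    obtain ⟨k, hr, hk⟩ := hc (a, s, [])
    refine ⟨_, Prog.Runs.loop_stop hr, ?_⟩
    simp only [encSize_pair, encSize_nil] at hM hk
    have h1 : encSize a + (encSize s + 1 + 1) + 1 ≤ M := by omega
    have := qc.eval_nat_mono h1
    change k + encSize (a, s, ([] : List γ)) + 1 ≤ _
    simp only [encSize_pair, encSize_nil, List.length_nil]
    omega
  | cons x l ih =>
    rw [encSize_cons] at hM
    have hS' : ∀ l₁ l₂, l = l₁ ++ l₂ → encSize (l₁.foldl (step a) (step a s x)) ≤ S :=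
      fun l₁ l₂ h => hS (x :: l₁) l₂ (by rw [h]; rfl)
    obtain ⟨r, hr, hrk⟩ := ih (step a s x) hS' (by omega) (hS' [] l rfl)
    obtain ⟨j, hj, hjk⟩ := hc (a, s, x :: l)
    obtain ⟨i, hi, hik⟩ := hb (a, s, x, l)
    refine ⟨_, .loop_step hj (by simp [enc]) hi hr, ?_⟩
    have h1 : encSize (a, s, x :: l) ≤ M := by
      simp only [encSize_pair, encSize_cons]; omega
    have h2 := qc.eval_nat_mono h1
    have h3 : i ≤ qb.eval M := hik.trans (qb.eval_nat_mono h1)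
    change j + i + r + encSize (a, s, x :: l) + 1 ≤ _
    have h4 : ((x :: l).length + 1) * (qc.eval M + qb.eval M + M + 1) =
      (l.length + 1) * (qc.eval M + qb.eval M + M + 1) + (qc.eval M + qb.eval M + M + 1) := by
      rw [List.length_cons]; ring
    omega

/-- Folds whose intermediate states are polynomially bounded. -/
theorem PolyTime.foldl_of_bounded {l : α → List γ} {init : α → σ} {step : α → σ → γ → σ}
    (hl : PolyTime l) (hi : PolyTime init) (hs : PolyTime fun p : α × σ × γ => step p.1 p.2.1 p.2.2)
    (hb : ∃ q : Polynomial ℕ, ∀ a l₁ l₂, l a = l₁ ++ l₂ →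
      encSize (l₁.foldl (step a) (init a)) ≤ q.eval (encSize a)) :
    PolyTime fun a => (l a).foldl (step a) (init a) := by
  obtain ⟨ql, hql⟩ := hl.encSize_le
  obtain ⟨q, hq⟩ := hb
  have hbody : PolyTime fun p : α × σ × γ × List γ =>
      (p.1, step p.1 p.2.1 p.2.2.1, p.2.2.2) := by
    have := hs.comp' (g := fun p : α × σ × γ × List γ => (p.1, p.2.1, p.2.2.1)) (by fun_prop)
    fun_prop
  have hcond : PolyTime fun p : α × σ × List γ => !p.2.2.isEmpty :=
    PolyTime.not_isEmpty.comp' (by fun_prop)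
  have hinit : PolyTime fun a => (a, init a, l a) := by fun_prop
  have hfin : PolyTime fun p : α × σ × List γ => p.2.1 := by fun_prop
  obtain ⟨c, qc, hc⟩ := hcond
  obtain ⟨b, qb, hb⟩ := hbody
  have hloop : ∃ (p : Prog) (Q : Polynomial ℕ), ∀ a, ∃ k,
      p.Runs (enc (a, init a, l a)) (enc (a, (l a).foldl (step a) (init a), ([] : List γ))) k ∧
        k ≤ Q.eval (encSize a) := by
    -- The lengths of context, accumulator and list, and the two pairing symbols of the triple.
    let M : Polynomial ℕ := Polynomial.X + q + ql + 2
    refine ⟨.loop c b, (ql + 1) * (qc.comp M + qb.comp M + M + 1), fun a => ?_⟩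
    have hlen : (l a).length ≤ ql.eval (encSize a) := (length_le_encSize _).trans (hql a)
    obtain ⟨k, hr, hk⟩ := loop_runs_foldl hc hb a (q.eval (encSize a)) (M.eval (encSize a)) (l a)
      (init a) (hq a) (by
        have h2 := hql a
        simp only [M, Polynomial.eval_add, Polynomial.eval_X, Polynomial.eval_ofNat]
        omega)
    refine ⟨k, hr, hk.trans ?_⟩
    simp only [Polynomial.eval_add, Polynomial.eval_mul, Polynomial.eval_comp, Polynomial.eval_one]
    gcongr
  obtain ⟨p, Q, hp⟩ := hloop
  obtain ⟨p₀, q₀, h₀⟩ := hinit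
  obtain ⟨p₁, q₁, h₁⟩ := hfin
  refine ⟨.seq (.seq p₀ p) p₁, q₀ + Q + q₁.comp Q + 2, fun a => ?_⟩
  obtain ⟨k₀, hr₀, hk₀⟩ := h₀ a
  obtain ⟨k, hr, hk⟩ := hp a
  obtain ⟨k₁, hr₁, hk₁⟩ := h₁ (a, (l a).foldl (step a) (init a), [])
  refine ⟨_, .seq (.seq hr₀ hr) hr₁, ?_⟩
  have h2 : encSize (a, (l a).foldl (step a) (init a), ([] : List γ)) ≤ Q.eval (encSize a) :=
    hr.size_le.trans hk
  have h3 := q₁.eval_nat_mono h2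
  simp only [Polynomial.eval_add, Polynomial.eval_comp, Polynomial.eval_ofNat]
  omega

/-- Folds whose state grows by a polynomially bounded amount in each step. -/
theorem PolyTime.foldl {l : α → List γ} {init : α → σ} {step : α → σ → γ → σ} (hl : PolyTime l)
    (hi : PolyTime init) (hs : PolyTime fun p : α × σ × γ => step p.1 p.2.1 p.2.2)
    (hb : ∃ q : Polynomial ℕ, ∀ a, ∀ x ∈ l a, ∀ s,
      encSize (step a s x) ≤ encSize s + q.eval (encSize a)) :
    PolyTime fun a => (l a).foldl (step a) (init a) := by
  obtain ⟨ql, hql⟩ := hl.encSize_le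
  obtain ⟨qi, hqi⟩ := hi.encSize_le
  obtain ⟨q, hq⟩ := hb
  refine PolyTime.foldl_of_bounded hl hi hs ⟨qi + ql * q, fun a l₁ l₂ h => ?_⟩
  have h1 : ∀ (l' : List γ) (s : σ), (∀ x ∈ l', x ∈ l a) →
      encSize (l'.foldl (step a) s) ≤ encSize s + l'.length * q.eval (encSize a) := by
    intro l'
    induction l' with
    | nil => intro s _; simp
    | cons x t ih =>
      intro s ht
      have h2 := ih (step a s x) fun y hy => ht y (by simp [hy])
      have h3 := hq a x (ht x (by simp)) s
      rw [List.foldl_cons, List.length_cons, Nat.add_mul, Nat.one_mul]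
      omega
  have h2 := h1 l₁ (init a) fun x hx => by simp [h, hx]
  have h3 : l₁.length ≤ ql.eval (encSize a) := by
    have h4 := (length_le_encSize _).trans (hql a)
    rw [h, List.length_append] at h4
    omega
  have h4 := Nat.mul_le_mul_right (q.eval (encSize a)) h3
  have h5 := hqi a
  simp only [Polynomial.eval_add, Polynomial.eval_mul]
  omega

/-! ### List operations as folds -/

@[fun_prop]
theorem PolyTime.reverse {l : α → List β} (hl : PolyTime l) : PolyTime fun a => (l a).reverse := by
  have h : (fun l : List β => l.reverse) = fun l => l.foldl (fun s x => x :: s) [] := by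
    funext l; simp
  have h' : PolyTime fun l : List β => l.reverse := by
    rw [h]
    refine PolyTime.foldl (by fun_prop) (by fun_prop) (by fun_prop)
      ⟨Polynomial.X + 1, fun a x hx s => ?_⟩
    have := encSize_le_of_mem hx
    simp only [encSize_cons, Polynomial.eval_add, Polynomial.eval_X, Polynomial.eval_one]
    omega
  exact h'.comp' hl

/-- The members of a list that the context produces are bounded together with the context. -/
theorem PolyTime.encSize_pair_mem_le {l : α → List β} (hl : PolyTime l) :
    ∃ q : Polynomial ℕ, ∀ a, ∀ x ∈ l a, encSize (a, x) ≤ q.eval (encSize a) := by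
  obtain ⟨q, hq⟩ := hl.encSize_le
  refine ⟨Polynomial.X + q + 1, fun a x hx => ?_⟩
  have := (encSize_le_of_mem hx).trans (hq a)
  simp only [encSize_pair, Polynomial.eval_add, Polynomial.eval_X, Polynomial.eval_one]
  omega

/-- A bound for a function of the context and a member of a list that the context produces. -/
theorem PolyTime.encSize_apply_mem_le {l : α → List β} {f : α → β → γ} (hl : PolyTime l)
    (hf : PolyTime fun p : α × β => f p.1 p.2) :
    ∃ q : Polynomial ℕ, ∀ a, ∀ x ∈ l a, encSize (f a x) ≤ q.eval (encSize a) := by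
  obtain ⟨q, hq⟩ := hl.encSize_pair_mem_le
  obtain ⟨r, hr⟩ := hf.encSize_le
  refine ⟨r.comp q, fun a x hx => ?_⟩
  rw [Polynomial.eval_comp]
  exact (hr (a, x)).trans (r.eval_nat_mono (hq a x hx))

@[fun_prop]
theorem PolyTime.map {l : α → List β} {f : α → β → γ} (hf : PolyTime fun p : α × β => f p.1 p.2)
    (hl : PolyTime l) : PolyTime fun a => (l a).map (f a) := by
  -- The fold pushes results to the front, which reverses the order.
  have h : (fun a => (l a).map (f a)) =
      fun a => ((l a).foldl (fun s x => f a x :: s) []).reverse := by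
    funext a
    rw [← List.foldl_map (f := f a) (g := fun s x => x :: s)]
    simp
  rw [h]
  obtain ⟨q, hq⟩ := hl.encSize_apply_mem_le hf
  refine PolyTime.reverse (PolyTime.foldl hl (by fun_prop) ?_ ⟨q + 1, fun a x hx s => ?_⟩)
  · have := hf.comp' (g := fun p : α × List γ × β => (p.1, p.2.2)) (by fun_prop)
    fun_prop
  · have := hq a x hx
    simp only [encSize_cons, Polynomial.eval_add, Polynomial.eval_one]
    omega

@[fun_prop]
theorem PolyTime.filter {l : α → List β} {f : α → β → Bool}
    (hf : PolyTime fun p : α × β => f p.1 p.2) (hl : PolyTime l) :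
    PolyTime fun a => (l a).filter (f a) := by
  have h : (fun a => (l a).filter (f a)) =
      fun a => ((l a).foldl (fun s x => _root_.cond (f a x) (x :: s) s) []).reverse := by
    funext a
    have : ∀ s, (l a).foldl (fun s x => _root_.cond (f a x) (x :: s) s) s =
        ((l a).filter (f a)).reverse ++ s := by
      induction l a with
      | nil => simp
      | cons x t ih =>
        intro s
        rw [List.foldl_cons, ih, List.filter_cons]
        cases f a x <;> simp
    simp [this]
  rw [h]
  obtain ⟨q, hq⟩ := hl.encSize_pair_mem_le
  refine PolyTime.reverse (PolyTime.foldl hl (by fun_prop) ?_ ⟨q + 1, fun a x hx s => ?_⟩)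
  · have := hf.comp' (g := fun p : α × List β × β => (p.1, p.2.2)) (by fun_prop)
    fun_prop
  · have h1 := hq a x hx
    rw [encSize_pair] at h1
    simp only [Polynomial.eval_add, Polynomial.eval_one]
    cases f a x <;> simp only [_root_.cond, encSize_cons] <;> omega

@[fun_prop]
theorem PolyTime.all {l : α → List β} {f : α → β → Bool}
    (hl : PolyTime l) (hf : PolyTime fun p : α × β => f p.1 p.2) :
    PolyTime fun a => (l a).all (f a) := by
  have h : (fun a => (l a).all (f a)) =
      fun a => !(!((l a).filter fun x => !(f a x)).isEmpty) := by
    funext a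
    rw [Bool.eq_iff_iff]
    simp
  rw [h]
  have h2 : PolyTime fun a => (l a).filter fun x => !(f a x) := by
    have : PolyTime fun p : α × β => !(f p.1 p.2) := by fun_prop
    fun_prop
  exact (PolyTime.not_isEmpty.comp' h2).not

@[fun_prop]
theorem PolyTime.any {l : α → List β} {f : α → β → Bool}
    (hl : PolyTime l) (hf : PolyTime fun p : α × β => f p.1 p.2) :
    PolyTime fun a => (l a).any (f a) := by
  have h : (fun a => (l a).any (f a)) = fun a => !((l a).filter (f a)).isEmpty := by
    funext a
    rw [Bool.eq_iff_iff]
    simp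
  rw [h]
  exact PolyTime.not_isEmpty.comp' (by fun_prop)

@[fun_prop]
theorem PolyTime.sum {l : α → List ℤ} (hl : PolyTime l) : PolyTime fun a => (l a).sum := by
  have h : (fun l : List ℤ => l.sum) = fun l => l.foldl (fun s x => s + x) 0 := by
    funext l; rw [List.sum_eq_foldl]
  have h' : PolyTime fun l : List ℤ => l.sum := by
    rw [h]
    refine PolyTime.foldl (by fun_prop) (by fun_prop) (by fun_prop)
      ⟨Polynomial.X, fun a x hx s => ?_⟩
    have := encSize_le_of_mem hx
    have := Int.size_add_le s x
    simp only [encSize_int, Polynomial.eval_X] at *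
    omega
  exact h'.comp' hl

-- The length of a product is at most the sum of the lengths, so the accumulator gains at most the
-- length of the entry in each step. This makes the product of all denominators affordable in
-- `fracSum`.
@[fun_prop]
theorem PolyTime.prod {l : α → List ℤ} (hl : PolyTime l) : PolyTime fun a => (l a).prod := by
  have h : (fun l : List ℤ => l.prod) = fun l => l.foldl (fun s x => s * x) 1 := by
    funext l; rw [List.prod_eq_foldl]
  have h' : PolyTime fun l : List ℤ => l.prod := by
    rw [h]
    refine PolyTime.foldl (by fun_prop) (by fun_prop) (by fun_prop)
      ⟨Polynomial.X, fun a x hx s => ?_⟩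
    have := encSize_le_of_mem hx
    have := Nat.size_mul_le s.natAbs x.natAbs
    simp only [encSize_int, Polynomial.eval_X, Int.natAbs_mul] at *
    omega
  exact h'.comp' hl

/-- One step of `enumReverse`: the state is the number of entries so far and the list. -/
def enumStep {α : Type} (s : ℤ × List (ℤ × α)) (x : α) : ℤ × List (ℤ × α) :=
  (s.1 + 1, (s.1, x) :: s.2)

/-- The list with the positions of its entries, in reverse order. -/
def enumReverse {α : Type} (l : List α) : List (ℤ × α) := (l.foldl enumStep (0, [])).2

theorem foldl_enumStep_fst {α : Type} (l : List α) :
    (l.foldl enumStep ((0 : ℤ), ([] : List (ℤ × α)))).1 = l.length := by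
  induction l using List.reverseRecOn with
  | nil => rfl
  | append_singleton l x ih => simp [List.foldl_append, enumStep, ih]

theorem enumReverse_append_singleton {α : Type} (l : List α) (x : α) :
    enumReverse (l ++ [x]) = ((l.length : ℤ), x) :: enumReverse l := by
  simp [enumReverse, List.foldl_append, enumStep, foldl_enumStep_fst]

theorem Nat.size_le_self (n : ℕ) : Nat.size n ≤ n :=
  Nat.size_le.2 Nat.lt_two_pow_self

theorem encSize_nat_le (n : ℕ) : encSize (n : ℤ) ≤ n + 1 := by
  rw [encSize_int, Int.natAbs_natCast]
  have := Nat.size_le_self n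
  omega

@[fun_prop]
theorem PolyTime.enumReverse {l : α → List β} (hl : PolyTime l) :
    PolyTime fun a => enumReverse (l a) := by
  have h' : PolyTime fun l : List β => _root_.enumReverse l := by
    unfold _root_.enumReverse enumStep
    -- A step copies the counter, which belongs to the state, so its increment is not bounded by the
    -- input for arbitrary states. The states that do occur are bounded instead: after a prefix the
    -- counter is its length.
    refine PolyTime.snd (PolyTime.foldl_of_bounded (by fun_prop) (by fun_prop) (by fun_prop)
      ⟨Polynomial.X * (Polynomial.X + 4) + Polynomial.X + 2, fun l l₁ l₂ h => ?_⟩)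
    -- `N` stays fixed during the induction: each entry gains a position of length at most `N + 1`
    -- and a pairing symbol, which the factor `N + 4` absorbs.
    have h1 : ∀ (l : List β) (N : ℕ), l.length ≤ N →
        encSize (_root_.enumReverse l) ≤ encSize l * (N + 4) := by
      intro l N
      induction l using List.reverseRecOn with
      | nil => intro _; simp [_root_.enumReverse, encSize_nil]
      | append_singleton l x ih =>
        intro hN
        rw [List.length_append, List.length_singleton] at hN
        have h2 := ih (by omega)
        have h3 : encSize (l ++ [x]) = encSize l + (encSize x + 1) := by
          clear * -
          induction l with
          | nil => simp [encSize_cons, encSize_nil, Nat.add_comm]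
          | cons y t ih => rw [List.cons_append, encSize_cons, ih, encSize_cons]; omega
        rw [enumReverse_append_singleton, encSize_cons, encSize_pair, h3]
        have h4 := encSize_nat_le l.length
        nlinarith [Nat.zero_le (encSize x * N)]
    have h2 : encSize l₁ ≤ encSize l ∧ l₁.length ≤ encSize l := by
      subst h
      have : encSize l₁ ≤ encSize (l₁ ++ l₂) := by
        clear * -
        induction l₁ with
        | nil => rw [encSize_nil]; exact encSize_pos _
        | cons y t ih => rw [List.cons_append, encSize_cons, encSize_cons]; omega
      exact ⟨this, (length_le_encSize _).trans this⟩
    have h3 := h1 l₁ (encSize l) h2.2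
    have h4 := foldl_enumStep_fst l₁
    have h5 := encSize_nat_le l₁.length
    have h6 := Nat.mul_le_mul_right (encSize l + 4) h2.1
    unfold _root_.enumReverse at h3
    unfold enumStep at h3 h4
    rw [← h4] at h5
    simp only [Polynomial.eval_add, Polynomial.eval_mul, Polynomial.eval_X, Polynomial.eval_ofNat]
    rw [show ∀ p : ℤ × List (ℤ × β), encSize p = encSize p.1 + encSize p.2 + 1 from fun _ => rfl]
    beta_reduce at *
    omega
  exact h'.comp' hl

end

/-! ## The algorithm, on raw data -/

/-- Fractions, not necessarily reduced. -/
abbrev Frac : Type := ℤ × ℤ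

/-- Sum of fractions. -/
def fracSum (l : List Frac) : Frac :=
  ((l.map fun q => q.1 * ((l.map fun r => r.2).prod / q.2)).sum, (l.map fun r => r.2).prod)

/-- Product of fractions. -/
def fracProd (l : List Frac) : Frac := ((l.map fun q => q.1).prod, (l.map fun q => q.2).prod)

/-- Comparison of fractions. -/
def fracLe (q r : Frac) : Bool := !(ltb (r.1 * q.2) (q.1 * r.2))

/-- The value at a key of an association list. -/
def assoc {β : Type} (d : β) (l : List (ℤ × β)) (n : ℤ) : β :=
  ((l.filter fun p => eqb p.1 n).map fun p => p.2).headD d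

/-- A game as lists of numbers. -/
abbrev RawGame : Type :=
  ℤ × List (ℤ × ℤ × Frac) × List (ℤ × List Frac) × List (ℤ × ℤ)

/-- A pure strategy as a list of pairs (information set, action). -/
abbrev RawStrat : Type := List (ℤ × ℤ)

/-- A mixture as lists of numbers. -/
abbrev RawMixture : Type := List (Frac × List (List (Frac × RawStrat)))

namespace RawGame

/-- The edges with their numbers. -/
def edges (g : RawGame) : List (ℤ × ℤ × ℤ × Frac) := enumReverse g.2.1

/-- The histories with their numbers. -/
def hists (g : RawGame) : List (ℤ × ℤ × List Frac) := enumReverse g.2.2.1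

/-- The number of the information set at a history. -/
def infosetAt (g : RawGame) (h : ℤ) : ℤ := (assoc ((-1 : ℤ), ([] : List Frac)) (hists g) h).1

/-- The player at an information set. -/
def ownerOf (g : RawGame) (I : ℤ) : ℤ := (assoc ((-1 : ℤ), (0 : ℤ)) (enumReverse g.2.2.2) I).1

/-- The utility of a player at a history. -/
def utilityAt (g : RawGame) (i h : ℤ) : Frac :=
  assoc (0, 1) (enumReverse (assoc ((-1 : ℤ), ([] : List Frac)) (hists g) h).2) i

/-- Extending a path towards the root. -/
def pathStep (s : ℤ × List (ℤ × ℤ × Frac)) (e : ℤ × ℤ × ℤ × Frac) : ℤ × List (ℤ × ℤ × Frac) :=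
  cond (eqb s.1 (e.1 + 1)) (e.2.1, e.2 :: s.2) s

/-- The edges on the path to a history. -/
def pathTo (g : RawGame) (h : ℤ) : List (ℤ × ℤ × Frac) := ((edges g).foldl pathStep (h, [])).2

/-- The information sets and actions on the path to a history. -/
def movesTo (g : RawGame) (h : ℤ) : List (ℤ × ℤ) :=
  (pathTo g h).map fun e => (infosetAt g e.1, e.2.1)

/-- The probability that chance plays to a history. -/
def chanceTo (g : RawGame) (h : ℤ) : Frac := fracProd ((pathTo g h).map fun e => e.2.2)

/-- The actions at a history. -/
def actionsAt (g : RawGame) (h : ℤ) : List ℤ :=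
  ((edges g).filter fun e => eqb e.2.1 h).map fun e => e.2.2.1

/-- Whether a history is the first one of an information set. -/
def isFirst (g : RawGame) (h I : ℤ) : Bool :=
  (hists g).all fun r => !(eqb r.2.1 I) || !(ltb r.1 h)

/-- The information sets and actions on the path to an information set. -/
def movesToInfoset (g : RawGame) (I : ℤ) : List (ℤ × ℤ) :=
  movesTo g ((((hists g).filter fun r => eqb r.2.1 I).map fun r => r.1).headD 0)

end RawGame

/-- Whether a partial strategy is consistent with a list of information sets and actions. -/
def consistent (x : RawStrat) (m : List (ℤ × ℤ)) : Bool :=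
  m.all fun q => x.all fun p => !(eqb p.1 q.1) || eqb p.2 q.2

namespace RawGame

/-- The target that a strategy is to play to: the sequence `Ja` for the player who owns `J`, and the
history `h` for the others. -/
def target (g : RawGame) (J a h : ℤ) (x : RawStrat) : List (ℤ × ℤ) :=
  cond (x.any fun p => eqb p.1 J) ((J, a) :: movesToInfoset g J) (movesTo g h)

/-- The utility at the history `h`, weighted by the probability that chance and the other players
play to it and the owner of `J` plays to `Ja`. -/
def weight (g : RawGame) (π : RawMixture) (i J a h : ℤ) : Frac :=
  fracProd [utilityAt g i h, chanceTo g h, fracSum (π.map fun tm =>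
    fracProd (tm.1 :: tm.2.map fun L => fracSum (L.map fun bx =>
      cond (consistent bx.2 (target g J a h bx.2)) bx.1 (0, 1))))]

/-- The value of the action `b` at `I`, followed by the partial strategy `s` below. -/
def actionValue (g : RawGame) (π : RawMixture) (i J a : ℤ) (s : RawStrat) (I b : ℤ) : Frac :=
  fracSum ((hists g).map fun r =>
    cond (((movesTo g r.1).any fun q => eqb q.1 I && eqb q.2 b) && consistent s (movesTo g r.1))
      (weight g π i J a r.1) (0, 1))

/-- The best action at the history `h` in `I`. -/
def bestAction (g : RawGame) (π : RawMixture) (i J a : ℤ) (s : RawStrat) (I h : ℤ) : ℤ :=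
  ((actionsAt g h).filter fun b => (actionsAt g h).all fun b' =>
    fracLe (actionValue g π i J a s I b') (actionValue g π i J a s I b)).headD 0

/-- Adding the best action at an information set at its first history. -/
def bestResponseStep (g : RawGame) (π : RawMixture) (i J a : ℤ) (s : RawStrat)
    (r : ℤ × ℤ × List Frac) : RawStrat :=
  cond (eqb (ownerOf g r.2.1) i && isFirst g r.1 r.2.1)
    ((r.2.1, bestAction g π i J a s r.2.1 r.1) :: s) s

/-- The conditional counterfactual best response of player `i`, by backward traversal. -/
def bestResponse (g : RawGame) (π : RawMixture) (i J a : ℤ) : RawStrat :=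
  (hists g).foldl (bestResponseStep g π i J a) []

/-- The information set at which the strategy leaves the path to `I`. -/
def leaveAt (g : RawGame) (x : RawStrat) (I : ℤ) : ℤ :=
  (((movesToInfoset g I).filter fun q => x.any fun p => eqb p.1 q.1 && !(eqb p.2 q.2)).map
    fun q => q.1).headD 0

/-- The new action at the information set `p.1`, at which the strategy plays `p.2`. -/
def convertAction (g : RawGame) (π : RawMixture) (x : RawStrat) (p : ℤ × ℤ) : ℤ :=
  cond (consistent x (movesToInfoset g p.1)) p.2
    (assoc 0 (bestResponse g π (ownerOf g p.1) (leaveAt g x p.1) (assoc 0 x (leaveAt g x p.1))) p.1)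

/-- The conversion of a mixture. -/
def convert (g : RawGame) (π : RawMixture) : RawMixture :=
  π.map fun tm => (tm.1, tm.2.map fun L => L.map fun bx =>
    (bx.1, bx.2.map fun p => (p.1, convertAction g π bx.2 p)))

end RawGame

/-! ### Running time -/

section
variable {α β : Type} [Enc α] [Enc β]

@[fun_prop]
theorem PolyTime.fracSum {l : α → List Frac} (hl : PolyTime l) : PolyTime fun a => fracSum (l a) := by
  unfold _root_.fracSum; fun_prop

@[fun_prop]
theorem PolyTime.fracProd {l : α → List Frac} (hl : PolyTime l) :
    PolyTime fun a => fracProd (l a) := by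
  unfold _root_.fracProd; fun_prop

@[fun_prop]
theorem PolyTime.fracLe {q r : α → Frac} (hq : PolyTime q) (hr : PolyTime r) :
    PolyTime fun a => fracLe (q a) (r a) := by
  unfold _root_.fracLe; fun_prop

@[fun_prop]
theorem PolyTime.assoc {d : α → β} {l : α → List (ℤ × β)} {n : α → ℤ} (hd : PolyTime d)
    (hl : PolyTime l) (hn : PolyTime n) : PolyTime fun a => assoc (d a) (l a) (n a) := by
  unfold _root_.assoc; fun_prop

@[fun_prop]
theorem PolyTime.consistent {x m : α → List (ℤ × ℤ)} (hx : PolyTime x) (hm : PolyTime m) :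
    PolyTime fun a => consistent (x a) (m a) := by
  unfold _root_.consistent; fun_prop

end

namespace RawGame

section
variable {α : Type} [Enc α] {g : α → RawGame} {π : α → RawMixture} {i J a h I b : α → ℤ}
  {x s : α → RawStrat}

@[fun_prop]
theorem polyTime_edges (hg : PolyTime g) : PolyTime fun c => edges (g c) := by
  unfold edges; fun_prop

@[fun_prop]
theorem polyTime_hists (hg : PolyTime g) : PolyTime fun c => hists (g c) := by
  unfold hists; fun_prop

@[fun_prop]
theorem polyTime_infosetAt (hg : PolyTime g) (hh : PolyTime h) :
    PolyTime fun c => infosetAt (g c) (h c) := by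
  unfold infosetAt; fun_prop

@[fun_prop]
theorem polyTime_ownerOf (hg : PolyTime g) (hI : PolyTime I) :
    PolyTime fun c => ownerOf (g c) (I c) := by
  unfold ownerOf; fun_prop

@[fun_prop]
theorem polyTime_utilityAt (hg : PolyTime g) (hi : PolyTime i) (hh : PolyTime h) :
    PolyTime fun c => utilityAt (g c) (i c) (h c) := by
  unfold utilityAt; fun_prop

@[fun_prop]
theorem polyTime_pathTo (hg : PolyTime g) (hh : PolyTime h) :
    PolyTime fun c => pathTo (g c) (h c) := by
  unfold pathTo pathStep
  have he : PolyTime fun c => edges (g c) := by fun_prop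
  obtain ⟨q, hq⟩ := he.encSize_le
  -- The factor `2`: a step may write the parent twice, as the new current history and within the
  -- stored edge.
  refine PolyTime.snd (PolyTime.foldl (by fun_prop) (by fun_prop) (by fun_prop)
    ⟨2 * q, fun c e hec s => ?_⟩)
  have h1 := (encSize_le_of_mem hec).trans (hq c)
  obtain ⟨s₁, s₂⟩ := s
  obtain ⟨e, par, act⟩ := e
  have := encSize_pos e
  have := encSize_pos s₁
  cases eqb s₁ (e + 1)
  · simp only [cond]; omega
  · simp only [cond, encSize_pair, encSize_cons, Polynomial.eval_mul, Polynomial.eval_ofNat] at h1 ⊢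
    omega

@[fun_prop]
theorem polyTime_movesTo (hg : PolyTime g) (hh : PolyTime h) :
    PolyTime fun c => movesTo (g c) (h c) := by
  unfold movesTo; fun_prop

@[fun_prop]
theorem polyTime_chanceTo (hg : PolyTime g) (hh : PolyTime h) :
    PolyTime fun c => chanceTo (g c) (h c) := by
  unfold chanceTo; fun_prop

@[fun_prop]
theorem polyTime_actionsAt (hg : PolyTime g) (hh : PolyTime h) :
    PolyTime fun c => actionsAt (g c) (h c) := by
  unfold actionsAt; fun_prop

@[fun_prop]
theorem polyTime_isFirst (hg : PolyTime g) (hh : PolyTime h) (hI : PolyTime I) :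
    PolyTime fun c => isFirst (g c) (h c) (I c) := by
  unfold isFirst; fun_prop

@[fun_prop]
theorem polyTime_movesToInfoset (hg : PolyTime g) (hI : PolyTime I) :
    PolyTime fun c => movesToInfoset (g c) (I c) := by
  unfold movesToInfoset; fun_prop

@[fun_prop]
theorem polyTime_target (hg : PolyTime g) (hJ : PolyTime J) (ha : PolyTime a) (hh : PolyTime h)
    (hx : PolyTime x) : PolyTime fun c => target (g c) (J c) (a c) (h c) (x c) := by
  unfold target; fun_prop

@[fun_prop]
theorem polyTime_weight (hg : PolyTime g) (hπ : PolyTime π) (hi : PolyTime i) (hJ : PolyTime J)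
    (ha : PolyTime a) (hh : PolyTime h) :
    PolyTime fun c => weight (g c) (π c) (i c) (J c) (a c) (h c) := by
  unfold weight; fun_prop

@[fun_prop]
theorem polyTime_actionValue (hg : PolyTime g) (hπ : PolyTime π) (hi : PolyTime i)
    (hJ : PolyTime J) (ha : PolyTime a) (hs : PolyTime s) (hI : PolyTime I) (hb : PolyTime b) :
    PolyTime fun c => actionValue (g c) (π c) (i c) (J c) (a c) (s c) (I c) (b c) := by
  unfold actionValue; fun_prop

@[fun_prop]
theorem polyTime_bestAction (hg : PolyTime g) (hπ : PolyTime π) (hi : PolyTime i)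
    (hJ : PolyTime J) (ha : PolyTime a) (hs : PolyTime s) (hI : PolyTime I) (hh : PolyTime h) :
    PolyTime fun c => bestAction (g c) (π c) (i c) (J c) (a c) (s c) (I c) (h c) := by
  unfold bestAction; fun_prop

/-- Uniform in `f`. In `bestAction` the predicate depends on the strategy accumulated so far, but
the chosen action comes from a list that does not, so the accumulator grows by a bounded amount. -/
theorem encSize_headD_filter_le (l : List ℤ) (f : ℤ → Bool) :
    encSize ((l.filter f).headD 0) ≤ encSize l := by
  cases h : l.filter f with
  | nil => exact encSize_pos l
  | cons y t =>
    refine encSize_le_of_mem (List.mem_of_mem_filter (p := f) ?_)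
    rw [h]; simp

@[fun_prop]
theorem polyTime_bestResponse (hg : PolyTime g) (hπ : PolyTime π) (hi : PolyTime i)
    (hJ : PolyTime J) (ha : PolyTime a) :
    PolyTime fun c => bestResponse (g c) (π c) (i c) (J c) (a c) := by
  unfold bestResponse
  have hh : PolyTime fun c => hists (g c) := by fun_prop
  obtain ⟨q, hq⟩ := hh.encSize_le
  obtain ⟨q', hq'⟩ := hh.encSize_apply_mem_le (f := fun c r => actionsAt (g c) r.1) (by fun_prop)
  refine PolyTime.foldl (by fun_prop) (by fun_prop) (by unfold bestResponseStep; fun_prop)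
    ⟨q + q' + 2, fun c r hr s => ?_⟩
  unfold bestResponseStep
  have h1 := (encSize_le_of_mem hr).trans (hq c)
  have h2 := hq' c r hr
  obtain ⟨r, I, us⟩ := r
  simp only [encSize_pair] at h1
  dsimp only at h2
  simp only [Polynomial.eval_add, Polynomial.eval_ofNat]
  cases (eqb (ownerOf (g c) I) (i c) && isFirst (g c) r I)
  · simp only [cond]; omega
  · have h3 := encSize_headD_filter_le (actionsAt (g c) r) (fun b => (actionsAt (g c) r).all fun b' =>
      fracLe (actionValue (g c) (π c) (i c) (J c) (a c) s I b')
        (actionValue (g c) (π c) (i c) (J c) (a c) s I b))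
    simp only [cond, encSize_cons, encSize_pair, bestAction]
    omega

@[fun_prop]
theorem polyTime_leaveAt (hg : PolyTime g) (hx : PolyTime x) (hI : PolyTime I) :
    PolyTime fun c => leaveAt (g c) (x c) (I c) := by
  unfold leaveAt; fun_prop

@[fun_prop]
theorem polyTime_convertAction {p : α → ℤ × ℤ} (hg : PolyTime g) (hπ : PolyTime π)
    (hx : PolyTime x) (hp : PolyTime p) :
    PolyTime fun c => convertAction (g c) (π c) (x c) (p c) := by
  unfold convertAction; fun_prop

theorem polyTime_convert : PolyTime fun c : RawGame × RawMixture => convert c.1 c.2 := by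
  unfold convert; fun_prop

end

end RawGame

/-! ## Paths and sequences -/

theorem List.exists_first_not {α : Type*} {P : α → Prop} {l : List α} (h : ¬ ∀ m ∈ l, P m) :
    ∃ l₁ m l₂, l = l₁ ++ m :: l₂ ∧ (∀ m' ∈ l₁, P m') ∧ ¬ P m := by
  induction l with
  | nil => simp at h
  | cons a t ih =>
    by_cases ha : P a
    · have : ¬ ∀ m ∈ t, P m := fun ht => h fun m hm => by
        rcases List.mem_cons.1 hm with rfl | hm
        exacts [ha, ht m hm]
      obtain ⟨l₁, m, l₂, rfl, h1, h2⟩ := ih this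
      refine ⟨a :: l₁, m, l₂, rfl, fun m' hm' => ?_, h2⟩
      rcases List.mem_cons.1 hm' with rfl | hm'
      exacts [ha, h1 m' hm']
    · exact ⟨[], a, t, rfl, by simp, ha⟩

namespace Game

variable {G : Game}

/-! ### The tree of histories -/

theorem path_zero : G.path 0 = [] := by
  rw [path, dif_pos rfl]

theorem path_succ (e : Fin G.numEdges) : G.path e.succ = G.path (G.parent e) ++ [e] := by
  rw [path, dif_neg (Fin.succ_ne_zero e)]
  simp

theorem parent_lt_succ (e : Fin G.numEdges) : G.parent e < e.succ :=
  lt_of_le_of_lt (G.parent_le e) (Fin.castSucc_lt_succ)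

/-- Induction along the tree. -/
theorem hist_induction {P : G.Hist → Prop} (h0 : P 0)
    (hs : ∀ e, P (G.parent e) → P e.succ) (h : G.Hist) : P h := by
  induction h using WellFoundedLT.induction with
  | ind h ih =>
    by_cases hz : h = 0
    · rw [hz]; exact h0
    · have h1 := hs (h.pred hz)
      rw [Fin.succ_pred] at h1
      refine h1 (ih _ ?_)
      have := parent_lt_succ (h.pred hz)
      rwa [Fin.succ_pred] at this

theorem succ_le_of_mem_path {h : G.Hist} : ∀ {e}, e ∈ G.path h → e.succ ≤ h := by
  induction h using hist_induction with
  | h0 => intro e he; simp [path_zero] at he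
  | hs e ih =>
    intro e' he
    rw [path_succ, List.mem_append, List.mem_singleton] at he
    rcases he with he | rfl
    · exact (ih he).trans (parent_lt_succ e).le
    · exact le_rfl

theorem parent_lt_of_mem_path {h : G.Hist} {e} (he : e ∈ G.path h) : G.parent e < h :=
  (parent_lt_succ e).trans_le (succ_le_of_mem_path he)

theorem path_split {h : G.Hist} : ∀ {l₁ e l₂}, G.path h = l₁ ++ e :: l₂ →
    G.path (G.parent e) = l₁ := by
  induction h using hist_induction with
  | h0 => intro l₁ e l₂ h; simp [path_zero] at h
  | hs e ih =>
    intro l₁ e' l₂ h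
    rw [path_succ] at h
    rcases List.eq_nil_or_concat l₂ with rfl | ⟨l, a, rfl⟩
    · obtain ⟨h1, h2⟩ := List.append_inj' h rfl
      rw [List.singleton_inj] at h2
      rw [← h2, h1]
    · rw [List.concat_eq_append] at h
      have : l₁ ++ e' :: (l ++ [a]) = (l₁ ++ e' :: l) ++ [a] := by simp
      rw [this] at h
      exact ih (List.append_inj' h rfl).1

theorem path_injective : Function.Injective G.path := by
  intro g h hgh
  by_cases hg : g = 0 <;> by_cases hh : h = 0
  · rw [hg, hh]
  · rw [hg, path_zero, ← Fin.succ_pred h hh, path_succ] at hgh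
    simp at hgh
  · rw [hh, path_zero, ← Fin.succ_pred g hg, path_succ] at hgh
    simp at hgh
  · rw [← Fin.succ_pred h hh, ← Fin.succ_pred g hg, path_succ, path_succ] at hgh
    have h1 := (List.append_inj' hgh rfl).2
    rw [List.singleton_inj] at h1
    rw [← Fin.succ_pred h hh, ← Fin.succ_pred g hg, h1]

theorem parent_le_of_mem_path {h : G.Hist} {e} (he : e ∈ G.path h) : G.Le (G.parent e) h := by
  obtain ⟨l₁, l₂, hl⟩ := List.append_of_mem he
  rw [Le, path_split hl, hl]
  exact List.prefix_append _ _

theorem Le.exists_edge {g h : G.Hist} (hgh : G.Le g h) (hne : g ≠ h) :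
    ∃ e ∈ G.path h, G.parent e = g := by
  obtain ⟨t, ht⟩ := hgh
  cases t with
  | nil => exact absurd (path_injective (by simpa using ht)) hne
  | cons e t =>
    exact ⟨e, by rw [← ht]; simp, path_injective (path_split ht.symm)⟩

/-! ### The sequences of a player -/

variable {i : Fin G.numPlayers}

theorem moveOf_eq_some {e : Fin G.numEdges} {m : G.Infoset i × ℕ} :
    moveOf i e = some m ↔ G.infoset (G.parent e) = some m.1.1 ∧ G.action e = m.2 := by
  obtain ⟨⟨I, hI⟩, c⟩ := m
  unfold moveOf
  cases h : G.infoset (G.parent e) with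
  | none => simp
  | some J =>
    by_cases hJ : G.owner J = i
    · simp [hJ, Subtype.ext_iff]
    · simp only [hJ, dite_false, Option.some.injEq, false_iff, reduceCtorEq]
      rintro ⟨rfl, -⟩
      exact hJ hI

theorem mem_sequence {h : G.Hist} {m : G.Infoset i × ℕ} :
    m ∈ sequence i h ↔
      ∃ e ∈ G.path h, G.infoset (G.parent e) = some m.1.1 ∧ G.action e = m.2 := by
  simp only [sequence, List.mem_filterMap, moveOf_eq_some]

/-- Cutting the sequence at a move corresponds to cutting the path at its edge; the initial part is
then the sequence of the history where the move is made. -/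
theorem sequence_split {h : G.Hist} {l₁ l₂} {m : G.Infoset i × ℕ}
    (hl : sequence i h = l₁ ++ m :: l₂) :
    ∃ e ∈ G.path h, G.infoset (G.parent e) = some m.1.1 ∧ G.action e = m.2 ∧
      sequence i (G.parent e) = l₁ := by
  unfold sequence at hl
  rw [List.filterMap_eq_append_iff] at hl
  obtain ⟨p₁, p₂, hp, h1, h2⟩ := hl
  rw [List.filterMap_eq_cons_iff] at h2
  obtain ⟨q₁, e, q₂, rfl, hq, he, -⟩ := h2
  have hp' : G.path h = (p₁ ++ q₁) ++ e :: q₂ := by rw [hp, List.append_assoc]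
  obtain ⟨h3, h4⟩ := moveOf_eq_some.1 he
  refine ⟨e, by rw [hp']; simp, h3, h4, ?_⟩
  rw [sequence, path_split hp', List.filterMap_append, h1, List.filterMap_eq_nil_iff.2 hq,
    List.append_nil]

theorem Le.exists_move {g h : G.Hist} (hgh : G.Le g h) (hne : g ≠ h) {I : G.Infoset i}
    (hg : G.infoset g = some I.1) : ∃ c, (I, c) ∈ sequence i h := by
  obtain ⟨e, he, rfl⟩ := hgh.exists_edge hne
  exact ⟨G.action e, mem_sequence.2 ⟨e, he, hg, rfl⟩⟩

/-! ### The first history of an information set -/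

theorem infoset_filter_nonempty (I : G.Infoset i) :
    (Finset.univ.filter fun h => G.infoset h = some I.1).Nonempty := by
  obtain ⟨h, hh⟩ := G.infoset_nonempty I.1
  exact ⟨h, by simpa using hh⟩

/-- The first history of an information set. -/
def firstHist (I : G.Infoset i) : G.Hist :=
  (Finset.univ.filter fun h => G.infoset h = some I.1).min' (infoset_filter_nonempty I)

theorem infoset_firstHist (I : G.Infoset i) : G.infoset (firstHist I) = some I.1 := by
  exact (Finset.mem_filter.1 (Finset.min'_mem _ (infoset_filter_nonempty I))).2

theorem firstHist_le {I : G.Infoset i} {h : G.Hist} (hh : G.infoset h = some I.1) :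
    firstHist I ≤ h := Finset.min'_le _ _ (by simpa using hh)

theorem firstHist_injective : Function.Injective (firstHist : G.Infoset i → G.Hist) := by
  intro I J h
  have h1 := infoset_firstHist I
  rw [h, infoset_firstHist J] at h1
  exact Subtype.ext (Option.some.inj h1).symm

/-- The sequence of an information set. -/
def seqTo (I : G.Infoset i) : List (G.Infoset i × ℕ) := sequence i (firstHist I)

theorem PerfectRecall.sequence_eq (hG : G.PerfectRecall) {I : G.Infoset i} {h : G.Hist}
    (hh : G.infoset h = some I.1) : sequence i h = seqTo I :=
  hG i I h _ hh (infoset_firstHist I)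

/-- What precedes a move is the sequence of a history in its information set, and by perfect recall
this depends on the information set only. -/
theorem PerfectRecall.eq_seqTo (hG : G.PerfectRecall) {h : G.Hist} {l₁ l₂}
    {m : G.Infoset i × ℕ} (hl : sequence i h = l₁ ++ m :: l₂) : l₁ = seqTo m.1 := by
  obtain ⟨e, -, he, -, rfl⟩ := sequence_split hl
  exact hG.sequence_eq he

theorem PerfectRecall.mem_sequence_of_mem_seqTo (hG : G.PerfectRecall) {h : G.Hist}
    {m m' : G.Infoset i × ℕ} (hm : m ∈ sequence i h) (hm' : m' ∈ seqTo m.1) :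
    m' ∈ sequence i h := by
  obtain ⟨l₁, l₂, hl⟩ := List.append_of_mem hm
  rw [hl, hG.eq_seqTo hl]
  simp [hm']

/-- Two occurrences of `J` on one path have the same initial part, `seqTo J`, so they are the same
occurrence. -/
theorem PerfectRecall.action_unique (hG : G.PerfectRecall) {h : G.Hist} {J : G.Infoset i}
    {c c' : ℕ} (hc : (J, c) ∈ sequence i h) (hc' : (J, c') ∈ sequence i h) : c = c' := by
  obtain ⟨l₁, l₂, hl⟩ := List.append_of_mem hc
  obtain ⟨l₁', l₂', hl'⟩ := List.append_of_mem hc'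
  have h1 : l₁ = l₁' := (hG.eq_seqTo hl).trans (hG.eq_seqTo hl').symm
  rw [hl, h1] at hl'
  have := List.append_cancel_left hl'
  simp only [List.cons.injEq, Prod.mk.injEq, true_and] at this
  exact this.1

/-- Numbers of histories increase along paths. Thus first histories order the information sets of a
player linearly, compatibly with the tree, and backward traversal can follow their numbers. -/
theorem firstHist_lt_of_mem_seqTo {I : G.Infoset i} {m : G.Infoset i × ℕ} (hm : m ∈ seqTo I) :
    firstHist m.1 < firstHist I := by
  obtain ⟨e, he, h1, -⟩ := mem_sequence.1 hm
  exact (firstHist_le h1).trans_lt (parent_lt_of_mem_path he)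

theorem InfoLe.refl (I : G.Infoset i) : InfoLe I I :=
  ⟨firstHist I, firstHist I, infoset_firstHist I, infoset_firstHist I, List.prefix_refl _⟩

theorem infoLe_of_mem_sequence {I : G.Infoset i} {h : G.Hist} {m : G.Infoset i × ℕ}
    (hh : G.infoset h = some I.1) (hm : m ∈ sequence i h) : InfoLe m.1 I := by
  obtain ⟨e, he, h1, -⟩ := mem_sequence.1 hm
  exact ⟨_, _, h1, hh, parent_le_of_mem_path he⟩

theorem infoLe_of_mem_seqTo {I : G.Infoset i} {m : G.Infoset i × ℕ} (hm : m ∈ seqTo I) :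
    InfoLe m.1 I := infoLe_of_mem_sequence (infoset_firstHist I) hm

theorem PerfectRecall.infoLe_iff (hG : G.PerfectRecall) {J I : G.Infoset i} :
    InfoLe J I ↔ J = I ∨ ∃ c, (J, c) ∈ seqTo I := by
  constructor
  · rintro ⟨g, h, hg, hh, hgh⟩
    by_cases hne : g = h
    · left
      rw [hne, hh] at hg
      exact Subtype.ext (Option.some.inj hg).symm
    · right
      rw [← hG.sequence_eq hh]
      exact hgh.exists_move hne hg
  · rintro (rfl | ⟨c, hc⟩)
    · exact .refl _
    · exact infoLe_of_mem_seqTo hc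

theorem PerfectRecall.seqLe_iff (hG : G.PerfectRecall) {J I : G.Infoset i}
    {a : Fin (G.numActions J.1)} : SeqLe J a I ↔ (J, (a : ℕ)) ∈ seqTo I := by
  constructor
  · rintro ⟨h, hh, hm⟩
    rwa [← hG.sequence_eq hh]
  · exact fun hm => ⟨_, infoset_firstHist I, hm⟩

theorem PerfectRecall.infoLe_trans (hG : G.PerfectRecall) {J I K : G.Infoset i}
    (h : InfoLe J I) (h' : InfoLe I K) : InfoLe J K := by
  rcases hG.infoLe_iff.1 h' with rfl | ⟨c', hc'⟩
  · exact h
  rcases hG.infoLe_iff.1 h with rfl | ⟨c, hc⟩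
  · exact h'
  exact hG.infoLe_iff.2 (Or.inr ⟨c, hG.mem_sequence_of_mem_seqTo hc' hc⟩)

theorem PerfectRecall.firstHist_le_of_infoLe (hG : G.PerfectRecall) {J I : G.Infoset i}
    (h : InfoLe J I) : firstHist J ≤ firstHist I := by
  rcases hG.infoLe_iff.1 h with rfl | ⟨c, hc⟩
  · exact le_rfl
  · exact (firstHist_lt_of_mem_seqTo hc).le

theorem infoLe_total_of_mem_sequence {h : G.Hist} {m m' : G.Infoset i × ℕ}
    (hm : m ∈ sequence i h) (hm' : m' ∈ sequence i h) : InfoLe m.1 m'.1 ∨ InfoLe m'.1 m.1 := by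
  obtain ⟨e, he, h1, -⟩ := mem_sequence.1 hm
  obtain ⟨e', he', h1', -⟩ := mem_sequence.1 hm'
  rcases List.prefix_or_prefix_of_prefix (parent_le_of_mem_path he) (parent_le_of_mem_path he')
    with h2 | h2
  · exact Or.inl ⟨_, _, h1, h1', h2⟩
  · exact Or.inr ⟨_, _, h1', h1, h2⟩

theorem PerfectRecall.infoLe_iff_firstHist_le (hG : G.PerfectRecall) {h : G.Hist}
    {m m' : G.Infoset i × ℕ} (hm : m ∈ sequence i h) (hm' : m' ∈ sequence i h) :
    InfoLe m.1 m'.1 ↔ firstHist m.1 ≤ firstHist m'.1 := by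
  refine ⟨hG.firstHist_le_of_infoLe, fun hle => ?_⟩
  rcases infoLe_total_of_mem_sequence hm hm' with h1 | h1
  · exact h1
  · rw [firstHist_injective (le_antisymm hle (hG.firstHist_le_of_infoLe h1))]
    exact .refl _

theorem infoLeHist_iff {I : G.Infoset i} {z : G.Hist} :
    InfoLeHist I z ↔ G.infoset z = some I.1 ∨ ∃ c, (I, c) ∈ sequence i z := by
  constructor
  · rintro ⟨g, hg, hgz⟩
    by_cases hne : g = z
    · exact Or.inl (hne ▸ hg)
    · exact Or.inr (hgz.exists_move hne hg)
  · rintro (h | ⟨c, hc⟩)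
    · exact ⟨z, h, List.prefix_refl _⟩
    · obtain ⟨e, he, h1, -⟩ := mem_sequence.1 hc
      exact ⟨_, h1, parent_le_of_mem_path he⟩

theorem PerfectRecall.infoLeHist_iff_infoLe (hG : G.PerfectRecall) {I J : G.Infoset i}
    {h : G.Hist} (hh : G.infoset h = some J.1) : InfoLeHist I h ↔ InfoLe I J := by
  rw [infoLeHist_iff, hG.infoLe_iff, hG.sequence_eq hh, hh]
  refine or_congr ⟨fun h => Subtype.ext (Option.some.inj h).symm, fun h => by rw [h]⟩ Iff.rfl

theorem infoset_eq_none_of_terminal {z : G.Hist} (hz : G.Terminal z) : G.infoset z = none := by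
  by_contra hne
  obtain ⟨I, hI⟩ := Option.ne_none_iff_exists'.1 hne
  have h1 := G.card_children z I hI
  have h2 : (Finset.univ.filter fun e => G.parent e = z) = ∅ := by
    ext e; simpa using hz e
  rw [h2, Finset.card_empty] at h1
  exact (G.numActions_pos I).ne h1

theorem infoLeHist_terminal {I : G.Infoset i} {z : G.Hist}
    (hz : G.Terminal z) : InfoLeHist I z ↔ ∃ c, (I, c) ∈ sequence i z := by
  rw [infoLeHist_iff, infoset_eq_none_of_terminal hz]
  simp

/-! ### Playing to histories and information sets -/

theorem PerfectRecall.playsToInfo_iff (hG : G.PerfectRecall) {x : G.Strat i} {I : G.Infoset i} :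
    PlaysToInfo x I ↔ ∀ m ∈ seqTo I, (x m.1 : ℕ) = m.2 := by
  constructor
  · rintro ⟨h, hh, hp⟩
    rwa [← hG.sequence_eq hh]
  · exact fun h => ⟨_, infoset_firstHist I, h⟩

theorem PerfectRecall.playsToInfo_iff_playsTo (hG : G.PerfectRecall) {x : G.Strat i}
    {I : G.Infoset i} {h : G.Hist} (hh : G.infoset h = some I.1) :
    PlaysToInfo x I ↔ PlaysTo x h := by
  rw [hG.playsToInfo_iff, PlaysTo, hG.sequence_eq hh]

theorem PerfectRecall.playsToInfo_of_infoLe (hG : G.PerfectRecall) {x : G.Strat i}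
    {J I : G.Infoset i} (h : InfoLe J I) (hx : PlaysToInfo x I) : PlaysToInfo x J := by
  rcases hG.infoLe_iff.1 h with rfl | ⟨c, hc⟩
  · exact hx
  · rw [hG.playsToInfo_iff] at hx ⊢
    exact fun m hm => hx m (hG.mem_sequence_of_mem_seqTo hc hm)

theorem PerfectRecall.playsFrom_iff (hG : G.PerfectRecall) {x : G.Strat i} {I : G.Infoset i}
    {z : G.Hist} :
    PlaysFrom x I z ↔ ∀ m ∈ sequence i z, InfoLe I m.1 → (x m.1 : ℕ) = m.2 := by
  constructor
  · intro h m hm hI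
    obtain ⟨e, he, h1, h2⟩ := mem_sequence.1 hm
    exact h e he ((hG.infoLeHist_iff_infoLe h1).2 hI) m (moveOf_eq_some.2 ⟨h1, h2⟩)
  · intro h e he hI m hm
    obtain ⟨h1, h2⟩ := moveOf_eq_some.1 hm
    exact h m (mem_sequence.2 ⟨e, he, h1, h2⟩) ((hG.infoLeHist_iff_infoLe h1).1 hI)

/-- Agreement where `x` itself plays suffices: before the first move that `x` misses, `x` follows
the path, so `y` misses that move too. -/
theorem playsTo_congr {x y : G.Strat i} {z : G.Hist}
    (h : ∀ m ∈ sequence i z, PlaysToInfo x m.1 → y m.1 = x m.1) :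
    PlaysTo y z ↔ PlaysTo x z := by
  have key : ∀ {l₁ m l₂}, sequence i z = l₁ ++ m :: l₂ → (∀ m' ∈ l₁, (x m'.1 : ℕ) = m'.2) →
      y m.1 = x m.1 := by
    intro l₁ m l₂ hl hx
    obtain ⟨e, -, he, -, hs⟩ := sequence_split hl
    exact h m (by rw [hl]; simp) ⟨_, he, by rw [PlaysTo, hs]; exact hx⟩
  constructor
  · intro hy
    by_contra hx
    obtain ⟨l₁, m, l₂, hl, h1, h2⟩ := List.exists_first_not hx
    rw [← key hl h1] at h2
    exact h2 (hy m (by rw [hl]; simp))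
  · intro hx m hm
    obtain ⟨l₁, l₂, hl⟩ := List.append_of_mem hm
    rw [key hl fun m' hm' => hx m' (by rw [hl]; simp [hm'])]
    exact hx m hm

/-- The strategy `x` leaves the path to `I` at the sequence `Ja`. -/
def Leaves (x : G.Strat i) (J : G.Infoset i) (a : Fin (G.numActions J.1)) (I : G.Infoset i) :
    Prop :=
  (∃ c, (J, c) ∈ seqTo I ∧ (a : ℕ) ≠ c) ∧ PlaysToSeq x J a

theorem PerfectRecall.leaves_iff (hG : G.PerfectRecall) {x : G.Strat i} {J I : G.Infoset i}
    {a : Fin (G.numActions J.1)} (hI : ¬ PlaysToInfo x I) :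
    Leaves x J a I ↔ InfoLe J I ∧ PlaysToSeq x J a ∧ ¬ SeqLe J a I := by
  rw [hG.infoLe_iff, hG.seqLe_iff]
  constructor
  · rintro ⟨⟨c, hc, hac⟩, hp⟩
    exact ⟨Or.inr ⟨c, hc⟩, hp, fun h => hac (hG.action_unique h hc)⟩
  · rintro ⟨rfl | ⟨c, hc⟩, hp, h⟩
    · exact absurd hp.1 hI
    · exact ⟨⟨c, hc, fun h' => h (h' ▸ hc)⟩, hp⟩

theorem PerfectRecall.not_playsToInfo_of_leaves (hG : G.PerfectRecall) {x : G.Strat i}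
    {J I : G.Infoset i} {a : Fin (G.numActions J.1)} (h : Leaves x J a I) :
    ¬ PlaysToInfo x I := by
  obtain ⟨⟨c, hc, hac⟩, -, rfl⟩ := h
  exact fun hI => hac (hG.playsToInfo_iff.1 hI _ hc)

theorem PerfectRecall.exists_leaves (hG : G.PerfectRecall) {x : G.Strat i} {I : G.Infoset i}
    (h : ¬ PlaysToInfo x I) : ∃ J, Leaves x J (x J) I := by
  rw [hG.playsToInfo_iff] at h
  obtain ⟨l₁, m, l₂, hl, h1, h2⟩ := List.exists_first_not h
  refine ⟨m.1, ⟨m.2, ?_, h2⟩, ?_, rfl⟩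
  · rw [hl]; simp
  · rw [hG.playsToInfo_iff, ← hG.eq_seqTo hl]
    exact h1

/-- Both `J` and `J'` lie on the path to `I`, hence are comparable. Playing to the later one
requires at the earlier one the very action that leaving there forbids. -/
theorem PerfectRecall.leaves_unique (hG : G.PerfectRecall) {x : G.Strat i} {I J J' : G.Infoset i}
    {a : Fin (G.numActions J.1)} {a' : Fin (G.numActions J'.1)} (h : Leaves x J a I)
    (h' : Leaves x J' a' I) : J = J' := by
  have key : ∀ {J J' : G.Infoset i} {a : Fin (G.numActions J.1)} {a' : Fin (G.numActions J'.1)},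
      Leaves x J a I → Leaves x J' a' I → InfoLe J J' → J = J' := by
    rintro J J' a a' ⟨⟨c, hc, hac⟩, hJ, rfl⟩ ⟨⟨c', hc', hac'⟩, hJ', rfl⟩ hle
    rcases hG.infoLe_iff.1 hle with rfl | ⟨d, hd⟩
    · rfl
    · have h1 := hG.action_unique hc (hG.mem_sequence_of_mem_seqTo hc' hd)
      exact absurd ((hG.playsToInfo_iff.1 hJ' _ hd).trans h1.symm) hac
  obtain ⟨c, hc, -⟩ := h.1
  obtain ⟨c', hc', -⟩ := h'.1
  rcases infoLe_total_of_mem_sequence hc hc' with hle | hle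
  · exact key h h' hle
  · exact (key h' h hle).symm

theorem Leaves.action_eq {x : G.Strat i} {I J : G.Infoset i} {a : Fin (G.numActions J.1)}
    (h : Leaves x J a I) : x J = a := h.2.2

/-- Leaving the path to `I` means leaving the paths to all information sets below. -/
theorem PerfectRecall.leaves_of_infoLe (hG : G.PerfectRecall) {x : G.Strat i}
    {I I' J : G.Infoset i} {a : Fin (G.numActions J.1)} (h : Leaves x J a I) (hI : InfoLe I I') :
    Leaves x J a I' := by
  obtain ⟨⟨c, hc, hac⟩, hp⟩ := h
  rcases hG.infoLe_iff.1 hI with rfl | ⟨d, hd⟩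
  · exact ⟨⟨c, hc, hac⟩, hp⟩
  · exact ⟨⟨c, hG.mem_sequence_of_mem_seqTo hd hc, hac⟩, hp⟩

end Game

/-! ## Conversions are outcome equivalent behavioral correlated equilibria -/

namespace Game

variable {G : Game} {i : Fin G.numPlayers}

/-! ### Expectations -/

theorem Correlated.expect_add (μ : G.Correlated) (f g : G.Profile → ℚ) :
    (μ.expect fun x => f x + g x) = μ.expect f + μ.expect g := by
  simp only [Correlated.expect, mul_add, Finset.sum_add_distrib]

theorem Correlated.expect_sub (μ : G.Correlated) (f g : G.Profile → ℚ) :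
    (μ.expect fun x => f x - g x) = μ.expect f - μ.expect g := by
  simp only [Correlated.expect, mul_sub, Finset.sum_sub_distrib]

theorem Correlated.expect_sum {ι : Type*} (μ : G.Correlated) (s : Finset ι)
    (f : ι → G.Profile → ℚ) :
    (μ.expect fun x => ∑ p ∈ s, f p x) = ∑ p ∈ s, μ.expect (f p) := by
  simp only [Correlated.expect, Finset.mul_sum]
  exact Finset.sum_comm

theorem Correlated.expect_const_mul (μ : G.Correlated) (c : ℚ) (f : G.Profile → ℚ) :
    (μ.expect fun x => c * f x) = c * μ.expect f := by
  simp only [Correlated.expect, Finset.mul_sum]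
  exact Finset.sum_congr rfl fun x _ => by ring

/-- Averaging over support indices instead of profiles: the conversion keeps indices and weights, so
it becomes a substitution inside `f`, even if it merges strategies. -/
theorem Mixture.expect_eq {T K : ℕ} (π : G.Mixture T K) (f : G.Profile → ℚ) :
    π.toCorrelated.expect f = ∑ t, π.α t * ∑ k : Fin G.numPlayers → Fin K,
      (∏ i, π.β t i (k i)) * f fun i => π.strat t i (k i) := by
  have h : ∀ x t, (∏ i, ∑ k, if π.strat t i k = x i then π.β t i k else 0) =
      ∑ k : Fin G.numPlayers → Fin K,
        if (fun i => π.strat t i (k i)) = x then ∏ i, π.β t i (k i) else 0 := by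
    intro x t
    rw [Finset.prod_univ_sum, Fintype.piFinset_univ]
    refine Finset.sum_congr rfl fun k _ => ?_
    rw [Finset.prod_ite_zero]
    simp [funext_iff]
  simp only [Correlated.expect, Mixture.toCorrelated, h, Finset.sum_mul]
  rw [Finset.sum_comm]
  refine Finset.sum_congr rfl fun t _ => ?_
  simp only [mul_assoc, Finset.sum_mul, ← Finset.mul_sum]
  congr 1
  rw [Finset.sum_comm]
  refine Finset.sum_congr rfl fun k _ => ?_
  simp only [ite_mul, zero_mul]
  rw [Finset.sum_ite_eq]
  simp

/-- The sum over `K ^ n` index tuples factors into `n` sums of `K` terms, which is what makes the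
weights computable in polynomial time. -/
theorem Mixture.expect_prod {T K : ℕ} (π : G.Mixture T K)
    (f : (j : Fin G.numPlayers) → G.Strat j → ℚ) :
    (π.toCorrelated.expect fun x => ∏ j, f j (x j)) =
      ∑ t, π.α t * ∏ j, ∑ k, π.β t j k * f j (π.strat t j k) := by
  rw [π.expect_eq]
  refine Finset.sum_congr rfl fun t _ => ?_
  rw [Finset.prod_univ_sum, Fintype.piFinset_univ]
  simp only [Finset.prod_mul_distrib]

/-! ### Utilities under changes of strategies -/

/-- Counterfactual utility at `I` sees the player's own strategy only from `I` on, and the opponents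
only through their reach indicators. -/
theorem PerfectRecall.cfUtil_update_congr (hG : G.PerfectRecall) {x x' : G.Profile}
    {y y' : G.Strat i} {I : G.Infoset i} (hy : ∀ I', InfoLe I I' → y I' = y' I')
    (hx : ∀ j, j ≠ i → ∀ z, PlaysTo (x j) z ↔ PlaysTo (x' j) z) :
    cfUtil i (Function.update x i y) I = cfUtil i (Function.update x' i y') I := by
  unfold cfUtil
  refine Finset.sum_congr rfl fun z _ => ?_
  have h1 : PlaysFrom y I z ↔ PlaysFrom y' I z := by
    rw [hG.playsFrom_iff, hG.playsFrom_iff]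
    exact forall₂_congr fun m _ => forall_congr' fun hI => by rw [hy _ hI]
  have h2 : ∏ j ∈ Finset.univ.erase i, reach (Function.update x i y j) z =
      ∏ j ∈ Finset.univ.erase i, reach (Function.update x' i y' j) z := by
    refine Finset.prod_congr rfl fun j hj => ?_
    have hj : j ≠ i := Finset.ne_of_mem_erase hj
    rw [Function.update_of_ne hj, Function.update_of_ne hj, reach, reach]
    simp only [hx j hj z]
  rw [h2, Function.update_self, Function.update_self]
  simp only [h1]

theorem PerfectRecall.playsTo_iff_playsFrom (hG : G.PerfectRecall) {y : G.Strat i}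
    {I : G.Infoset i} {z : G.Hist} {c : ℕ} (hz : (I, c) ∈ sequence i z) (hy : PlaysToInfo y I) :
    PlaysTo y z ↔ PlaysFrom y I z := by
  rw [hG.playsFrom_iff]
  refine ⟨fun h m hm _ => h m hm, fun h m hm => ?_⟩
  rcases infoLe_total_of_mem_sequence hz hm with hI | hI
  · exact h m hm hI
  · rcases hG.infoLe_iff.1 hI with h1 | ⟨d, hd⟩
    · exact h m hm (h1 ▸ InfoLe.refl _)
    · have h1 := hG.playsToInfo_iff.1 hy _ hd
      rw [h1]
      exact hG.action_unique (hG.mem_sequence_of_mem_seqTo hz hd) hm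

theorem util_eq (x : G.Profile) :
    util i x = ∑ z ∈ Finset.univ.filter G.Terminal, G.utility i z * chanceProb z *
      (if PlaysTo (x i) z then 1 else 0) * ∏ j ∈ Finset.univ.erase i, reach (x j) z := by
  refine Finset.sum_congr rfl fun z _ => ?_
  rw [← Finset.mul_prod_erase _ _ (Finset.mem_univ i), ← mul_assoc]
  rfl

theorem cfUtil_eq (x : G.Profile) (I : G.Infoset i) :
    cfUtil i x I = ∑ z ∈ Finset.univ.filter G.Terminal, if InfoLeHist I z then
      G.utility i z * chanceProb z * (if PlaysFrom (x i) I z then 1 else 0) *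
        ∏ j ∈ Finset.univ.erase i, reach (x j) z else 0 := by
  rw [← Finset.sum_filter, Finset.filter_filter]
  rfl

/-- Outside the subtree of `I` both strategies reach the same histories and the terms cancel. Both
play to `I`, so inside it reaching `z` means playing from `I` to `z`. -/
theorem PerfectRecall.util_sub_eq (hG : G.PerfectRecall) {x : G.Profile} {y : G.Strat i}
    {I : G.Infoset i} (hI : PlaysToInfo (x i) I)
    (hy : ∀ I', ¬ InfoLe I I' → PlaysToInfo (x i) I' → y I' = x i I') :
    util i (Function.update x i y) - util i x =
      cfUtil i (Function.update x i y) I - cfUtil i x I := by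
  rw [util_eq, util_eq, cfUtil_eq, cfUtil_eq, ← Finset.sum_sub_distrib, ← Finset.sum_sub_distrib]
  refine Finset.sum_congr rfl fun z hz => ?_
  have hz := (Finset.mem_filter.1 hz).2
  have h2 : ∏ j ∈ Finset.univ.erase i, reach (Function.update x i y j) z =
      ∏ j ∈ Finset.univ.erase i, reach (x j) z :=
    Finset.prod_congr rfl fun j hj => by
      rw [Function.update_of_ne (Finset.ne_of_mem_erase hj)]
  rw [h2, Function.update_self]
  have hyI : PlaysToInfo y I := by
    rw [hG.playsToInfo_iff] at hI ⊢
    intro m hm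
    rw [hy m.1 (fun h => (hG.firstHist_le_of_infoLe h).not_gt (firstHist_lt_of_mem_seqTo hm)) ?_]
    · exact hI m hm
    · exact hG.playsToInfo_of_infoLe (infoLe_of_mem_seqTo hm) (hG.playsToInfo_iff.2 hI)
  by_cases hIz : InfoLeHist I z
  · obtain ⟨c, hc⟩ := (infoLeHist_terminal hz).1 hIz
    simp only [hIz, if_true, hG.playsTo_iff_playsFrom hc hyI, hG.playsTo_iff_playsFrom hc hI]
  · have : PlaysTo y z ↔ PlaysTo (x i) z := by
      refine playsTo_congr fun m hm hp => hy _ (fun hle => hIz ?_) hp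
      refine (infoLeHist_terminal hz).2 ?_
      rcases hG.infoLe_iff.1 hle with h1 | ⟨d, hd⟩
      · exact ⟨m.2, by rw [h1]; exact hm⟩
      · exact ⟨d, hG.mem_sequence_of_mem_seqTo hm hd⟩
    simp only [hIz, if_false, this, sub_self]

theorem util_update_of_playsTo {x : G.Profile} {y : G.Strat i}
    (hy : ∀ z, PlaysTo y z ↔ PlaysTo (x i) z) : util i (Function.update x i y) = util i x := by
  refine Finset.sum_congr rfl fun z _ => ?_
  congr 1
  refine Finset.prod_congr rfl fun j _ => ?_
  by_cases hj : j = i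
  · subst hj
    rw [Function.update_self, reach, reach]
    simp only [hy z]
  · rw [Function.update_of_ne hj]

/-! ### The converted strategy -/

open Classical in
/-- The strategy `x`, changed to best responses at the information sets that it does not play to. -/
noncomputable def convStrat (br : (J : G.Infoset i) → Fin (G.numActions J.1) → G.Strat i)
    (x : G.Strat i) : G.Strat i := fun I =>
  if PlaysToInfo x I then x I
  else if h : ∃ J, Leaves x J (x J) I then br h.choose (x h.choose) I
  -- Never used under perfect recall, by `exists_leaves`.
  else x I

section convStrat

variable {br : (J : G.Infoset i) → Fin (G.numActions J.1) → G.Strat i} {x y : G.Strat i}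
  {I J : G.Infoset i} {a : Fin (G.numActions J.1)}

theorem convStrat_of_plays (h : PlaysToInfo x I) : convStrat br x I = x I := if_pos h

theorem PerfectRecall.convStrat_of_leaves (hG : G.PerfectRecall) (h : Leaves x J a I) :
    convStrat br x I = br J a I := by
  have hx := h.action_eq
  subst hx
  have h1 : ∃ J, Leaves x J (x J) I := ⟨J, h⟩
  have h2 : h1.choose = J := hG.leaves_unique h1.choose_spec h
  rw [convStrat, if_neg (hG.not_playsToInfo_of_leaves h), dif_pos h1, h2]

theorem playsTo_convStrat (z : G.Hist) : PlaysTo (convStrat br x) z ↔ PlaysTo x z :=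
  playsTo_congr fun _ _ h => convStrat_of_plays h

/-- The converted action at an information set depends only on the sequences above it. -/
theorem PerfectRecall.convStrat_congr (hG : G.PerfectRecall)
    (h : ∀ J, InfoLe J I → ∀ a, PlaysToSeq x J a ↔ PlaysToSeq y J a) :
    convStrat br x I = convStrat br y I := by
  by_cases hI : PlaysToInfo x I
  · have h1 := (h I (.refl I) (x I)).1 ⟨hI, rfl⟩
    rw [convStrat_of_plays hI, convStrat_of_plays h1.1, h1.2]
  · obtain ⟨J, hJ⟩ := hG.exists_leaves hI
    have hle : InfoLe J I := ((hG.leaves_iff hI).1 hJ).1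
    have hJ' : Leaves y J (x J) I := ⟨hJ.1, (h J hle _).1 hJ.2⟩
    rw [hG.convStrat_of_leaves hJ, hG.convStrat_of_leaves hJ']

end convStrat

/-- The two clauses of `IsConversion` cover every information set, since a leaving sequence always
exists; so the best responses determine the conversion. -/
theorem PerfectRecall.strat_eq_convStrat (hG : G.PerfectRecall)
    {br : (J : G.Infoset i) → Fin (G.numActions J.1) → G.Strat i} {x x' : G.Strat i}
    (h : ∀ I, (PlaysToInfo x I → x' I = x I) ∧ (¬ PlaysToInfo x I → ∀ J a, InfoLe J I →
      PlaysToSeq x J a → ¬ SeqLe J a I → x' I = br J a I)) : x' = convStrat br x := by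
  funext I
  by_cases hI : PlaysToInfo x I
  · rw [convStrat_of_plays hI, (h I).1 hI]
  · obtain ⟨J, hJ⟩ := hG.exists_leaves hI
    obtain ⟨h1, h2, h3⟩ := (hG.leaves_iff hI).1 hJ
    rw [hG.convStrat_of_leaves hJ, (h I).2 hI J _ h1 h2 h3]

/-! ### Best responses -/

theorem Correlated.expect_ite_eq_zero (μ : G.Correlated) {P : G.Profile → Prop} [DecidablePred P]
    (h : (μ.expect fun x => if P x then 1 else 0) = 0) (f : G.Profile → ℚ) :
    (μ.expect fun x => if P x then f x else 0) = 0 := by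
  unfold Correlated.expect at h ⊢
  rw [Finset.sum_eq_zero_iff_of_nonneg] at h
  · refine Finset.sum_eq_zero fun x hx => ?_
    have := h x hx
    by_cases hP : P x <;> simp_all
  · intro x _
    exact mul_nonneg (μ.nonneg x) (by beta_reduce; split_ifs <;> simp)

theorem Correlated.expect_ite_nonneg (μ : G.Correlated) (P : G.Profile → Prop) [DecidablePred P] :
    0 ≤ μ.expect fun x => if P x then 1 else 0 :=
  Finset.sum_nonneg fun x _ => mul_nonneg (μ.nonneg x) (by beta_reduce; split_ifs <;> simp)

theorem Correlated.IsCondBestResponse.expect_le {μ : G.Correlated} {J : G.Infoset i}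
    {a : Fin (G.numActions J.1)} {y : G.Strat i} (h : μ.IsCondBestResponse J a y)
    {I : G.Infoset i} (hI : InfoLe J I) (y' : G.Strat i) :
    (μ.expect fun x => if PlaysToSeq (x i) J a then cfUtil i (Function.update x i y') I else 0) ≤
      μ.expect fun x => if PlaysToSeq (x i) J a then cfUtil i (Function.update x i y) I else 0 := by
  rcases (μ.expect_ite_nonneg fun x => PlaysToSeq (x i) J a).eq_or_lt with h0 | h0
  · rw [μ.expect_ite_eq_zero h0.symm, μ.expect_ite_eq_zero h0.symm]
  · exact (div_le_div_iff_of_pos_right h0).1 (h I hI y')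

/-! ### The equilibrium property -/

open Classical in
/-- The causal deviation that follows `φ` on converted strategies from the information set `I` on,
if the strategy plays to `I`. -/
noncomputable def deviateFrom (br : (J : G.Infoset i) → Fin (G.numActions J.1) → G.Strat i)
    (φ : G.Strat i → G.Strat i) (I : G.Infoset i) (x : G.Strat i) : G.Strat i := fun I' =>
  if PlaysToInfo x I ∧ InfoLe I I' then φ (convStrat br x) I'
  -- A fixed action, as a causal deviation cannot see the recommendation at an information set that
  -- `x` does not play to.
  else if PlaysToInfo x I' then x I' else ⟨0, G.numActions_pos _⟩

theorem PerfectRecall.causal_deviateFrom (hG : G.PerfectRecall)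
    (br : (J : G.Infoset i) → Fin (G.numActions J.1) → G.Strat i)
    {φ : G.Strat i → G.Strat i} (hφ : Behavioral φ) (I : G.Infoset i) :
    Causal (deviateFrom br φ I) := by
  intro I' x y h
  have hplays : ∀ J, InfoLe J I' → (PlaysToInfo x J ↔ PlaysToInfo y J) := fun J hJ =>
    ⟨fun hx => ((h J hJ (x J)).1 ⟨hx, rfl⟩).1, fun hy => ((h J hJ (y J)).2 ⟨hy, rfl⟩).1⟩
  unfold deviateFrom
  have h1 : (PlaysToInfo x I ∧ InfoLe I I') ↔ (PlaysToInfo y I ∧ InfoLe I I') :=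
    and_congr_left fun hI => hplays I hI
  by_cases hc : PlaysToInfo x I ∧ InfoLe I I'
  · rw [if_pos hc, if_pos (h1.1 hc)]
    refine hφ I' _ _ fun J hJ => hG.convStrat_congr fun K hK => h K (hG.infoLe_trans hK hJ)
  · rw [if_neg hc, if_neg (mt h1.2 hc)]
    by_cases hI' : PlaysToInfo x I'
    · rw [if_pos hI', if_pos ((hplays I' (.refl I')).1 hI'), ((h I' (.refl I') (x I')).1 ⟨hI', rfl⟩).2]
    · rw [if_neg hI', if_neg (mt (hplays I' (.refl I')).2 hI')]

section equilibrium

variable {br : (i : Fin G.numPlayers) → (J : G.Infoset i) → Fin (G.numActions J.1) → G.Strat i}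

/-- The gain in counterfactual utility at `I` if `φ` is applied to the converted strategy. -/
noncomputable def gain (br : (J : G.Infoset i) → Fin (G.numActions J.1) → G.Strat i)
    (φ : G.Strat i → G.Strat i) (I : G.Infoset i) (x : G.Profile) : ℚ :=
  cfUtil i (Function.update x i (φ (convStrat br (x i)))) I -
    cfUtil i (Function.update x i (convStrat br (x i))) I

/-- If `x i` does not play to `I`, the deviation alters it only off its own path, and utility is
unchanged. Otherwise the utility gain equals the counterfactual gain at `I`. -/
theorem PerfectRecall.regret_deviateFrom (hG : G.PerfectRecall) (μ : G.Correlated)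
    (br : (J : G.Infoset i) → Fin (G.numActions J.1) → G.Strat i)
    (φ : G.Strat i → G.Strat i) (I : G.Infoset i) :
    μ.regret i (deviateFrom br φ I) =
      μ.expect fun x => if PlaysToInfo (x i) I then gain br φ I x else 0 := by
  unfold Correlated.regret
  congr 1
  funext x
  by_cases hI : PlaysToInfo (x i) I
  · rw [if_pos hI, hG.util_sub_eq hI, gain]
    · congr 1
      · refine hG.cfUtil_update_congr (fun I' hI' => ?_) fun _ _ _ => Iff.rfl
        rw [deviateFrom, if_pos ⟨hI, hI'⟩]
      -- The conversion may differ from `x i` below `I`, but both play to `I` and reach the same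
      -- histories, so their counterfactual utilities at `I` agree.
      · unfold cfUtil
        refine Finset.sum_congr rfl fun z hz => ?_
        obtain ⟨-, hz, hIz⟩ := Finset.mem_filter.1 hz
        obtain ⟨c, hc⟩ := (infoLeHist_terminal hz).1 hIz
        have h2 : ∏ j ∈ Finset.univ.erase i,
            reach (Function.update x i (convStrat br (x i)) j) z =
            ∏ j ∈ Finset.univ.erase i, reach (x j) z :=
          Finset.prod_congr rfl fun j hj => by
            rw [Function.update_of_ne (Finset.ne_of_mem_erase hj)]
        have hcI : PlaysToInfo (convStrat br (x i)) I := by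
          obtain ⟨h, hh, hp⟩ := hI
          exact ⟨h, hh, (playsTo_convStrat h).2 hp⟩
        rw [h2, Function.update_self]
        simp only [← hG.playsTo_iff_playsFrom hc hcI, ← hG.playsTo_iff_playsFrom hc hI,
          playsTo_convStrat]
    · intro I' hle hp
      rw [deviateFrom, if_neg fun h => hle h.2, if_pos hp]
  · rw [if_neg hI, sub_eq_zero]
    refine util_update_of_playsTo fun z => playsTo_congr fun m _ hp => ?_
    rw [deviateFrom, if_neg fun h => hI h.1, if_pos hp]

/-- On the event `x_i(Ja) = 1` the conversion is `br J a` from `I` on, and what `φ` can see there is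
the same for all such strategies. So one fixed strategy is compared with the best response. -/
theorem PerfectRecall.expect_gain_leaves_le (hG : G.PerfectRecall) {μ : G.Correlated}
    {br : (J : G.Infoset i) → Fin (G.numActions J.1) → G.Strat i}
    (hbr : ∀ J a, μ.IsCondBestResponse J a (br J a)) {φ : G.Strat i → G.Strat i}
    (hφ : Behavioral φ) {I J : G.Infoset i} {a : Fin (G.numActions J.1)}
    (hJ : ∃ c, (J, c) ∈ seqTo I ∧ (a : ℕ) ≠ c) :
    (μ.expect fun x => if PlaysToSeq (x i) J a then gain br φ I x else 0) ≤ 0 := by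
  by_cases hex : ∃ x₀ : G.Strat i, PlaysToSeq x₀ J a
  -- Any representative of the event may define the fixed strategy `φ (convStrat br x₀)`.
  · obtain ⟨x₀, hx₀⟩ := hex
    have hle : InfoLe J I := by
      obtain ⟨c, hc, -⟩ := hJ
      exact infoLe_of_mem_seqTo hc
    have h1 : (μ.expect fun x => if PlaysToSeq (x i) J a then gain br φ I x else 0) =
        (μ.expect fun x => if PlaysToSeq (x i) J a then
          cfUtil i (Function.update x i (φ (convStrat br x₀))) I else 0) -
        μ.expect fun x => if PlaysToSeq (x i) J a then
          cfUtil i (Function.update x i (br J a)) I else 0 := by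
      rw [← Correlated.expect_sub]
      congr 1
      funext x
      by_cases hx : PlaysToSeq (x i) J a
      · simp only [if_pos hx]
        rw [gain]
        have hl : ∀ I', InfoLe I I' → Leaves (x i) J a I' := fun I' hI' =>
          hG.leaves_of_infoLe ⟨hJ, hx⟩ hI'
        congr 1
        · refine hG.cfUtil_update_congr (fun I' hI' => ?_) fun _ _ _ => Iff.rfl
          refine hφ I' _ _ fun K hK => ?_
          -- Playing to `Ja` prescribes every action up to and including `J`.
          have key : ∀ {K'}, InfoLe K' J → ∀ b, PlaysToSeq (x i) K' b ↔ PlaysToSeq x₀ K' b := by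
            intro K' hK' b
            have e : x i K' = x₀ K' := by
              rcases hG.infoLe_iff.1 hK' with rfl | ⟨d, hd⟩
              · rw [hx.2, hx₀.2]
              · exact Fin.ext ((hG.playsToInfo_iff.1 hx.1 _ hd).trans
                  (hG.playsToInfo_iff.1 hx₀.1 _ hd).symm)
            simp only [PlaysToSeq, e, hG.playsToInfo_of_infoLe hK' hx.1,
              hG.playsToInfo_of_infoLe hK' hx₀.1]
          obtain ⟨c, hc, hac⟩ := hJ
          rcases hG.infoLe_iff.1 (hG.infoLe_trans hle hI') with rfl | ⟨d, hd⟩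
          · exact hG.convStrat_congr fun K' hK' => key (hG.infoLe_trans hK' hK)
          -- `K` and `J` both precede `I'`, so `K` is at or above `J`, where the two strategies
          -- agree, or below `J`, where both have left at `Ja`.
          · have hcmp : InfoLe K J ∨ ∃ c', (J, c') ∈ seqTo K := by
              rcases hG.infoLe_iff.1 hK with rfl | ⟨k, hk⟩
              · exact Or.inr ⟨d, hd⟩
              · rcases infoLe_total_of_mem_sequence hk hd with h3 | h3
                · exact Or.inl h3
                · rcases hG.infoLe_iff.1 h3 with h4 | h4
                  · left
                    have h5 : J = K := h4
                    rw [← h5]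
                    exact .refl _
                  · exact Or.inr h4
            rcases hcmp with h3 | ⟨c', hc'⟩
            · exact hG.convStrat_congr fun K' hK' => key (hG.infoLe_trans hK' h3)
            · have hcc : (a : ℕ) ≠ c' := by
                obtain ⟨c'', hc'', hac''⟩ := (hl I' hI').1
                have hKI : (J, c') ∈ seqTo I' := by
                  rcases hG.infoLe_iff.1 hK with rfl | ⟨k, hk⟩
                  · exact hc'
                  · exact hG.mem_sequence_of_mem_seqTo hk hc'
                rwa [hG.action_unique hKI hc'']
              rw [hG.convStrat_of_leaves (J := J) (a := a) ⟨⟨c', hc', hcc⟩, hx⟩,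
                hG.convStrat_of_leaves (J := J) (a := a) ⟨⟨c', hc', hcc⟩, hx₀⟩]
        · refine hG.cfUtil_update_congr (fun I' hI' => ?_) fun _ _ _ => Iff.rfl
          exact hG.convStrat_of_leaves (hl I' hI')
      · simp only [if_neg hx, sub_zero]
    rw [h1, sub_nonpos]
    exact (hbr J a).expect_le hle _
  · have : (fun x : G.Profile => if PlaysToSeq (x i) J a then gain br φ I x else 0) =
        fun _ => 0 := by
      funext x
      rw [if_neg fun h => hex ⟨_, h⟩]
    rw [this]
    simp [Correlated.expect]

-- Playing to `I` and leaving its path at the various `Ja` partition the strategies.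
open Classical in
theorem PerfectRecall.gain_eq (hG : G.PerfectRecall)
    (br : (J : G.Infoset i) → Fin (G.numActions J.1) → G.Strat i)
    (φ : G.Strat i → G.Strat i) (I : G.Infoset i) (x : G.Profile) :
    gain br φ I x = (if PlaysToInfo (x i) I then gain br φ I x else 0) +
      ∑ p : (J : G.Infoset i) × Fin (G.numActions J.1),
        if Leaves (x i) p.1 p.2 I then gain br φ I x else 0 := by
  by_cases hI : PlaysToInfo (x i) I
  · rw [if_pos hI, Finset.sum_eq_zero, add_zero]
    intro p _
    rw [if_neg fun h => hG.not_playsToInfo_of_leaves h hI]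
  · obtain ⟨J, hJ⟩ := hG.exists_leaves hI
    rw [if_neg hI, zero_add, Finset.sum_eq_single ⟨J, x i J⟩, if_pos hJ]
    · rintro ⟨J', a⟩ _ hne
      rw [if_neg]
      intro h
      obtain rfl := hG.leaves_unique hJ h
      exact hne (by rw [h.action_eq])
    · simp

theorem PerfectRecall.expect_gain_le (hG : G.PerfectRecall) {μ : G.Correlated} {ε : ℝ}
    (hμ : μ.IsEFCE ε) {br : (J : G.Infoset i) → Fin (G.numActions J.1) → G.Strat i}
    (hbr : ∀ J a, μ.IsCondBestResponse J a (br J a)) {φ : G.Strat i → G.Strat i}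
    (hφ : Behavioral φ) (I : G.Infoset i) : (μ.expect (gain br φ I) : ℝ) ≤ ε := by
  classical
  have h1 : μ.expect (gain br φ I) = μ.regret i (deviateFrom br φ I) +
      ∑ p : (J : G.Infoset i) × Fin (G.numActions J.1),
        μ.expect fun x => if Leaves (x i) p.1 p.2 I then gain br φ I x else 0 := by
    rw [hG.regret_deviateFrom, ← Correlated.expect_sum, ← Correlated.expect_add]
    exact congrArg _ (funext fun x => hG.gain_eq br φ I x)
  have h2 : (∑ p : (J : G.Infoset i) × Fin (G.numActions J.1),
      μ.expect fun x => if Leaves (x i) p.1 p.2 I then gain br φ I x else 0) ≤ 0 := by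
    refine Finset.sum_nonpos fun p _ => ?_
    by_cases hp : ∃ c, (p.1, c) ∈ seqTo I ∧ (p.2 : ℕ) ≠ c
    · have := hG.expect_gain_leaves_le hbr hφ hp
      simpa only [Leaves, hp, true_and] using this
    · simp [Leaves, hp, Correlated.expect]
  have h3 := hμ i _ (hG.causal_deviateFrom br hφ I)
  have h4 : (μ.expect (gain br φ I) : ℝ) ≤ (μ.regret i (deviateFrom br φ I) : ℝ) := by
    rw [h1]
    exact_mod_cast by linarith
  exact h4.trans h3

end equilibrium

variable {T K : ℕ} {π π' : G.Mixture T K}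

theorem PerfectRecall.expect_of_isConversion (hG : G.PerfectRecall) (h : π.IsConversion π') :
    ∃ br : (i : Fin G.numPlayers) → (J : G.Infoset i) → Fin (G.numActions J.1) → G.Strat i,
      (∀ i J a, π.toCorrelated.IsCondBestResponse J a (br i J a)) ∧
      ∀ f, π'.toCorrelated.expect f =
        π.toCorrelated.expect fun x => f fun i => convStrat (br i) (x i) := by
  obtain ⟨hα, hβ, br, hbr, hs⟩ := h
  have hs' : ∀ t i k, π'.strat t i k = convStrat (br i) (π.strat t i k) := fun t i k =>
    hG.strat_eq_convStrat (hs t i k)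
  exact ⟨br, hbr, fun f => by rw [Mixture.expect_eq, Mixture.expect_eq]; simp only [hα, hβ, hs']⟩

theorem PerfectRecall.outcomeEquiv_of_isConversion (hG : G.PerfectRecall)
    (h : π.IsConversion π') : π.toCorrelated.OutcomeEquiv π'.toCorrelated := by
  obtain ⟨br, -, he⟩ := hG.expect_of_isConversion h
  intro z _
  rw [Correlated.outcome, Correlated.outcome, he]
  simp only [reach, playsTo_convStrat]

/-- The opponents may be put back to their original strategies, since conversion preserves their
reach indicators; what remains is the expected `gain`. -/
theorem PerfectRecall.isBCE_of_isConversion (hG : G.PerfectRecall) (h : π.IsConversion π')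
    {ε : ℝ} (hε : π.toCorrelated.IsEFCE ε) : π'.toCorrelated.IsBCE ε := by
  obtain ⟨br, hbr, he⟩ := hG.expect_of_isConversion h
  intro i φ hφ I
  rw [Correlated.cfRegret, he]
  have h1 : (fun x : G.Profile => cfUtil i (Function.update (fun j => convStrat (br j) (x j)) i
        (φ (convStrat (br i) (x i)))) I - cfUtil i (fun j => convStrat (br j) (x j)) I) =
      gain (br i) φ I := by
    funext x
    rw [gain]
    congr 1
    · exact hG.cfUtil_update_congr (fun _ _ => rfl) fun j _ z => playsTo_convStrat z
    · rw [← Function.update_eq_self i fun j => convStrat (br j) (x j)]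
      exact hG.cfUtil_update_congr (fun _ _ => rfl) fun j _ z => playsTo_convStrat z
  rw [h1]
  exact hG.expect_gain_le hε (hbr i) hφ I

end Game

/-! ## Best responses by backward traversal -/

namespace Game

variable {G : Game} {i : Fin G.numPlayers}

open Classical in
/-- The total weight of the histories below `I` to which the strategy plays from `I`. -/
noncomputable def subtreeValue (W : G.Hist → ℚ) (I : G.Infoset i) (y : G.Strat i) : ℚ :=
  ∑ z, if (∃ c, (I, c) ∈ sequence i z) ∧
    ∀ m ∈ sequence i z, InfoLe I m.1 → (y m.1 : ℕ) = m.2 then W z else 0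

open Classical in
/-- The total weight of the histories below the action `b` at `I` to which the strategy plays from
there. -/
noncomputable def actionVal (W : G.Hist → ℚ) (s : G.Strat i) (I : G.Infoset i) (b : ℕ) : ℚ :=
  ∑ z, if (I, b) ∈ sequence i z ∧
    ∀ m ∈ sequence i z, firstHist I < firstHist m.1 → (s m.1 : ℕ) = m.2 then W z else 0

theorem actionVal_congr {W : G.Hist → ℚ} {s s' : G.Strat i} {I : G.Infoset i} {b : ℕ}
    (h : ∀ I', firstHist I < firstHist I' → s I' = s' I') :
    actionVal W s I b = actionVal W s' I b := by
  unfold actionVal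
  refine Finset.sum_congr rfl fun z _ => ?_
  congr 1
  refine propext (and_congr_right fun _ => forall₂_congr fun m _ => forall_congr' fun hm => ?_)
  rw [h _ hm]

open Classical in
/-- The value of the subtree of `I`, split at an information set below. -/
theorem PerfectRecall.subtreeValue_eq (hG : G.PerfectRecall) (W : G.Hist → ℚ) {I I₀ : G.Infoset i}
    (hI : InfoLe I I₀) (y : G.Strat i) :
    subtreeValue W I y =
      (∑ z, if (¬ ∃ c, (I₀, c) ∈ sequence i z) ∧ (∃ c, (I, c) ∈ sequence i z) ∧
        ∀ m ∈ sequence i z, InfoLe I m.1 → (y m.1 : ℕ) = m.2 then W z else 0) +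
      if ∀ m ∈ seqTo I₀, InfoLe I m.1 → (y m.1 : ℕ) = m.2 then actionVal W y I₀ (y I₀) else 0 := by
  have h1 : (if ∀ m ∈ seqTo I₀, InfoLe I m.1 → (y m.1 : ℕ) = m.2 then
      actionVal W y I₀ (y I₀) else 0) =
      ∑ z, if (∃ c, (I₀, c) ∈ sequence i z) ∧ (∃ c, (I, c) ∈ sequence i z) ∧
        ∀ m ∈ sequence i z, InfoLe I m.1 → (y m.1 : ℕ) = m.2 then W z else 0 := by
    -- Below `I₀` the moves to be matched before `I₀` do not depend on `z`, by perfect recall. The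
    -- condition on them factors out of the sum.
    have key : ∀ z, ((∃ c, (I₀, c) ∈ sequence i z) ∧ (∃ c, (I, c) ∈ sequence i z) ∧
        ∀ m ∈ sequence i z, InfoLe I m.1 → (y m.1 : ℕ) = m.2) ↔
        (∀ m ∈ seqTo I₀, InfoLe I m.1 → (y m.1 : ℕ) = m.2) ∧ (I₀, (y I₀ : ℕ)) ∈ sequence i z ∧
        ∀ m ∈ sequence i z, firstHist I₀ < firstHist m.1 → (y m.1 : ℕ) = m.2 := by
      intro z
      constructor
      · rintro ⟨⟨c, hc⟩, -, h⟩
        refine ⟨fun m hm => h m (hG.mem_sequence_of_mem_seqTo hc hm), ?_, fun m hm hlt => ?_⟩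
        · rw [show (y I₀ : ℕ) = c from h _ hc hI]
          exact hc
        · exact h m hm (hG.infoLe_trans hI ((hG.infoLe_iff_firstHist_le hc hm).2 hlt.le))
      · rintro ⟨h1, h2, h3⟩
        refine ⟨⟨_, h2⟩, ?_, fun m hm hle => ?_⟩
        · rcases hG.infoLe_iff.1 hI with rfl | ⟨d, hd⟩
          · exact ⟨_, h2⟩
          · exact ⟨d, hG.mem_sequence_of_mem_seqTo h2 hd⟩
        · rcases infoLe_total_of_mem_sequence h2 hm with h4 | h4
          · rcases (hG.firstHist_le_of_infoLe h4).lt_or_eq with h5 | h5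
            · exact h3 m hm h5
            · have h6 : I₀ = m.1 := firstHist_injective h5
              subst h6
              exact hG.action_unique h2 hm
          · rcases hG.infoLe_iff.1 h4 with h6 | ⟨d, hd⟩
            · have h6 : m.1 = I₀ := h6
              subst h6
              exact hG.action_unique h2 hm
            · rw [h1 _ hd hle]
              exact hG.action_unique (hG.mem_sequence_of_mem_seqTo h2 hd) hm
    simp only [key]
    by_cases hA : ∀ m ∈ seqTo I₀, InfoLe I m.1 → (y m.1 : ℕ) = m.2
    · rw [if_pos hA, actionVal]
      exact Finset.sum_congr rfl fun z _ => if_congr (and_iff_right hA).symm rfl rfl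
    · rw [if_neg hA]
      exact (Finset.sum_eq_zero fun z _ => if_neg fun h => hA h.1).symm
  rw [h1, subtreeValue, ← Finset.sum_add_distrib]
  refine Finset.sum_congr rfl fun z _ => ?_
  by_cases hc : ∃ c, (I₀, c) ∈ sequence i z <;> simp [hc]

/-- Improving a strategy at one information set, if the strategy is fixed below. -/
theorem PerfectRecall.subtreeValue_le_update (hG : G.PerfectRecall) (W : G.Hist → ℚ)
    {s u u' : G.Strat i} {I₀ : G.Infoset i}
    (hs : ∀ b : Fin (G.numActions I₀.1), actionVal W s I₀ b ≤ actionVal W s I₀ (s I₀))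
    (hu : ∀ I', firstHist I₀ < firstHist I' → u I' = s I') (hu₀ : u' I₀ = s I₀)
    (hu' : ∀ I', I' ≠ I₀ → u' I' = u I') (I : G.Infoset i) :
    subtreeValue W I u ≤ subtreeValue W I u' := by
  classical
  by_cases hI : InfoLe I I₀
  · rw [hG.subtreeValue_eq W hI, hG.subtreeValue_eq W hI]
    have h1 : ∀ z, ((¬ ∃ c, (I₀, c) ∈ sequence i z) ∧ (∃ c, (I, c) ∈ sequence i z) ∧
        ∀ m ∈ sequence i z, InfoLe I m.1 → (u m.1 : ℕ) = m.2) ↔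
        ((¬ ∃ c, (I₀, c) ∈ sequence i z) ∧ (∃ c, (I, c) ∈ sequence i z) ∧
        ∀ m ∈ sequence i z, InfoLe I m.1 → (u' m.1 : ℕ) = m.2) := fun z =>
      and_congr_right fun h => and_congr_right fun _ => forall₂_congr fun m hm => by
        rw [hu' m.1 fun h' => h ⟨m.2, h' ▸ hm⟩]
    have h2 : (∀ m ∈ seqTo I₀, InfoLe I m.1 → (u m.1 : ℕ) = m.2) ↔
        ∀ m ∈ seqTo I₀, InfoLe I m.1 → (u' m.1 : ℕ) = m.2 :=
      forall₂_congr fun m hm => by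
        rw [hu' m.1 fun h' => (firstHist_lt_of_mem_seqTo hm).ne (by rw [h'])]
    have h3 : actionVal W u I₀ (u I₀) ≤ actionVal W u' I₀ (u' I₀) := by
      rw [actionVal_congr hu, hu₀, actionVal_congr (s := u') (s' := s)]
      · exact hs (u I₀)
      · intro I' hI'
        rw [hu' I' fun h' => hI'.ne (by rw [h']), hu I' hI']
    simp only [h1, h2]
    split_ifs
    · linarith
    · exact le_rfl
  -- If `I₀` is not below `I`, the action at `I₀` does not enter.
  · refine le_of_eq ?_
    unfold subtreeValue
    refine Finset.sum_congr rfl fun z _ => ?_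
    congr 1
    refine propext (and_congr_right fun _ => forall₂_congr fun m _ => forall_congr' fun hm => ?_)
    rw [hu' m.1 fun h => hI (h ▸ hm)]

/-- The one-shot deviation argument along hybrids: `u n` is `s` at information sets with first
history at least `n`, and `y` elsewhere. Passing from `u (n + 1)` to `u n` changes at most one
information set, with `s` already in place at all later ones. -/
theorem PerfectRecall.subtreeValue_le (hG : G.PerfectRecall) {W : G.Hist → ℚ} {s : G.Strat i}
    (hs : ∀ (I : G.Infoset i) (b : Fin (G.numActions I.1)),
      actionVal W s I b ≤ actionVal W s I (s I)) (I : G.Infoset i) (y : G.Strat i) :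
    subtreeValue W I y ≤ subtreeValue W I s := by
  classical
  let u : ℕ → G.Strat i := fun n I' => if n ≤ (firstHist I' : ℕ) then s I' else y I'
  have step : ∀ n, subtreeValue W I (u (n + 1)) ≤ subtreeValue W I (u n) := by
    intro n
    by_cases hn : ∃ I₀ : G.Infoset i, (firstHist I₀ : ℕ) = n
    · obtain ⟨I₀, hI₀⟩ := hn
      refine hG.subtreeValue_le_update W (hs I₀) (fun I' hI' => ?_) (if_pos hI₀.ge)
        (fun I' hI' => ?_) I
      · rw [Fin.lt_def, hI₀] at hI'
        exact if_pos hI'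
      · have h1 : (firstHist I' : ℕ) ≠ n := fun h =>
          hI' (firstHist_injective (Fin.ext (h.trans hI₀.symm)))
        simp only [u]
        by_cases h2 : n ≤ (firstHist I' : ℕ)
        · rw [if_pos h2, if_pos (by omega)]
        · rw [if_neg h2, if_neg (by omega)]
    · refine le_of_eq (congrArg _ (funext fun I' => ?_))
      have h1 : (firstHist I' : ℕ) ≠ n := fun h => hn ⟨I', h⟩
      simp only [u]
      by_cases h2 : n ≤ (firstHist I' : ℕ)
      · rw [if_pos h2, if_pos (by omega)]
      · rw [if_neg h2, if_neg (by omega)]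
  have h0 : u 0 = s := funext fun I' => if_pos (Nat.zero_le _)
  have h1 : u (G.numEdges + 1) = y := funext fun I' => if_neg (by
    have := (firstHist I').isLt
    omega)
  have := antitone_nat_of_succ_le (f := fun n => subtreeValue W I (u n)) step (Nat.zero_le (G.numEdges + 1))
  simpa only [h0, h1] using this

/-! ### The weights of the histories -/

/-- A strategy of the owner of `J` plays to `Ja`; a strategy of another player plays to `z`. -/
def Meets (J : Fin G.numInfosets) (a : Fin (G.numActions J)) (z : G.Hist) {j : Fin G.numPlayers}
    (x : G.Strat j) : Prop :=
  if h : G.owner J = j then PlaysToSeq x ⟨J, h⟩ a else PlaysTo x z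

instance (J : Fin G.numInfosets) (a : Fin (G.numActions J)) (z : G.Hist) {j : Fin G.numPlayers}
    (x : G.Strat j) : Decidable (Meets J a z x) := by unfold Meets; infer_instance

/-- The utility at `z`, weighted by the probability that chance and the other players play to `z`
and the player plays to `Ja`. -/
def Correlated.histWeight (μ : G.Correlated) (J : G.Infoset i) (a : Fin (G.numActions J.1))
    (z : G.Hist) : ℚ :=
  G.utility i z * chanceProb z * μ.expect fun x => ∏ j, if Meets J.1 a z (x j) then 1 else 0

/-- Conditioning event and opponents' reach in one product over all players, the form that
`expect_prod` needs. -/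
theorem prod_meets (J : G.Infoset i) (a : Fin (G.numActions J.1)) (z : G.Hist) (x : G.Profile) :
    (∏ j, if Meets J.1 a z (x j) then (1 : ℚ) else 0) =
      (if PlaysToSeq (x i) J a then 1 else 0) * ∏ j ∈ Finset.univ.erase i, reach (x j) z := by
  rw [← Finset.mul_prod_erase _ _ (Finset.mem_univ i)]
  congr 1
  · have : Meets J.1 a z (x i) ↔ PlaysToSeq (x i) J a := by
      rw [Meets, dif_pos J.2]
    simp only [this]
  · refine Finset.prod_congr rfl fun j hj => ?_
    have : Meets J.1 a z (x j) ↔ PlaysTo (x j) z := by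
      rw [Meets, dif_neg]
      rw [J.2]
      exact (Finset.ne_of_mem_erase hj).symm
    simp only [this, reach]

theorem utility_eq_zero_of_not_terminal {z : G.Hist} (hz : ¬ G.Terminal z) :
    G.utility i z = 0 := by
  unfold Terminal at hz
  push Not at hz
  obtain ⟨e, rfl⟩ := hz
  exact G.utility_eq_zero i e

/-- Since `y` is fixed, its indicators leave the expectation. Nonterminal histories have utility
`0`, so the sum may run over all histories. -/
theorem PerfectRecall.expect_cfUtil (hG : G.PerfectRecall) (μ : G.Correlated) (J I : G.Infoset i)
    (a : Fin (G.numActions J.1)) (y : G.Strat i) :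
    (μ.expect fun x => if PlaysToSeq (x i) J a then cfUtil i (Function.update x i y) I else 0) =
      subtreeValue (μ.histWeight J a) I y := by
  classical
  have h1 : ∀ x : G.Profile,
      (if PlaysToSeq (x i) J a then cfUtil i (Function.update x i y) I else 0) =
      ∑ z, (if (∃ c, (I, c) ∈ sequence i z) ∧
        ∀ m ∈ sequence i z, InfoLe I m.1 → (y m.1 : ℕ) = m.2 then
          G.utility i z * chanceProb z else 0) *
        ∏ j, if Meets J.1 a z (x j) then (1 : ℚ) else 0 := by
    intro x
    simp only [prod_meets]
    by_cases hx : PlaysToSeq (x i) J a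
    · simp only [if_pos hx, one_mul]
      rw [cfUtil_eq, Finset.sum_filter]
      refine Finset.sum_congr rfl fun z _ => ?_
      have h2 : ∏ j ∈ Finset.univ.erase i, reach (Function.update x i y j) z =
          ∏ j ∈ Finset.univ.erase i, reach (x j) z :=
        Finset.prod_congr rfl fun j hj => by
          rw [Function.update_of_ne (Finset.ne_of_mem_erase hj)]
      by_cases hz : G.Terminal z
      · rw [if_pos hz, h2, Function.update_self]
        simp only [infoLeHist_terminal hz, hG.playsFrom_iff]
        by_cases hc : ∃ c, (I, c) ∈ sequence i z
        · by_cases hp : ∀ m ∈ sequence i z, InfoLe I m.1 → (y m.1 : ℕ) = m.2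
          · rw [if_pos hc, if_pos hp, if_pos ⟨hc, hp⟩, mul_one]
          · rw [if_pos hc, if_neg hp, if_neg fun h => hp h.2]
            ring
        · rw [if_neg hc, if_neg fun h => hc h.1, zero_mul]
      · rw [if_neg hz, utility_eq_zero_of_not_terminal hz]
        simp
    · simp [if_neg hx]
  simp only [h1]
  rw [Correlated.expect_sum, subtreeValue]
  refine Finset.sum_congr rfl fun z _ => ?_
  rw [Correlated.expect_const_mul, Correlated.histWeight]
  split_ifs <;> simp

theorem PerfectRecall.isCondBestResponse (hG : G.PerfectRecall) {μ : G.Correlated}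
    {J : G.Infoset i} {a : Fin (G.numActions J.1)} {s : G.Strat i}
    (hs : ∀ (I : G.Infoset i) (b : Fin (G.numActions I.1)),
      actionVal (μ.histWeight J a) s I b ≤ actionVal (μ.histWeight J a) s I (s I)) :
    μ.IsCondBestResponse J a s := by
  intro I _ y
  -- The normalization does not depend on the candidate, so it need not be computed.
  refine div_le_div_of_nonneg_right ?_ (μ.expect_ite_nonneg fun x => PlaysToSeq (x i) J a)
  rw [hG.expect_cfUtil, hG.expect_cfUtil]
  exact hG.subtreeValue_le hs I y

theorem Mixture.histWeight_eq {T K : ℕ} (π : G.Mixture T K) (J : G.Infoset i)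
    (a : Fin (G.numActions J.1)) (z : G.Hist) :
    π.toCorrelated.histWeight J a z = G.utility i z * chanceProb z *
      ∑ t, π.α t * ∏ j, ∑ k, if Meets J.1 a z (π.strat t j k) then π.β t j k else 0 := by
  rw [Correlated.histWeight, π.expect_prod fun j x => if Meets J.1 a z x then 1 else 0]
  simp only [mul_ite, mul_one, mul_zero]

end Game

/-! ## Correctness of the algorithm -/

/-! ### Fractions -/

/-- The fraction has a positive denominator and the given value. -/
def Frac.Represents (q : Frac) (r : ℚ) : Prop := 0 < q.2 ∧ (q.1 : ℚ) / q.2 = r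

/-- A rational number as a fraction. -/
def rawFrac (q : ℚ) : Frac := (q.num, (q.den : ℤ))

theorem represents_rawFrac (q : ℚ) : (rawFrac q).Represents q :=
  ⟨by simpa [rawFrac] using q.den_pos, by simpa [rawFrac] using q.num_div_den⟩

theorem represents_zero : Frac.Represents (0, 1) 0 := ⟨by norm_num, by simp⟩

theorem represents_fracProd {ι : Type*} (l : List ι) {f : ι → Frac} {r : ι → ℚ}
    (h : ∀ x ∈ l, (f x).Represents (r x)) : (fracProd (l.map f)).Represents (l.map r).prod := by
  induction l with
  | nil => exact ⟨by simp [fracProd], by simp [fracProd]⟩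
  | cons x t ih =>
    obtain ⟨h1, h2⟩ := ih fun y hy => h y (by simp [hy])
    obtain ⟨h3, h4⟩ := h x (by simp)
    simp only [fracProd, List.map_cons, List.prod_cons] at h1 h2 ⊢
    refine ⟨mul_pos h3 h1, ?_⟩
    push_cast at h2 ⊢
    rw [mul_div_mul_comm, h4, h2]

theorem represents_fracSum {ι : Type*} (l : List ι) {f : ι → Frac} {r : ι → ℚ}
    (h : ∀ x ∈ l, (f x).Represents (r x)) : (fracSum (l.map f)).Represents (l.map r).sum := by
  have hpos : 0 < ((l.map f).map fun q => q.2).prod := by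
    refine List.prod_pos fun z hz => ?_
    simp only [List.map_map, List.mem_map, Function.comp_apply] at hz
    obtain ⟨x, hx, rfl⟩ := hz
    exact (h x hx).1
  refine ⟨hpos, ?_⟩
  unfold fracSum
  dsimp only
  -- Each denominator divides the common one, so the integer divisions in `fracSum` are exact.
  have hdvd : ∀ x ∈ l, (f x).2 ∣ ((l.map f).map fun q => q.2).prod := fun x hx =>
    List.dvd_prod (List.mem_map_of_mem (f := fun q : Frac => q.2) (List.mem_map_of_mem hx))
  generalize ((l.map f).map fun q => q.2).prod = D at hpos hdvd
  have hD : (D : ℚ) ≠ 0 := by exact_mod_cast hpos.ne'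
  rw [div_eq_iff hD]
  induction l with
  | nil => simp
  | cons x t ih =>
    simp only [List.map_cons, List.sum_cons, add_mul]
    rw [Int.cast_add, Int.cast_mul, ih (fun y hy => h y (by simp [hy])) fun y hy => hdvd y (by simp [hy])]
    congr 1
    obtain ⟨h3, h4⟩ := h x (by simp)
    have h5 : ((f x).2 : ℚ) ≠ 0 := by exact_mod_cast h3.ne'
    rw [Int.cast_div (hdvd x (by simp)) h5, ← h4]
    field_simp

theorem fracLe_iff {q r : Frac} {a b : ℚ} (hq : q.Represents a) (hr : r.Represents b) :
    fracLe q r = true ↔ a ≤ b := by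
  obtain ⟨h1, rfl⟩ := hq
  obtain ⟨h2, rfl⟩ := hr
  have h1' : (0 : ℚ) < q.2 := by exact_mod_cast h1
  have h2' : (0 : ℚ) < r.2 := by exact_mod_cast h2
  rw [div_le_div_iff₀ h1' h2']
  simp only [fracLe, ltb, Bool.not_eq_true', decide_eq_false_iff_not, not_lt]
  exact_mod_cast Iff.rfl

/-! ### Lists -/

theorem enumReverse_ofFn {α : Type} : ∀ {n : ℕ} (f : Fin n → α),
    enumReverse (List.ofFn f) = ((List.finRange n).map fun i : Fin n => (((i : ℕ) : ℤ), f i)).reverse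
  | 0, f => by simp [enumReverse]
  | n + 1, f => by
    rw [List.ofFn_succ', List.concat_eq_append, enumReverse_append_singleton, enumReverse_ofFn,
      List.finRange_succ_last]
    simp [Function.comp_def]

theorem mem_enumReverse_ofFn {α : Type} {n : ℕ} {f : Fin n → α} {p : ℤ × α} :
    p ∈ enumReverse (List.ofFn f) ↔ ∃ i : Fin n, p = (((i : ℕ) : ℤ), f i) := by
  rw [enumReverse_ofFn]
  simp [eq_comm]

/-- An invariant for traversals from the last index down: `P m` speaks of the state once all indices
from `m` on are processed. -/
theorem foldr_finRange_induction {σ : Type*} {n : ℕ} {f : Fin n → σ → σ} {s : σ}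
    {P : ℕ → σ → Prop} (h0 : P n s) (hs : ∀ (i : Fin n) (s), P (i + 1) s → P i (f i s)) :
    P 0 ((List.finRange n).foldr f s) := by
  induction n generalizing s with
  | zero => simpa using h0
  | succ n ih =>
    rw [List.finRange_succ_last, List.foldr_append, List.foldr_map]
    exact ih (by simpa using hs (Fin.last n) s h0) fun i s => hs i.castSucc s

theorem assoc_eq {β : Type} {d b : β} {l : List (ℤ × β)} {n : ℤ} (h : (n, b) ∈ l)
    (h' : ∀ b', (n, b') ∈ l → b' = b) : assoc d l n = b := by
  unfold assoc
  cases hl : l.filter fun p => eqb p.1 n with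
  | nil =>
    have : (n, b) ∈ l.filter fun p => eqb p.1 n := by simp [h, eqb]
    rw [hl] at this
    simp at this
  | cons p t =>
    have : p ∈ l.filter fun p => eqb p.1 n := by rw [hl]; simp
    simp only [List.mem_filter, eqb, decide_eq_true_eq] at this
    obtain ⟨h1, rfl⟩ := this
    exact h' _ h1

theorem assoc_enumReverse_ofFn {α : Type} {n : ℕ} {f : Fin n → α} {d : α} (i : Fin n) :
    assoc d (enumReverse (List.ofFn f)) ((i : ℕ) : ℤ) = f i := by
  refine assoc_eq (mem_enumReverse_ofFn.2 ⟨i, rfl⟩) fun b hb => ?_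
  obtain ⟨j, hj⟩ := mem_enumReverse_ofFn.1 hb
  simp only [Prod.mk.injEq, Nat.cast_inj, Fin.val_inj] at hj
  rw [hj.2, hj.1]

theorem consistent_iff {x : RawStrat} {m : List (ℤ × ℤ)} :
    consistent x m = true ↔ ∀ q ∈ m, ∀ p ∈ x, p.1 = q.1 → p.2 = q.2 := by
  simp only [consistent, List.all_eq_true, Bool.or_eq_true, Bool.not_eq_true', eqb,
    decide_eq_false_iff_not, decide_eq_true_eq, imp_iff_not_or]

namespace Game

/-! ### Games and mixtures as raw data -/

/-- The number of the information set at a history. -/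
def infosetCode (G : Game) (h : G.Hist) : ℤ :=
  match G.infoset h with
  | some I => (I.val : ℤ)
  | none => -1

/-- The data of an edge. -/
def rawEdge (G : Game) (e : Fin G.numEdges) : ℤ × ℤ × Frac :=
  (((G.parent e).val : ℤ), (G.action e : ℤ), rawFrac (G.prob e))

/-- The game as raw data. -/
def raw (G : Game) : RawGame :=
  ((G.numPlayers : ℤ), List.ofFn G.rawEdge,
    List.ofFn fun h : G.Hist => (G.infosetCode h, List.ofFn fun i => rawFrac (G.utility i h)),
    List.ofFn fun I : Fin G.numInfosets => (((G.owner I).val : ℤ), (G.numActions I : ℤ)))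

variable {G : Game} {i : Fin G.numPlayers}

/-- A pure strategy as raw data. -/
def rawStrat (x : G.Strat i) : RawStrat :=
  (List.finRange G.numInfosets).filterMap fun I =>
    if h : G.owner I = i then some ((I.val : ℤ), ((x ⟨I, h⟩).val : ℤ)) else none

/-- A mixture as raw data. -/
def Mixture.raw {T K : ℕ} (π : G.Mixture T K) : RawMixture :=
  List.ofFn fun t : Fin T => (rawFrac (π.α t), List.ofFn fun i : Fin G.numPlayers =>
    List.ofFn fun k : Fin K => (rawFrac (π.β t i k), rawStrat (π.strat t i k)))

theorem enc_list {α : Type} [Enc α] (l : List α) : Enc.enc l = Data.ofList (l.map Enc.enc) := rfl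

theorem enc_rawFrac (q : ℚ) : Enc.enc (rawFrac q) = Data.ofRat q := rfl

theorem enc_pair {α β : Type} [Enc α] [Enc β] (a : α) (b : β) :
    Enc.enc (a, b) = Data.pair (Enc.enc a) (Enc.enc b) := rfl

theorem enc_int (z : ℤ) : Enc.enc z = Data.num z := rfl

theorem enc_raw (G : Game) : Enc.enc G.raw = G.encode := by
  simp only [raw, encode, rawEdge, enc_pair, enc_list, enc_int, List.map_ofFn, Function.comp_def,
    enc_rawFrac, infosetCode]

theorem enc_rawStrat (x : G.Strat i) : Enc.enc (rawStrat x) = encodeStrat x := by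
  rw [enc_list, rawStrat, encodeStrat, List.map_filterMap]
  congr 2
  funext I
  split_ifs <;> rfl

theorem Mixture.enc_raw {T K : ℕ} (π : G.Mixture T K) : Enc.enc π.raw = π.encode := by
  simp only [Mixture.raw, Mixture.encode, enc_pair, enc_list, List.map_ofFn, Function.comp_def,
    enc_rawFrac]
  simp only [← enc_list, enc_rawStrat]

theorem mem_rawStrat {x : G.Strat i} {p : ℤ × ℤ} :
    p ∈ rawStrat x ↔ ∃ I : G.Infoset i, p = (((I.1 : ℕ) : ℤ), ((x I : ℕ) : ℤ)) := by
  simp only [rawStrat, List.mem_filterMap, List.mem_finRange, true_and]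
  constructor
  · rintro ⟨I, hI⟩
    split_ifs at hI with h
    · exact ⟨⟨I, h⟩, (Option.some.inj hI).symm⟩
  · rintro ⟨I, rfl⟩
    exact ⟨I.1, by rw [dif_pos I.2]⟩

/-! ### The tree -/

theorem infosetCode_eq {h : G.Hist} {I : Fin G.numInfosets} :
    G.infosetCode h = ((I : ℕ) : ℤ) ↔ G.infoset h = some I := by
  unfold infosetCode
  cases hh : G.infoset h with
  | none => simp only [reduceCtorEq]
  | some J => simp [Fin.val_inj]

theorem infosetAt_raw (h : G.Hist) :
    RawGame.infosetAt G.raw ((h : ℕ) : ℤ) = G.infosetCode h := by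
  rw [RawGame.infosetAt, RawGame.hists, raw, assoc_enumReverse_ofFn]

theorem utilityAt_raw (i : Fin G.numPlayers) (h : G.Hist) :
    RawGame.utilityAt G.raw ((i : ℕ) : ℤ) ((h : ℕ) : ℤ) = rawFrac (G.utility i h) := by
  rw [RawGame.utilityAt, RawGame.hists, raw, assoc_enumReverse_ofFn, assoc_enumReverse_ofFn]

theorem ownerOf_raw (I : Fin G.numInfosets) :
    RawGame.ownerOf G.raw ((I : ℕ) : ℤ) = (((G.owner I : Fin G.numPlayers) : ℕ) : ℤ) := by
  rw [RawGame.ownerOf, raw, assoc_enumReverse_ofFn]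

/-- The default `-1` keeps chance nodes and terminal histories from being attributed to a player. -/
theorem ownerOf_raw_of_none : RawGame.ownerOf G.raw (-1) = -1 := by
  have : (enumReverse G.raw.2.2.2).filter (fun p => eqb p.1 (-1)) = [] := by
    rw [List.filter_eq_nil_iff]
    intro p hp
    obtain ⟨I, rfl⟩ := mem_enumReverse_ofFn.1 hp
    simp only [eqb, decide_eq_true_eq]
    omega
  rw [RawGame.ownerOf, assoc, this]
  rfl

theorem ownerOf_infosetCode {h : G.Hist} :
    RawGame.ownerOf G.raw (G.infosetCode h) = ((i : ℕ) : ℤ) ↔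
      ∃ I : G.Infoset i, G.infoset h = some I.1 := by
  cases hh : G.infoset h with
  | none =>
    have : G.infosetCode h = -1 := by rw [infosetCode, hh]
    rw [this, ownerOf_raw_of_none]
    simp only [reduceCtorEq, exists_false]
  | some I =>
    rw [infosetCode_eq.2 hh, ownerOf_raw]
    simp only [Nat.cast_inj, Fin.val_inj, Option.some.injEq]
    exact ⟨fun h => ⟨⟨I, h⟩, rfl⟩, by rintro ⟨I, rfl⟩; exact I.2⟩

/-- Parents precede children, so one pass from the last edge down meets the edges of the path in
order. Invariant: the path to the current history, followed by the edges collected, is the path to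
`h`. -/
theorem pathTo_raw (h : G.Hist) :
    RawGame.pathTo G.raw ((h : ℕ) : ℤ) = (G.path h).map G.rawEdge := by
  rw [RawGame.pathTo, RawGame.edges, raw, enumReverse_ofFn, List.foldl_reverse, List.foldr_map]
  have key := foldr_finRange_induction (n := G.numEdges)
    (f := fun e s => RawGame.pathStep s (((e : ℕ) : ℤ), G.rawEdge e))
    (s := (((h : ℕ) : ℤ), ([] : List (ℤ × ℤ × Frac))))
    (P := fun n s => ∃ g : G.Hist, (g : ℕ) ≤ n ∧ s.1 = ((g : ℕ) : ℤ) ∧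
      (G.path g).map G.rawEdge ++ s.2 = (G.path h).map G.rawEdge)
    ⟨h, Nat.lt_succ_iff.1 h.isLt, rfl, by simp⟩ (by
      rintro e ⟨s₁, s₂⟩ ⟨g, hg, rfl, hp⟩
      unfold RawGame.pathStep
      by_cases hge : (g : ℕ) = e + 1
      · have h1 : g = e.succ := Fin.ext hge
        subst h1
        refine ⟨G.parent e, G.parent_le e, ?_, ?_⟩
        · simp [eqb, rawEdge]
        · rw [path_succ] at hp
          simpa [eqb] using hp
      · refine ⟨g, by omega, ?_⟩
        have : eqb ((g : ℕ) : ℤ) (((e : ℕ) : ℤ) + 1) = false := by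
          simp only [eqb, decide_eq_false_iff_not]; omega
        dsimp only at hp ⊢
        rw [this]
        exact ⟨rfl, hp⟩)
  obtain ⟨g, hg, -, hp⟩ := key
  have hg0 : g = 0 := Fin.ext (by simpa using hg)
  rw [hg0, path_zero] at hp
  simpa using hp

theorem movesTo_raw (h : G.Hist) : RawGame.movesTo G.raw ((h : ℕ) : ℤ) =
    (G.path h).map fun e => (G.infosetCode (G.parent e), (G.action e : ℤ)) := by
  rw [RawGame.movesTo, pathTo_raw, List.map_map]
  refine List.map_congr_left fun e _ => ?_
  simp only [Function.comp_apply, rawEdge, infosetAt_raw]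

theorem represents_chanceTo (h : G.Hist) :
    (RawGame.chanceTo G.raw ((h : ℕ) : ℤ)).Represents (chanceProb h) := by
  rw [RawGame.chanceTo, pathTo_raw, List.map_map]
  exact represents_fracProd _ fun e _ => represents_rawFrac _

theorem mem_hists_raw {r : ℤ × ℤ × List Frac} : r ∈ RawGame.hists G.raw ↔ ∃ h : G.Hist,
    r = (((h : ℕ) : ℤ), G.infosetCode h, List.ofFn fun i => rawFrac (G.utility i h)) :=
  mem_enumReverse_ofFn

/-- The labels at `h` are distinct and smaller than the number of children, so by counting they
exhaust the range. -/
theorem mem_actionsAt_raw {h : G.Hist} {I : Fin G.numInfosets} (hh : G.infoset h = some I) {b : ℤ} :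
    b ∈ RawGame.actionsAt G.raw ((h : ℕ) : ℤ) ↔
      ∃ c : Fin (G.numActions I), b = ((c : ℕ) : ℤ) := by
  have h1 : (Finset.univ.filter fun e => G.parent e = h).image G.action =
      Finset.range (G.numActions I) := by
    refine Finset.eq_of_subset_of_card_le (fun c hc => ?_) ?_
    · obtain ⟨e, he, rfl⟩ := Finset.mem_image.1 hc
      have he := (Finset.mem_filter.1 he).2
      have := G.action_lt e
      rw [he, G.card_children h I hh] at this
      exact Finset.mem_range.2 this
    · rw [Finset.card_range, Finset.card_image_of_injOn, G.card_children h I hh]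
      intro e he e' he' hee
      simp only [Finset.coe_filter, Finset.mem_univ, true_and, Set.mem_ofPred_eq] at he he'
      exact G.action_inj e e' (he.trans he'.symm) hee
  have h2 : b ∈ RawGame.actionsAt G.raw ((h : ℕ) : ℤ) ↔
      ∃ e, G.parent e = h ∧ b = (G.action e : ℤ) := by
    simp only [RawGame.actionsAt, List.mem_map, List.mem_filter]
    constructor
    · rintro ⟨p, ⟨hp, hp'⟩, rfl⟩
      obtain ⟨e, rfl⟩ := mem_enumReverse_ofFn.1 hp
      simp only [rawEdge, eqb, decide_eq_true_eq, Nat.cast_inj, Fin.val_inj] at hp'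
      exact ⟨e, hp', rfl⟩
    · rintro ⟨e, rfl, rfl⟩
      exact ⟨_, ⟨mem_enumReverse_ofFn.2 ⟨e, rfl⟩, by simp [rawEdge, eqb]⟩, rfl⟩
  rw [h2]
  constructor
  · rintro ⟨e, he, rfl⟩
    have : G.action e ∈ Finset.range (G.numActions I) := by
      rw [← h1]; exact Finset.mem_image_of_mem _ (by simpa using he)
    exact ⟨⟨_, Finset.mem_range.1 this⟩, rfl⟩
  · rintro ⟨c, rfl⟩
    have : (c : ℕ) ∈ (Finset.univ.filter fun e => G.parent e = h).image G.action := by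
      rw [h1]; exact Finset.mem_range.2 c.isLt
    obtain ⟨e, he, hc⟩ := Finset.mem_image.1 this
    exact ⟨e, (Finset.mem_filter.1 he).2, by rw [hc]⟩

theorem isFirst_raw {h : G.Hist} {I : G.Infoset i} (hh : G.infoset h = some I.1) :
    RawGame.isFirst G.raw ((h : ℕ) : ℤ) ((I.1 : ℕ) : ℤ) = true ↔ h = firstHist I := by
  simp only [RawGame.isFirst, List.all_eq_true, Bool.or_eq_true, Bool.not_eq_true', eqb, ltb,
    decide_eq_false_iff_not]
  constructor
  · intro hall
    have := hall _ (mem_hists_raw.2 ⟨firstHist I, rfl⟩)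
    simp only [infosetCode_eq.2 (infoset_firstHist I), not_true_eq_false, false_or, not_lt,
      Nat.cast_le] at this
    exact le_antisymm this (firstHist_le hh)
  · rintro rfl r hr
    obtain ⟨h', rfl⟩ := mem_hists_raw.1 hr
    by_cases h1 : G.infosetCode h' = ((I.1 : ℕ) : ℤ)
    · right
      simpa using firstHist_le (infosetCode_eq.1 h1)
    · exact Or.inl h1

/-- Which history of `I` the algorithm picks is left open; for the player's own moves it is
immaterial under perfect recall. -/
theorem exists_movesToInfoset_raw (I : G.Infoset i) : ∃ h : G.Hist, G.infoset h = some I.1 ∧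
    RawGame.movesToInfoset G.raw ((I.1 : ℕ) : ℤ) = RawGame.movesTo G.raw ((h : ℕ) : ℤ) := by
  unfold RawGame.movesToInfoset
  cases hl : (RawGame.hists G.raw).filter fun r => eqb r.2.1 ((I.1 : ℕ) : ℤ) with
  | nil =>
    rw [List.filter_eq_nil_iff] at hl
    exact absurd (by simpa [eqb] using infosetCode_eq.2 (infoset_firstHist I))
      (hl _ (mem_hists_raw.2 ⟨firstHist I, rfl⟩))
  | cons r t =>
    have : r ∈ (RawGame.hists G.raw).filter fun r => eqb r.2.1 ((I.1 : ℕ) : ℤ) := by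
      rw [hl]; simp
    obtain ⟨hr, hr'⟩ := List.mem_filter.1 this
    obtain ⟨h, rfl⟩ := mem_hists_raw.1 hr
    exact ⟨h, infosetCode_eq.1 (by simpa [eqb] using hr'), rfl⟩

/-! ### Strategies -/

/-- `P` is the domain of the partial strategy `s`. The raw path also lists moves of chance and of
other players, but their codes match no key of `s`. -/
theorem consistent_movesTo_iff {s : RawStrat} {y : G.Strat i} {P : G.Infoset i → Prop}
    (hs : ∀ p, p ∈ s ↔ ∃ I : G.Infoset i, P I ∧ p = (((I.1 : ℕ) : ℤ), ((y I : ℕ) : ℤ)))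
    (h : G.Hist) :
    consistent s (RawGame.movesTo G.raw ((h : ℕ) : ℤ)) = true ↔
      ∀ m ∈ sequence i h, P m.1 → (y m.1 : ℕ) = m.2 := by
  rw [consistent_iff, movesTo_raw]
  constructor
  · intro hc m hm hP
    obtain ⟨e, he, h1, h2⟩ := mem_sequence.1 hm
    have : ((y m.1 : ℕ) : ℤ) = (G.action e : ℤ) := hc _ (List.mem_map_of_mem he) _
      ((hs _).2 ⟨m.1, hP, rfl⟩) (infosetCode_eq.2 h1).symm
    rw [← h2]
    exact_mod_cast this
  · intro hc q hq p hp hpq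
    obtain ⟨e, he, rfl⟩ := List.mem_map.1 hq
    obtain ⟨I, hI, rfl⟩ := (hs p).1 hp
    have : (y I : ℕ) = G.action e :=
      hc (I, G.action e) (mem_sequence.2 ⟨e, he, infosetCode_eq.1 hpq.symm, rfl⟩) hI
    exact congrArg Nat.cast this

theorem consistent_rawStrat_iff {x : G.Strat i} (h : G.Hist) :
    consistent (rawStrat x) (RawGame.movesTo G.raw ((h : ℕ) : ℤ)) = true ↔ PlaysTo x h := by
  rw [consistent_movesTo_iff (y := x) (P := fun _ => True) (fun p => by simp only [mem_rawStrat, true_and])]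
  simp only [true_implies, PlaysTo]

theorem PerfectRecall.consistent_movesToInfoset_iff (hG : G.PerfectRecall) {x : G.Strat i}
    (I : G.Infoset i) :
    consistent (rawStrat x) (RawGame.movesToInfoset G.raw ((I.1 : ℕ) : ℤ)) = true ↔
      PlaysToInfo x I := by
  obtain ⟨h, hh, he⟩ := exists_movesToInfoset_raw I
  rw [he, consistent_rawStrat_iff, hG.playsToInfo_iff_playsTo hh]

theorem assoc_rawStrat {s : RawStrat} {y : G.Strat i} {d : ℤ}
    (hs : ∀ p, p ∈ s ↔ ∃ I : G.Infoset i, p = (((I.1 : ℕ) : ℤ), ((y I : ℕ) : ℤ)))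
    (I : G.Infoset i) : assoc d s ((I.1 : ℕ) : ℤ) = ((y I : ℕ) : ℤ) := by
  refine assoc_eq ((hs _).2 ⟨I, rfl⟩) fun b hb => ?_
  obtain ⟨J, hJ⟩ := (hs _).1 hb
  simp only [Prod.mk.injEq, Nat.cast_inj, Fin.val_inj] at hJ
  obtain rfl := Subtype.ext hJ.1
  exact hJ.2

/-- A raw strategy does not name its player; having `J` among its keys identifies the owner of `J`.
-/
theorem PerfectRecall.consistent_target_iff (hG : G.PerfectRecall) {j : Fin G.numPlayers}
    (x : G.Strat j) (J : Fin G.numInfosets) (a : Fin (G.numActions J)) (z : G.Hist) :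
    consistent (rawStrat x) (RawGame.target G.raw ((J : ℕ) : ℤ) ((a : ℕ) : ℤ) ((z : ℕ) : ℤ)
      (rawStrat x)) = true ↔ Meets J a z x := by
  have h1 : ((rawStrat x).any fun p => eqb p.1 ((J : ℕ) : ℤ)) = true ↔ G.owner J = j := by
    simp only [List.any_eq_true, mem_rawStrat, eqb, decide_eq_true_eq]
    constructor
    · rintro ⟨p, ⟨I, rfl⟩, hI⟩
      simp only [Nat.cast_inj, Fin.val_inj] at hI
      rw [← hI]
      exact I.2
    · exact fun h => ⟨_, ⟨⟨J, h⟩, rfl⟩, rfl⟩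
  unfold RawGame.target Meets
  by_cases hJ : G.owner J = j
  · rw [h1.2 hJ, dif_pos hJ, cond_true, PlaysToSeq, ← hG.consistent_movesToInfoset_iff,
      consistent_iff, consistent_iff, List.forall_mem_cons, and_comm]
    refine and_congr Iff.rfl ?_
    constructor
    · intro h
      have : ((x ⟨J, hJ⟩ : ℕ) : ℤ) = ((a : ℕ) : ℤ) := h _ (mem_rawStrat.2 ⟨⟨J, hJ⟩, rfl⟩) rfl
      exact Fin.ext (by exact_mod_cast this)
    · rintro h p hp hpJ
      obtain ⟨I, rfl⟩ := mem_rawStrat.1 hp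
      simp only [Nat.cast_inj, Fin.val_inj] at hpJ
      obtain rfl : I = ⟨J, hJ⟩ := Subtype.ext hpJ
      rw [h]
  · rw [Bool.eq_false_iff.2 (mt h1.1 hJ), dif_neg hJ, cond_false, consistent_rawStrat_iff]

end Game

namespace Game

variable {G : Game} {i : Fin G.numPlayers} {T K : ℕ}

/-! ### Weights and best responses -/

theorem PerfectRecall.represents_weight (hG : G.PerfectRecall) (π : G.Mixture T K)
    (J : G.Infoset i) (a : Fin (G.numActions J.1)) (z : G.Hist) :
    (RawGame.weight G.raw π.raw ((i : ℕ) : ℤ) ((J.1 : ℕ) : ℤ) ((a : ℕ) : ℤ)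
      ((z : ℕ) : ℤ)).Represents (π.toCorrelated.histWeight J a z) := by
  have hsum : (fracSum (π.raw.map fun tm => fracProd (tm.1 :: tm.2.map fun L =>
      fracSum (L.map fun bx => cond (consistent bx.2 (RawGame.target G.raw ((J.1 : ℕ) : ℤ)
        ((a : ℕ) : ℤ) ((z : ℕ) : ℤ) bx.2)) bx.1 (0, 1))))).Represents
      (∑ t, π.α t * ∏ j, ∑ k, if Meets J.1 a z (π.strat t j k) then π.β t j k else 0) := by
    rw [Mixture.raw, List.ofFn_eq_map, List.map_map, ← List.sum_ofFn, List.ofFn_eq_map]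
    refine represents_fracSum _ fun t _ => ?_
    rw [Function.comp_apply, List.ofFn_eq_map, List.map_map, ← List.prod_ofFn, List.ofFn_eq_map]
    have hprod := represents_fracProd (List.finRange G.numPlayers)
      (f := fun j => fracSum ((List.ofFn fun k => (rawFrac (π.β t j k), rawStrat (π.strat t j k))).map
        fun bx => cond (consistent bx.2 (RawGame.target G.raw ((J.1 : ℕ) : ℤ)
          ((a : ℕ) : ℤ) ((z : ℕ) : ℤ) bx.2)) bx.1 (0, 1)))
      (r := fun j => ∑ k, if Meets J.1 a z (π.strat t j k) then π.β t j k else 0) (by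
        intro j _
        rw [List.ofFn_eq_map, List.map_map, ← List.sum_ofFn, List.ofFn_eq_map]
        refine represents_fracSum _ fun k _ => ?_
        rw [Function.comp_apply]
        by_cases hm : Meets J.1 a z (π.strat t j k)
        · rw [(hG.consistent_target_iff _ _ _ _).2 hm, if_pos hm, cond_true]
          exact represents_rawFrac _
        · rw [Bool.eq_false_iff.2 (mt (hG.consistent_target_iff _ _ _ _).1 hm), if_neg hm,
            cond_false]
          exact represents_zero)
    obtain ⟨h1, h2⟩ := hprod
    obtain ⟨h3, h4⟩ := represents_rawFrac (π.α t)
    refine ⟨mul_pos h3 h1, ?_⟩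
    rw [← h2]
    simp only [fracProd, List.map_cons, List.prod_cons, Int.cast_mul]
    rw [mul_div_mul_comm, h4]
    rfl
  obtain ⟨h1, h2⟩ := hsum
  obtain ⟨h3, h4⟩ := represents_rawFrac (G.utility i z)
  obtain ⟨h5, h6⟩ := represents_chanceTo z
  rw [π.histWeight_eq, ← h2, ← h4, ← h6, RawGame.weight, utilityAt_raw]
  simp only [fracProd, List.map_cons, List.map_nil, List.prod_cons, List.prod_nil, mul_one]
  refine ⟨mul_pos h3 (mul_pos h5 h1), ?_⟩
  rw [Int.cast_mul, Int.cast_mul, Int.cast_mul, Int.cast_mul, mul_div_mul_comm, mul_div_mul_comm,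
    mul_assoc]

theorem PerfectRecall.represents_actionValue (hG : G.PerfectRecall) (π : G.Mixture T K)
    (J : G.Infoset i) (a : Fin (G.numActions J.1)) {s : RawStrat} {y : G.Strat i}
    (I : G.Infoset i) (hs : ∀ p, p ∈ s ↔ ∃ I' : G.Infoset i, firstHist I < firstHist I' ∧
      p = (((I'.1 : ℕ) : ℤ), ((y I' : ℕ) : ℤ))) (b : ℕ) :
    (RawGame.actionValue G.raw π.raw ((i : ℕ) : ℤ) ((J.1 : ℕ) : ℤ) ((a : ℕ) : ℤ) s
      ((I.1 : ℕ) : ℤ) (b : ℤ)).Represents (actionVal (π.toCorrelated.histWeight J a) y I b) := by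
  classical
  have h1 : ∀ z : G.Hist, ((RawGame.movesTo G.raw ((z : ℕ) : ℤ)).any fun q =>
      eqb q.1 ((I.1 : ℕ) : ℤ) && eqb q.2 (b : ℤ)) = true ↔ (I, b) ∈ sequence i z := by
    intro z
    simp only [movesTo_raw, List.any_map, List.any_eq_true, Function.comp_apply, eqb,
      Bool.and_eq_true, decide_eq_true_eq, infosetCode_eq, Nat.cast_inj, mem_sequence]
  have h2 : actionVal (π.toCorrelated.histWeight J a) y I b =
      ((List.finRange (G.numEdges + 1)).reverse.map fun z => if (I, b) ∈ sequence i z ∧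
        ∀ m ∈ sequence i z, firstHist I < firstHist m.1 → (y m.1 : ℕ) = m.2
        then π.toCorrelated.histWeight J a z else 0).sum := by
    rw [List.map_reverse, List.sum_reverse, ← List.ofFn_eq_map, List.sum_ofFn]
    rfl
  rw [h2, RawGame.actionValue, RawGame.hists, raw, enumReverse_ofFn, ← List.map_reverse,
    List.map_map]
  refine represents_fracSum _ fun z _ => ?_
  rw [Function.comp_apply]
  by_cases hz : (I, b) ∈ sequence i z ∧
      ∀ m ∈ sequence i z, firstHist I < firstHist m.1 → (y m.1 : ℕ) = m.2
  · have h3 := (h1 z).2 hz.1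
    have h4 := (consistent_movesTo_iff hs z).2 hz.2
    rw [if_pos hz]
    change Frac.Represents (cond (((RawGame.movesTo G.raw ((z : ℕ) : ℤ)).any fun q =>
      eqb q.1 ((I.1 : ℕ) : ℤ) && eqb q.2 (b : ℤ)) && consistent s
        (RawGame.movesTo G.raw ((z : ℕ) : ℤ))) (RawGame.weight G.raw π.raw ((i : ℕ) : ℤ)
        ((J.1 : ℕ) : ℤ) ((a : ℕ) : ℤ) ((z : ℕ) : ℤ)) (0, 1)) _
    rw [h3, h4]
    exact hG.represents_weight π J a z
  · have h3 : (((RawGame.movesTo G.raw ((z : ℕ) : ℤ)).any fun q =>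
        eqb q.1 ((I.1 : ℕ) : ℤ) && eqb q.2 (b : ℤ)) && consistent s
          (RawGame.movesTo G.raw ((z : ℕ) : ℤ))) = false := by
      rw [Bool.eq_false_iff]
      intro h
      obtain ⟨h3, h4⟩ := Bool.and_eq_true_iff.1 h
      exact hz ⟨(h1 z).1 h3, (consistent_movesTo_iff hs z).1 h4⟩
    rw [if_neg hz]
    change Frac.Represents (cond (((RawGame.movesTo G.raw ((z : ℕ) : ℤ)).any fun q =>
      eqb q.1 ((I.1 : ℕ) : ℤ) && eqb q.2 (b : ℤ)) && consistent s
        (RawGame.movesTo G.raw ((z : ℕ) : ℤ))) (RawGame.weight G.raw π.raw ((i : ℕ) : ℤ)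
        ((J.1 : ℕ) : ℤ) ((a : ℕ) : ℤ) ((z : ℕ) : ℤ)) (0, 1)) _
    rw [h3]
    exact represents_zero

/-- A maximum over finitely many actions exists, so the filtered list is nonempty and its default is
not used. -/
theorem PerfectRecall.bestAction_spec (hG : G.PerfectRecall) (π : G.Mixture T K)
    (J : G.Infoset i) (a : Fin (G.numActions J.1)) {s : RawStrat} {y : G.Strat i}
    {h : G.Hist} {I : G.Infoset i} (hh : G.infoset h = some I.1)
    (hs : ∀ p, p ∈ s ↔ ∃ I' : G.Infoset i, firstHist I < firstHist I' ∧
      p = (((I'.1 : ℕ) : ℤ), ((y I' : ℕ) : ℤ))) :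
    ∃ c : Fin (G.numActions I.1), RawGame.bestAction G.raw π.raw ((i : ℕ) : ℤ) ((J.1 : ℕ) : ℤ)
        ((a : ℕ) : ℤ) s ((I.1 : ℕ) : ℤ) ((h : ℕ) : ℤ) = ((c : ℕ) : ℤ) ∧
      ∀ b : Fin (G.numActions I.1), actionVal (π.toCorrelated.histWeight J a) y I b ≤
        actionVal (π.toCorrelated.histWeight J a) y I c := by
  have hle : ∀ c b : ℕ, fracLe (RawGame.actionValue G.raw π.raw ((i : ℕ) : ℤ) ((J.1 : ℕ) : ℤ)
      ((a : ℕ) : ℤ) s ((I.1 : ℕ) : ℤ) (b : ℤ)) (RawGame.actionValue G.raw π.raw ((i : ℕ) : ℤ)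
      ((J.1 : ℕ) : ℤ) ((a : ℕ) : ℤ) s ((I.1 : ℕ) : ℤ) (c : ℤ)) = true ↔
      actionVal (π.toCorrelated.histWeight J a) y I b ≤
        actionVal (π.toCorrelated.histWeight J a) y I c := fun c b =>
    fracLe_iff (hG.represents_actionValue π J a I hs b) (hG.represents_actionValue π J a I hs c)
  unfold RawGame.bestAction
  cases hl : (RawGame.actionsAt G.raw ((h : ℕ) : ℤ)).filter fun c =>
    (RawGame.actionsAt G.raw ((h : ℕ) : ℤ)).all fun b =>
      fracLe (RawGame.actionValue G.raw π.raw ((i : ℕ) : ℤ) ((J.1 : ℕ) : ℤ) ((a : ℕ) : ℤ) s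
        ((I.1 : ℕ) : ℤ) b) (RawGame.actionValue G.raw π.raw ((i : ℕ) : ℤ) ((J.1 : ℕ) : ℤ)
        ((a : ℕ) : ℤ) s ((I.1 : ℕ) : ℤ) c) with
  | nil =>
    exfalso
    have : Nonempty (Fin (G.numActions I.1)) := ⟨⟨0, G.numActions_pos _⟩⟩
    obtain ⟨c, hc⟩ := Finite.exists_max fun c : Fin (G.numActions I.1) =>
      actionVal (π.toCorrelated.histWeight J a) y I c
    rw [List.filter_eq_nil_iff] at hl
    refine hl _ ((mem_actionsAt_raw hh).2 ⟨c, rfl⟩) ?_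
    rw [List.all_eq_true]
    intro b hb
    obtain ⟨b, rfl⟩ := (mem_actionsAt_raw hh).1 hb
    exact (hle c b).2 (hc b)
  | cons c t =>
    have hc : c ∈ (RawGame.actionsAt G.raw ((h : ℕ) : ℤ)).filter fun c =>
      (RawGame.actionsAt G.raw ((h : ℕ) : ℤ)).all fun b =>
        fracLe (RawGame.actionValue G.raw π.raw ((i : ℕ) : ℤ) ((J.1 : ℕ) : ℤ) ((a : ℕ) : ℤ) s
          ((I.1 : ℕ) : ℤ) b) (RawGame.actionValue G.raw π.raw ((i : ℕ) : ℤ) ((J.1 : ℕ) : ℤ)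
          ((a : ℕ) : ℤ) s ((I.1 : ℕ) : ℤ) c) := by rw [hl]; simp
    obtain ⟨hc, hall⟩ := List.mem_filter.1 hc
    obtain ⟨c, rfl⟩ := (mem_actionsAt_raw hh).1 hc
    refine ⟨c, rfl, fun b => (hle c b).1 ?_⟩
    rw [List.all_eq_true] at hall
    exact hall _ ((mem_actionsAt_raw hh).2 ⟨b, rfl⟩)

/-- Invariant of the traversal: the list records `y` exactly at the information sets whose first
history has been visited, and `y` is optimal at each of them given its later actions. -/
theorem PerfectRecall.exists_bestResponse (hG : G.PerfectRecall) (π : G.Mixture T K)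
    (J : G.Infoset i) (a : Fin (G.numActions J.1)) :
    ∃ y : G.Strat i, π.toCorrelated.IsCondBestResponse J a y ∧
      ∀ p, p ∈ RawGame.bestResponse G.raw π.raw ((i : ℕ) : ℤ) ((J.1 : ℕ) : ℤ) ((a : ℕ) : ℤ) ↔
        ∃ I : G.Infoset i, p = (((I.1 : ℕ) : ℤ), ((y I : ℕ) : ℤ)) := by
  classical
  rw [RawGame.bestResponse, RawGame.hists, raw, enumReverse_ofFn, ← raw, List.foldl_reverse,
    List.foldr_map]
  have key := foldr_finRange_induction (n := G.numEdges + 1)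
    (f := fun h s => RawGame.bestResponseStep G.raw π.raw ((i : ℕ) : ℤ) ((J.1 : ℕ) : ℤ)
      ((a : ℕ) : ℤ) s (((h : ℕ) : ℤ), G.infosetCode h, List.ofFn fun i => rawFrac (G.utility i h)))
    (s := [])
    (P := fun n s => ∃ y : G.Strat i,
      (∀ p, p ∈ s ↔ ∃ I : G.Infoset i, n ≤ (firstHist I : ℕ) ∧
        p = (((I.1 : ℕ) : ℤ), ((y I : ℕ) : ℤ))) ∧
      ∀ I : G.Infoset i, n ≤ (firstHist I : ℕ) → ∀ b : Fin (G.numActions I.1),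
        actionVal (π.toCorrelated.histWeight J a) y I b ≤
          actionVal (π.toCorrelated.histWeight J a) y I (y I))
    ⟨fun I => ⟨0, G.numActions_pos _⟩, fun p => by
      have : ∀ I : G.Infoset i, ¬ G.numEdges + 1 ≤ (firstHist I : ℕ) := fun I =>
        not_le.2 (firstHist I).isLt
      simp [this], fun I hI => absurd (firstHist I).isLt (not_lt.2 hI)⟩ (by
      rintro h s ⟨y, hs, hy⟩
      unfold RawGame.bestResponseStep
      dsimp only
      by_cases hex : ∃ I : G.Infoset i, firstHist I = h
      · obtain ⟨I, rfl⟩ := hex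
        have hcode := infosetCode_eq.2 (infoset_firstHist I)
        have h1 : eqb (RawGame.ownerOf G.raw (G.infosetCode (firstHist I))) ((i : ℕ) : ℤ) =
            true := by
          rw [eqb, decide_eq_true_eq]
          exact ownerOf_infosetCode.2 ⟨I, infoset_firstHist I⟩
        have h2 := (isFirst_raw (infoset_firstHist I)).2 rfl
        rw [h1, hcode, h2]
        obtain ⟨c, hc, hmax⟩ := hG.bestAction_spec π J a (s := s) (y := y) (infoset_firstHist I)
          (by simpa only [Nat.succ_le_iff, ← Fin.lt_def] using hs)
        -- Action values depend only on strictly later information sets, so recording `c` at `I`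
        -- spoils no optimality already obtained.
        have hne : ∀ I', firstHist I < firstHist I' → Function.update y I c I' = y I' := by
          intro I' hI'
          rw [Function.update_of_ne]
          rintro rfl
          exact lt_irrefl _ hI'
        refine ⟨Function.update y I c, fun p => ?_, fun I' hI' b => ?_⟩
        · rw [Bool.and_self, cond_true, List.mem_cons, hs, hc]
          constructor
          · rintro (rfl | ⟨I', hI', rfl⟩)
            · exact ⟨I, le_rfl, by rw [Function.update_self]⟩
            · refine ⟨I', by omega, ?_⟩
              rw [hne I' hI']
          · rintro ⟨I', hI', rfl⟩
            rcases hI'.eq_or_lt with h3 | h3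
            · obtain rfl : I = I' := firstHist_injective (Fin.ext h3)
              left
              rw [Function.update_self]
            · right
              exact ⟨I', h3, by rw [hne I' h3]⟩
        · rcases hI'.eq_or_lt with h3 | h3
          · obtain rfl : I = I' := firstHist_injective (Fin.ext h3)
            rw [Function.update_self, actionVal_congr hne, actionVal_congr hne]
            exact hmax b
          · have h4 : ∀ I'', firstHist I' < firstHist I'' → Function.update y I c I'' = y I'' :=
              fun I'' h5 => hne I'' (lt_trans h3 h5)
            rw [actionVal_congr h4, actionVal_congr h4, hne I' h3]
            exact hy I' h3 b
      · have h1 : (eqb (RawGame.ownerOf G.raw (G.infosetCode h)) ((i : ℕ) : ℤ) &&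
            RawGame.isFirst G.raw ((h : ℕ) : ℤ) (G.infosetCode h)) = false := by
          rw [Bool.eq_false_iff]
          intro hb
          obtain ⟨h1, h2⟩ := Bool.and_eq_true_iff.1 hb
          rw [eqb, decide_eq_true_eq] at h1
          obtain ⟨I, hI⟩ := ownerOf_infosetCode.1 h1
          rw [infosetCode_eq.2 hI] at h2
          exact hex ⟨I, ((isFirst_raw hI).1 h2).symm⟩
        have h2 : ∀ I : G.Infoset i, (h : ℕ) ≤ (firstHist I : ℕ) ↔
            (h : ℕ) + 1 ≤ (firstHist I : ℕ) := by
          intro I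
          have : (firstHist I : ℕ) ≠ h := fun h' => hex ⟨I, Fin.ext h'⟩
          omega
        rw [h1, cond_false]
        simp only [h2]
        exact ⟨y, hs, hy⟩)
  obtain ⟨y, hs, hy⟩ := key
  exact ⟨y, hG.isCondBestResponse fun I b => hy I (Nat.zero_le _) b,
    fun p => (hs p).trans (by simp only [Nat.zero_le, true_and])⟩

/-! ### The conversion -/

/-- The head of the filtered list is the first mismatch on the path. All moves before it are
matched, so `x` plays to that information set. -/
theorem PerfectRecall.leaveAt_spec (hG : G.PerfectRecall) {x : G.Strat i} {I : G.Infoset i}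
    (hI : ¬ PlaysToInfo x I) : ∃ J, Leaves x J (x J) I ∧
      RawGame.leaveAt G.raw (rawStrat x) ((I.1 : ℕ) : ℤ) = ((J.1 : ℕ) : ℤ) := by
  obtain ⟨h, hh, hm⟩ := exists_movesToInfoset_raw I
  rw [RawGame.leaveAt, hm]
  have hbad : ∀ q : ℤ × ℤ, ((rawStrat x).any fun p => eqb p.1 q.1 && !(eqb p.2 q.2)) = true ↔
      ¬ ∀ p ∈ rawStrat x, p.1 = q.1 → p.2 = q.2 := by
    intro q
    simp only [List.any_eq_true, Bool.and_eq_true, eqb, Bool.not_eq_true', decide_eq_true_eq,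
      decide_eq_false_iff_not, not_forall, exists_prop]
  have hne : ¬ ∀ q ∈ RawGame.movesTo G.raw ((h : ℕ) : ℤ), ∀ p ∈ rawStrat x,
      p.1 = q.1 → p.2 = q.2 := by
    rw [← consistent_iff, consistent_rawStrat_iff, ← hG.playsToInfo_iff_playsTo hh]
    exact hI
  cases hl : (RawGame.movesTo G.raw ((h : ℕ) : ℤ)).filter fun q =>
      (rawStrat x).any fun p => eqb p.1 q.1 && !(eqb p.2 q.2) with
  | nil =>
    rw [List.filter_eq_nil_iff] at hl
    refine absurd (fun q hq => ?_) hne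
    by_contra hb
    exact hl q hq ((hbad q).2 hb)
  | cons q t =>
    obtain ⟨l₁, l₂, hsplit, hl₁, hq, -⟩ := List.filter_eq_cons_iff.1 hl
    rw [movesTo_raw, List.map_eq_append_iff] at hsplit
    obtain ⟨p₁, p₂, hp, rfl, h2⟩ := hsplit
    rw [List.map_eq_cons_iff] at h2
    obtain ⟨e, p₃, rfl, rfl, rfl⟩ := h2
    have hmis := (hbad _).1 hq
    push Not at hmis
    obtain ⟨r, hr, h3, h4⟩ := hmis
    obtain ⟨J, rfl⟩ := mem_rawStrat.1 hr
    have h5 : G.infoset (G.parent e) = some J.1 := infosetCode_eq.1 h3.symm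
    refine ⟨J, ⟨⟨G.action e, ?_, fun h => h4 (congrArg Nat.cast h)⟩, ?_, rfl⟩, h3.symm⟩
    · rw [← hG.sequence_eq hh]
      exact mem_sequence.2 ⟨e, by rw [hp]; simp, h5, rfl⟩
    · rw [hG.playsToInfo_iff_playsTo h5, ← consistent_rawStrat_iff, consistent_iff, movesTo_raw,
        path_split hp]
      intro q' hq'
      by_contra hb
      exact hl₁ q' hq' ((hbad q').2 hb)

theorem PerfectRecall.convertAction_eq (hG : G.PerfectRecall) (π : G.Mixture T K)
    {br : (J : G.Infoset i) → Fin (G.numActions J.1) → G.Strat i}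
    (hbr : ∀ (J : G.Infoset i) (a : Fin (G.numActions J.1)) (p : ℤ × ℤ), p ∈ RawGame.bestResponse G.raw π.raw ((i : ℕ) : ℤ) ((J.1 : ℕ) : ℤ)
      ((a : ℕ) : ℤ) ↔ ∃ I : G.Infoset i, p = (((I.1 : ℕ) : ℤ), ((br J a I : ℕ) : ℤ)))
    (x : G.Strat i) (I : G.Infoset i) :
    RawGame.convertAction G.raw π.raw (rawStrat x) (((I.1 : ℕ) : ℤ), ((x I : ℕ) : ℤ)) =
      ((convStrat br x I : ℕ) : ℤ) := by
  unfold RawGame.convertAction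
  dsimp only
  by_cases hI : PlaysToInfo x I
  · rw [(hG.consistent_movesToInfoset_iff I).2 hI, cond_true, convStrat_of_plays hI]
  · obtain ⟨J, hJ, he⟩ := hG.leaveAt_spec hI
    rw [Bool.eq_false_iff.2 (mt (hG.consistent_movesToInfoset_iff I).1 hI), cond_false, he,
      assoc_rawStrat (fun p => mem_rawStrat) J, ownerOf_raw, I.2,
      assoc_rawStrat (hbr J (x J)) I, hG.convStrat_of_leaves hJ]

/-- The mixture with all strategies converted. -/
noncomputable def Mixture.conv (π : G.Mixture T K)
    (br : (i : Fin G.numPlayers) → (J : G.Infoset i) → Fin (G.numActions J.1) → G.Strat i) :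
    G.Mixture T K :=
  { π with strat := fun t i k => convStrat (br i) (π.strat t i k) }

theorem PerfectRecall.exists_convert_eq (hG : G.PerfectRecall) (π : G.Mixture T K) :
    ∃ π' : G.Mixture T K, RawGame.convert G.raw π.raw = π'.raw ∧ π.IsConversion π' := by
  choose br hbr hmem using fun (i : Fin G.numPlayers) (J : G.Infoset i)
    (a : Fin (G.numActions J.1)) => hG.exists_bestResponse π J a
  refine ⟨π.conv br, ?_, rfl, rfl, br, hbr, fun t i k I => ⟨fun h => convStrat_of_plays h,
    fun h J a h1 h2 h3 => hG.convStrat_of_leaves ((hG.leaves_iff h).2 ⟨h1, h2, h3⟩)⟩⟩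
  have hx : ∀ {i} (x : G.Strat i), ((rawStrat x).map fun p =>
      (p.1, RawGame.convertAction G.raw π.raw (rawStrat x) p)) =
        rawStrat (convStrat (br i) x) := by
    intro i x
    conv_lhs => enter [2]; rw [rawStrat]
    rw [rawStrat, List.map_filterMap]
    refine List.filterMap_congr fun I _ => ?_
    split_ifs with h
    · exact congrArg some (Prod.ext rfl (hG.convertAction_eq π (hmem i) x ⟨I, h⟩))
    · rfl
  rw [RawGame.convert]
  conv_lhs => enter [2]; rw [Mixture.raw]
  simp only [List.map_ofFn, Function.comp_def, hx]
  rfl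

/-! ### The length of the input -/

theorem encSize_list_le {α : Type} [Enc α] {l : List α} {M N : ℕ} (hl : l.length ≤ N)
    (h : ∀ x ∈ l, encSize x ≤ M) : encSize l ≤ N * (M + 1) + 1 := by
  have h1 : encSize l ≤ l.length * (M + 1) + 1 := by
    clear hl
    induction l with
    | nil => simp [encSize_nil]
    | cons x t ih =>
      have h1 := h x (by simp)
      have h2 := ih fun y hy => h y (by simp [hy])
      rw [encSize_cons, List.length_cons, Nat.add_mul]
      omega
  exact h1.trans (Nat.add_le_add_right (Nat.mul_le_mul_right _ hl) 1)

theorem encSize_ofFn_le {α : Type} [Enc α] {n : ℕ} {f : Fin n → α} {M N : ℕ} (hn : n ≤ N)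
    (h : ∀ i, encSize (f i) ≤ M) : encSize (List.ofFn f) ≤ N * (M + 1) + 1 := by
  refine encSize_list_le (by simpa using hn) fun x hx => ?_
  obtain ⟨i, rfl⟩ := List.mem_ofFn.1 hx
  exact h i

theorem encSize_rawFrac_le {b : ℕ} {q : ℚ} (h : RatBits b q) : encSize (rawFrac q) ≤ 2 * b + 3 := by
  rw [rawFrac, encSize_pair, encSize_int, encSize_int, Int.natAbs_natCast]
  have := h.1
  have := h.2
  omega

/-- Information sets are nonempty and disjoint. -/
theorem numInfosets_le (G : Game) : G.numInfosets ≤ G.numHist := by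
  choose f hf using G.infoset_nonempty
  have : Function.Injective f := fun I J h => by
    have := hf I
    rw [h, hf J] at this
    exact (Option.some.inj this).symm
  simpa [numHist] using Fintype.card_le_of_injective f this

theorem numActions_le (G : Game) (I : Fin G.numInfosets) : G.numActions I ≤ G.numEdges := by
  obtain ⟨h, hh⟩ := G.infoset_nonempty I
  rw [← G.card_children h I hh]
  exact (Finset.card_le_univ _).trans (by simp)

theorem action_lt_numEdges (e : Fin G.numEdges) : G.action e < G.numEdges :=
  (G.action_lt e).trans_le ((Finset.card_le_univ _).trans (by simp))

theorem encSize_rawStrat_le (x : G.Strat i) :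
    encSize (rawStrat x) ≤ G.numHist * (2 * G.numHist + 4) + 1 := by
  refine encSize_list_le ?_ fun p hp => ?_
  · rw [rawStrat]
    refine (List.length_filterMap_le _ _).trans ?_
    simpa using G.numInfosets_le
  · obtain ⟨I, rfl⟩ := mem_rawStrat.1 hp
    have h1 := encSize_nat_le (I.1 : ℕ)
    have h2 := encSize_nat_le (x I : ℕ)
    have h3 := I.1.isLt
    have h4 := (x I).isLt
    have h5 := G.numInfosets_le
    have h6 := G.numActions_le I.1
    have h7 : G.numHist = G.numEdges + 1 := rfl
    rw [encSize_pair]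
    omega

theorem encSize_raw_le {b : ℕ} (hn : G.numPlayers ≤ G.numHist) (hb : G.BitsLe b) :
    encSize G.raw ≤ (G.numHist + 1) + (G.numHist * (2 * G.numHist + 2 * b + 8) + 1) +
      (G.numHist * (G.numHist + 2 + (G.numHist * (2 * b + 4) + 1) + 2) + 1) +
      (G.numHist * (2 * G.numHist + 4) + 1) + 3 := by
  have hE : G.numHist = G.numEdges + 1 := rfl
  have h1 := encSize_nat_le G.numPlayers
  have h2 : encSize (List.ofFn G.rawEdge) ≤ G.numHist * (2 * G.numHist + 2 * b + 7 + 1) + 1 := by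
    refine encSize_ofFn_le (by omega) fun e => ?_
    have h3 := encSize_nat_le (G.parent e : ℕ)
    have h4 := encSize_nat_le (G.action e)
    have h5 := (G.parent e).isLt
    have h6 := action_lt_numEdges e
    have h7 := encSize_rawFrac_le (hb.1 e)
    rw [rawEdge, encSize_pair, encSize_pair]
    omega
  have h3 : encSize (List.ofFn fun h : G.Hist => (G.infosetCode h, List.ofFn fun i =>
      rawFrac (G.utility i h))) ≤
      G.numHist * (G.numHist + 2 + (G.numHist * (2 * b + 3 + 1) + 1) + 1 + 1) + 1 := by
    refine encSize_ofFn_le le_rfl fun h => ?_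
    have h4 : encSize (List.ofFn fun i => rawFrac (G.utility i h)) ≤
        G.numHist * (2 * b + 3 + 1) + 1 :=
      encSize_ofFn_le hn fun i => encSize_rawFrac_le (hb.2 i h)
    have h5 : encSize (G.infosetCode h) ≤ G.numHist + 2 := by
      cases hh : G.infoset h with
      | none =>
        have : G.infosetCode h = -1 := by rw [infosetCode, hh]
        rw [this, show encSize (-1 : ℤ) = 2 from by rw [encSize_int]; simp]
        omega
      | some I =>
        rw [infosetCode_eq.2 hh]
        have := encSize_nat_le (I : ℕ)
        have := I.isLt
        have := G.numInfosets_le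
        omega
    rw [encSize_pair]
    omega
  have h4 : encSize (List.ofFn fun I : Fin G.numInfosets =>
      (((G.owner I).val : ℤ), (G.numActions I : ℤ))) ≤ G.numHist * (2 * G.numHist + 3 + 1) + 1 := by
    refine encSize_ofFn_le G.numInfosets_le fun I => ?_
    have h5 := encSize_nat_le (G.owner I : ℕ)
    have h6 := encSize_nat_le (G.numActions I)
    have h7 := (G.owner I).isLt
    have h8 := G.numActions_le I
    rw [encSize_pair]
    omega
  rw [raw, encSize_pair, encSize_pair, encSize_pair]
  simp only [add_assoc, Nat.reduceAdd] at h2 h3 h4 ⊢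
  omega

theorem Mixture.encSize_raw_le {b : ℕ} (π : G.Mixture T K) (hn : G.numPlayers ≤ G.numHist)
    (hb : π.BitsLe b) :
    encSize π.raw ≤ T * (2 * b + 3 + (G.numHist * (K * (2 * b + 3 +
      (G.numHist * (2 * G.numHist + 4) + 1) + 1 + 1) + 1 + 1) + 1) + 1 + 1) + 1 := by
  refine encSize_ofFn_le le_rfl fun t => ?_
  rw [encSize_pair]
  have h1 := encSize_rawFrac_le (hb.1 t)
  refine Nat.add_le_add_right (Nat.add_le_add h1 ?_) 1
  refine encSize_ofFn_le hn fun i => encSize_ofFn_le le_rfl fun k => ?_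
  rw [encSize_pair]
  exact Nat.add_le_add_right (Nat.add_le_add (encSize_rawFrac_le (hb.2 t i k))
    (encSize_rawStrat_le _)) 1

/-- A polynomial that bounds the length of the input. -/
noncomputable def inputPoly : MvPolynomial (Fin 4) ℕ :=
  let H := MvPolynomial.X 0
  let T := MvPolynomial.X 1
  let K := MvPolynomial.X 2
  let b := MvPolynomial.X 3
  ((H + 1) + (H * (2 * H + 2 * b + 8) + 1) + (H * (H + 2 + (H * (2 * b + 4) + 1) + 2) + 1) +
    (H * (2 * H + 4) + 1) + 3) +
  (T * (2 * b + 3 + (H * (K * (2 * b + 3 + (H * (2 * H + 4) + 1) + 1 + 1) + 1 + 1) + 1) + 1 + 1) +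
    1) + 1

theorem encSize_input_le {b : ℕ} (π : G.Mixture T K) (hn : G.numPlayers ≤ G.numHist)
    (hG : G.BitsLe b) (hπ : π.BitsLe b) :
    encSize (G.raw, π.raw) ≤ MvPolynomial.eval ![G.numHist, T, K, b] inputPoly := by
  have h1 := Game.encSize_raw_le hn hG
  have h2 := π.encSize_raw_le hn hπ
  have h3 := Nat.add_le_add_right (Nat.add_le_add h1 h2) 1
  rw [encSize_pair]
  refine h3.trans (le_of_eq ?_)
  simp [inputPoly]

end Game

/-! ### The theorem -/

theorem MvPolynomial.eval_aeval_nat {σ : Type*} (v : σ → ℕ) (S : MvPolynomial σ ℕ)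
    (q : Polynomial ℕ) :
    MvPolynomial.eval v (Polynomial.aeval S q) = q.eval (MvPolynomial.eval v S) := by
  rw [Polynomial.aeval_def, Polynomial.hom_eval₂, Polynomial.eval]
  congr 1
  exact Subsingleton.elim _ _

theorem theorem2 :
    ∃ (prog : Prog) (P : MvPolynomial (Fin 4) ℕ),
      ∀ (G : Game), G.PerfectRecall → ∀ (T K : ℕ) (π : G.Mixture T K),
        ∃ (π' : G.Mixture T K) (steps : ℕ),
          prog.Runs (Data.pair G.encode π.encode) π'.encode steps ∧
          (∀ b : ℕ, G.numPlayers ≤ G.numHist → G.BitsLe b → π.BitsLe b →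
            steps ≤ MvPolynomial.eval ![G.numHist, T, K, b] P) ∧
          π.IsConversion π' ∧
          π.toCorrelated.OutcomeEquiv π'.toCorrelated ∧
          ∀ ε : ℝ, π.toCorrelated.IsEFCE ε → π'.toCorrelated.IsBCE ε := by
  obtain ⟨p, q, h⟩ := RawGame.polyTime_convert
  -- The time bound in the input length, with the bound on that length substituted; program and
  -- polynomial are chosen before the game and do not involve `ε`.
  refine ⟨p, Polynomial.aeval Game.inputPoly q, fun G hG T K π => ?_⟩
  obtain ⟨π', he, hc⟩ := hG.exists_convert_eq π
  obtain ⟨k, hr, hk⟩ := h (G.raw, π.raw)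
  dsimp only at hr
  rw [Game.enc_pair, Game.enc_raw, π.enc_raw, he, π'.enc_raw] at hr
  refine ⟨π', k, hr, fun b hn hb hb' => ?_, hc, hG.outcomeEquiv_of_isConversion hc,
    fun ε hε => hG.isBCE_of_isConversion hc hε⟩
  rw [MvPolynomial.eval_aeval_nat]
  exact hk.trans (q.eval_nat_mono (Game.encSize_input_le π hn hb hb'))
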